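/- Let $M$ be a connected smooth $n$-dimensional manifold (Hausdorff, second countable), let $F\to M$ and $G\to M$ be smooth real vector bundles of finite rank, and let $e\colon\Gamma(F)\to\Gamma(G)$ be a linear differential operator with smooth coefficients (for example, the linearization $e_\varphi$ of a PDE system at a background solution $\varphi$). Let $\mathcal{E}^\infty\subseteq J^\infty F$ be the zero set of its infinite prolongation $p_\infty e\colon J^\infty F\to J^\infty G$. Let $\Omega^{k,0}(F)$ be the space of local horizontal $k$-forms, i.e. horizontal $k$-forms on $J^\infty F$ that depend smoothly on $x$ and on finitely many (a bounded order of) jet coordinates, and let $d_h$ be the horizontal differential, $(d_h\omega)[\psi]=d(\omega[\psi])$ for $\psi\in\Gamma(F)$, where $\omega[\psi]=(j^\infty\psi)^*\omega$. A local horizontal form is *null* if it vanishes on $\mathcal{E}^\infty$; write $\hat\Omega^{k,0}(\mathcal E)$ for the null forms and $\Omega^{k,0}(\mathcal E)=\Omega^{k,0}(F)/\hat\Omega^{k,0}(\mathcal E)$ for the on-shell forms. Define the real vector spaces: * $H^k_{\mathrm{null}}(\mathcal E)$: null forms $\rho\in\hat\Omega^{k,0}(\mathcal E)$ with $d_h\rho=0$,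 and with vanishing Euler–Lagrange derivative $\delta_{EL}\rho=0$ if $k=n$ (the arrow leaving $\Omega^{n,0}(F)$ in the variational bicomplex is $\delta_{EL}$), modulo null forms $d_hj$ with $j\in\hat\Omega^{k-1,0}(\mathcal E)$; * $H^p_{\mathrm{src}}(\mathcal E)$: null $p$-sources, i.e. null forms $\rho\in\hat\Omega^{n-p,0}(\mathcal E)$ with $\rho=d_hj$ for some $j\in\Omega^{n-p-1,0}(F)$ not necessarily null, modulo null forms $d_hj$ with $j\in\hat\Omega^{n-p-1,0}(\mathcal E)$; * $H^k_{\mathrm{char}}(\mathcal E)$, $k<n$: on-shell forms $[j]\in\Omega^{k,0}(\mathcal E)$ with a representative $j$ such that $d_hj$ is null, modulo classes of forms $d_hi$, $i\in\Omega^{k-1,0}(F)$; * $H^p_{\mathrm{cur}}(\mathcal E)=H^{n-p}_{\mathrm{char}}(\mathcal E)/H^{n-p}_{\mathrm{dR}}(M)$, the conserved $p$-currents, where $H_{\mathrm{dR}}^{k}(M)\to H_{\mathrm{char}}^{k}(\mathcal E)$ is induced by pulling forms on $M$ back to $J^\infty F$ and restricting them to $\mathcal E^\infty$. (There are no nonzero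 forms of degree $-1$.) Then $H^n_{\mathrm{src}}(\mathcal E)=0$ and $H^0_{\mathrm{null}}(\mathcal E)=0$. For every $0\le p<n$ the map $H^{n-p-1}_{\mathrm{dR}}(M)\to H^{n-p-1}_{\mathrm{char}}(\mathcal E)$ is injective, and $$H^p_{\mathrm{src}}(\mathcal E)\;\cong\;H^{n-p}_{\mathrm{null}}(\mathcal E)\;\cong\;H^{n-p-1}_{\mathrm{char}}(\mathcal E)/H^{n-p-1}_{\mathrm{dR}}(M)\;=\;H^{p+1}_{\mathrm{cur}}(\mathcal E)$$ as real vector spaces. More precisely, every null $p$-source is a cocycle of the null complex and $[\rho]\mapsto[\rho]$ is an isomorphism $H^p_{\mathrm{src}}(\mathcal E)\to H^{n-p}_{\mathrm{null}}(\mathcal E)$, while $[j]\mapsto[\rho]$, $\rho=d_hj$ (for representatives $j$ with $d_hj$ null), is an isomorphism $H^{n-p-1}_{\mathrm{char}}(\mathcal E)/H^{n-p-1}_{\mathrm{dR}}(M)\to H^p_{\mathrm{src}}(\mathcal E)$. -/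

import Mathlib

open Bundle Manifold MeasureTheory
open scoped ContDiff Topology

namespace VarBicomplex

set_option linter.unusedSectionVars false

noncomputable section

/-! ## Differential forms on a manifold -/

section Forms

/-- The coordinate space `ℝⁿ`. -/
abbrev Coord (n : ℕ) : Type := EuclideanSpace ℝ (Fin n)

variable (n : ℕ) (M : Type*) [TopologicalSpace M] [ChartedSpace (Coord n) M]

/-- A (not necessarily smooth) field of alternating `k`-forms on the tangent spaces of `M`. -/
def RawForm (k : ℕ) : Type _ := (x : M) → TangentSpace (𝓡 n) x [⋀^Fin k]→L[ℝ] ℝ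

instance (k : ℕ) : AddCommGroup (RawForm n M k) :=
  inferInstanceAs (AddCommGroup ((x : M) → TangentSpace (𝓡 n) x [⋀^Fin k]→L[ℝ] ℝ))

instance (k : ℕ) : Module ℝ (RawForm n M k) :=
  inferInstanceAs (Module ℝ ((x : M) → TangentSpace (𝓡 n) x [⋀^Fin k]→L[ℝ] ℝ))

variable {n M}

/-- The coordinate expression of a field of `k`-forms in the chart at `x₀`, i.e. its pullback along
the inverse of the chart. -/
def formInChart {k : ℕ} (α : RawForm n M k) (x₀ : M) (y : Coord n) : Coord n [⋀^Fin k]→L[ℝ] ℝ :=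
  (α ((extChartAt (𝓡 n) x₀).symm y)).compContinuousLinearMap
    (mfderiv 𝓘(ℝ, Coord n) (𝓡 n) (extChartAt (𝓡 n) x₀).symm y : Coord n →L[ℝ] _)

/-- The exterior derivative at `x`, computed in the chart at `x`. -/
def extDerivAt {k : ℕ} (α : RawForm n M k) (x : M) :
    TangentSpace (𝓡 n) x [⋀^Fin (k + 1)]→L[ℝ] ℝ :=
  (extDeriv (formInChart α x) (extChartAt (𝓡 n) x x)).compContinuousLinearMap
    (mfderiv (𝓡 n) 𝓘(ℝ, Coord n) (extChartAt (𝓡 n) x) x : _ →L[ℝ] Coord n)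

/-- `IsExtDeriv α β` means `β = dα`. (The degree of `β` is one more than the degree of `α`; it is
kept as a free index `l` with `l = k + 1`, so that degrees such as `n - p` can be used.) -/
def IsExtDeriv {k l : ℕ} (α : RawForm n M k) (β : RawForm n M l) : Prop :=
  ∃ h : l = k + 1, ∀ (x : M) (v : Fin l → TangentSpace (𝓡 n) x),
    β x v = extDerivAt α x (fun i => v (Fin.cast h.symm i))

/-- A field of `k`-forms is smooth if its coordinate expressions are. -/
def IsSmoothForm {k : ℕ} (α : RawForm n M k) : Prop :=
  ∀ x₀ : M, ContDiffOn ℝ ∞ (formInChart α x₀) (extChartAt (𝓡 n) x₀).target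

theorem formInChart_add {k : ℕ} (α β : RawForm n M k) (x₀ : M) :
    formInChart (α + β) x₀ = formInChart α x₀ + formInChart β x₀ := rfl

theorem formInChart_smul {k : ℕ} (c : ℝ) (α : RawForm n M k) (x₀ : M) :
    formInChart (c • α) x₀ = c • formInChart α x₀ := rfl

theorem formInChart_zero {k : ℕ} (x₀ : M) :
    formInChart (0 : RawForm n M k) x₀ = 0 := rfl

variable (n M) in
/-- `Ωᵏ(M)`: the space of smooth `k`-forms on `M`. -/
def SmoothForm (k : ℕ) : Submodule ℝ (RawForm n M k) where
  carrier := {α | IsSmoothForm α}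
  add_mem' hα hβ x₀ := by
    rw [formInChart_add]
    exact (hα x₀).add (hβ x₀)
  zero_mem' x₀ := by
    rw [formInChart_zero]
    exact contDiffOn_const
  smul_mem' c α hα x₀ := by
    rw [formInChart_smul]
    exact (hα x₀).const_smul c

/-- The coordinate expression at the base point of the chart is differentiable. -/
def DiffInChart {k : ℕ} (α : RawForm n M k) : Prop :=
  ∀ x : M, DifferentiableAt ℝ (formInChart α x) (extChartAt (𝓡 n) x x)

theorem IsSmoothForm.diffInChart {k : ℕ} {α : RawForm n M k} (hα : IsSmoothForm α) :
    DiffInChart α := fun x =>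
  ((hα x).contDiffAt (extChartAt_target_mem_nhds x)).differentiableAt (by simp)

theorem extDerivAt_add {k : ℕ} {α β : RawForm n M k} (hα : DiffInChart α) (hβ : DiffInChart β)
    (x : M) : extDerivAt (α + β) x = extDerivAt α x + extDerivAt β x := by
  unfold extDerivAt
  rw [formInChart_add, extDeriv_add (hα x) (hβ x)]
  rfl

theorem extDerivAt_smul {k : ℕ} (c : ℝ) (α : RawForm n M k) (x : M) :
    extDerivAt (c • α) x = c • extDerivAt α x := by
  unfold extDerivAt
  rw [formInChart_smul, extDeriv_smul]
  rfl

theorem IsExtDeriv.add {k l : ℕ} {α α' : RawForm n M k} {β β' : RawForm n M l}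
    (hα : DiffInChart α) (hα' : DiffInChart α') (h : IsExtDeriv α β) (h' : IsExtDeriv α' β') :
    IsExtDeriv (α + α') (β + β') := by
  obtain ⟨e, h⟩ := h
  obtain ⟨_, h'⟩ := h'
  refine ⟨e, fun x v => ?_⟩
  rw [extDerivAt_add hα hα']
  exact congrArg₂ (· + ·) (h x v) (h' x v)

theorem IsExtDeriv.smul {k l : ℕ} (c : ℝ) {α : RawForm n M k} {β : RawForm n M l}
    (h : IsExtDeriv α β) : IsExtDeriv (c • α) (c • β) := by
  obtain ⟨e, h⟩ := h
  refine ⟨e, fun x v => ?_⟩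
  rw [extDerivAt_smul]
  exact congrArg (c • ·) (h x v)

theorem IsExtDeriv.zero (k : ℕ) :
    IsExtDeriv (0 : RawForm n M k) (0 : RawForm n M (k + 1)) := by
  refine ⟨rfl, fun x v => ?_⟩
  have := extDerivAt_smul (0 : ℝ) (0 : RawForm n M k) x
  rw [zero_smul, zero_smul] at this
  rw [this]
  rfl

variable (n M) in
/-- Closed smooth `k`-forms. -/
def closedForms (k : ℕ) : Submodule ℝ (RawForm n M k) where
  carrier := {α | α ∈ SmoothForm n M k ∧ IsExtDeriv α (0 : RawForm n M (k + 1))}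
  add_mem' hα hβ := by
    refine ⟨add_mem hα.1 hβ.1, ?_⟩
    have := hα.2.add (IsSmoothForm.diffInChart hα.1) (IsSmoothForm.diffInChart hβ.1) hβ.2
    rwa [add_zero] at this
  zero_mem' := ⟨zero_mem _, IsExtDeriv.zero k⟩
  smul_mem' c α hα := by
    refine ⟨Submodule.smul_mem _ c hα.1, ?_⟩
    have := hα.2.smul c
    rwa [smul_zero] at this

variable (n M) in
/-- Exact smooth `k`-forms: the differentials of smooth `(k-1)`-forms (in degree `0` only `0`). -/
def exactForms (k : ℕ) : Submodule ℝ (RawForm n M k) where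
  carrier := {α | α ∈ SmoothForm n M k ∧
    (α = 0 ∨ ∃ (m : ℕ) (β : RawForm n M m), β ∈ SmoothForm n M m ∧ IsExtDeriv β α)}
  add_mem' := by
    rintro α α' ⟨hα, h⟩ ⟨hα', h'⟩
    refine ⟨add_mem hα hα', ?_⟩
    rcases h with rfl | ⟨m, β, hβ, h⟩
    · rwa [zero_add]
    rcases h' with rfl | ⟨m', β', hβ', h'⟩
    · rw [add_zero]
      exact Or.inr ⟨m, β, hβ, h⟩
    obtain rfl : m = m' := by
      obtain ⟨e, -⟩ := h
      obtain ⟨e', -⟩ := h'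
      omega
    exact Or.inr ⟨m, β + β', add_mem hβ hβ',
      h.add (IsSmoothForm.diffInChart hβ) (IsSmoothForm.diffInChart hβ') h'⟩
  zero_mem' := ⟨zero_mem _, Or.inl rfl⟩
  smul_mem' := by
    rintro c α ⟨hα, h⟩
    refine ⟨Submodule.smul_mem _ c hα, ?_⟩
    rcases h with rfl | ⟨m, β, hβ, h⟩
    · exact Or.inl (smul_zero c)
    · exact Or.inr ⟨m, c • β, Submodule.smul_mem _ c hβ, h.smul c⟩

variable (n M) in
/-- De Rham cohomology `H^k_dR(M)`: closed forms modulo exact forms. -/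
abbrev HdR (k : ℕ) : Type _ :=
  closedForms n M k ⧸ (exactForms n M k).submoduleOf (closedForms n M k)

end Forms

/-! ## Infinite jets -/

section Jets

variable (n : ℕ) {M : Type*} [TopologicalSpace M] [ChartedSpace (Coord n) M]
  (Fm : Type*) [NormedAddCommGroup Fm] [NormedSpace ℝ Fm]
  (F : M → Type*) [TopologicalSpace (TotalSpace Fm F)] [∀ x, TopologicalSpace (F x)]
  [FiberBundle Fm F]

/-- `Γ(F)`: smooth sections of the vector bundle `F → M`. -/
abbrev Sec : Type _ := ContMDiffSection (𝓡 n) Fm ∞ F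

/-- The domain, in `ℝⁿ`, of the adapted coordinates of `F` at `x₀`: the part of the target of the
chart of `M` at `x₀` over which the trivialization of `F` at `x₀` is defined. -/
def adaptedTarget (x₀ : M) : Set (Coord n) :=
  (extChartAt (𝓡 n) x₀).target ∩
    (extChartAt (𝓡 n) x₀).symm ⁻¹' (trivializationAt Fm F x₀).baseSet

variable {n Fm F}

/-- The coordinate expression `u^a(x)` of a section in the adapted coordinates at `x₀`. -/
def secInChart (ψ : Sec n Fm F) (x₀ : M) (y : Coord n) : Fm :=
  (trivializationAt Fm F x₀
    ⟨(extChartAt (𝓡 n) x₀).symm y, ψ ((extChartAt (𝓡 n) x₀).symm y)⟩).2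

/-- The values of the jet coordinates `(∂_I u^a)`, `|I| ≤ r`, of a section at the point with
coordinate `y`; the derivatives of order `i` are collected in the `i`-th Fréchet derivative. -/
def jetCoord (r : ℕ) (ψ : Sec n Fm F) (x₀ : M) (y : Coord n) :
    (i : Fin (r + 1)) → Coord n [×(i : ℕ)]→L[ℝ] Fm :=
  fun i => iteratedFDeriv ℝ (i : ℕ) (secInChart ψ x₀) y

variable (n Fm F) in
/-- Two sections have the same `∞`-jet at `x` if all their derivatives at `x` agree. -/
def jetSetoid (x : M) : Setoid (Sec n Fm F) where
  r ψ χ := ∀ i : ℕ, iteratedFDeriv ℝ i (secInChart ψ x) (extChartAt (𝓡 n) x x) =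
    iteratedFDeriv ℝ i (secInChart χ x) (extChartAt (𝓡 n) x x)
  iseqv := ⟨fun _ _ => rfl, fun h i => (h i).symm, fun h h' i => (h i).trans (h' i)⟩

variable (n Fm F) in
/-- The infinite jet bundle `J^∞F`: pairs of a point `x` and an `∞`-jet of sections at `x`. -/
def JetSpace : Type _ := Σ x : M, Quotient (jetSetoid n Fm F x)

/-- The `∞`-jet prolongation `j^∞ψ : M → J^∞F`. -/
def prolong (ψ : Sec n Fm F) (x : M) : JetSpace n Fm F :=
  ⟨x, Quotient.mk (jetSetoid n Fm F x) ψ⟩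

/-! ## Local horizontal forms -/

variable (n Fm F) in
/-- A field `ρ` assigning to every `θ ∈ J^∞F` over `x` an alternating `k`-form on `T_xM`. -/
def RawLocalForm (k : ℕ) : Type _ :=
  (θ : JetSpace n Fm F) → TangentSpace (𝓡 n) θ.1 [⋀^Fin k]→L[ℝ] ℝ

instance (k : ℕ) : AddCommGroup (RawLocalForm n Fm F k) :=
  inferInstanceAs
    (AddCommGroup ((θ : JetSpace n Fm F) → TangentSpace (𝓡 n) θ.1 [⋀^Fin k]→L[ℝ] ℝ))

instance (k : ℕ) : Module ℝ (RawLocalForm n Fm F k) :=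
  inferInstanceAs
    (Module ℝ ((θ : JetSpace n Fm F) → TangentSpace (𝓡 n) θ.1 [⋀^Fin k]→L[ℝ] ℝ))

/-- `ρ[ψ] = ρ ∘ j^∞ψ`, a field of `k`-forms on `M`. -/
def RawLocalForm.along {k : ℕ} (ρ : RawLocalForm n Fm F k) (ψ : Sec n Fm F) : RawForm n M k :=
  fun x => ρ (prolong ψ x)

/-- Smoothness of a horizontal form on `J^∞F`: for some finite order `r`, the components of `ρ` are
in all adapted coordinates smooth functions of `(x^i, u^a_I)`, `|I| ≤ r`. -/
def IsLocalForm {k : ℕ} (ρ : RawLocalForm n Fm F k) : Prop :=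
  ∃ r : ℕ, ∀ x₀ : M,
    ∃ f : Coord n × ((i : Fin (r + 1)) → Coord n [×(i : ℕ)]→L[ℝ] Fm) → Coord n [⋀^Fin k]→L[ℝ] ℝ,
      ContDiffOn ℝ ∞ f (adaptedTarget n Fm F x₀ ×ˢ Set.univ) ∧
      ∀ (ψ : Sec n Fm F), ∀ y ∈ adaptedTarget n Fm F x₀,
        formInChart (ρ.along ψ) x₀ y = f (y, jetCoord r ψ x₀ y)

/-- A form factoring through the `r`-jet also factors through the `s`-jet for `r ≤ s`. -/
theorem exists_factor_mono {k : ℕ} {ρ : RawLocalForm n Fm F k} {r s : ℕ} (hrs : r ≤ s) {x₀ : M}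
    (h : ∃ f : Coord n × ((i : Fin (r + 1)) → Coord n [×(i : ℕ)]→L[ℝ] Fm) →
        Coord n [⋀^Fin k]→L[ℝ] ℝ,
      ContDiffOn ℝ ∞ f (adaptedTarget n Fm F x₀ ×ˢ Set.univ) ∧
      ∀ (ψ : Sec n Fm F), ∀ y ∈ adaptedTarget n Fm F x₀,
        formInChart (ρ.along ψ) x₀ y = f (y, jetCoord r ψ x₀ y)) :
    ∃ f : Coord n × ((i : Fin (s + 1)) → Coord n [×(i : ℕ)]→L[ℝ] Fm) →
        Coord n [⋀^Fin k]→L[ℝ] ℝ,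
      ContDiffOn ℝ ∞ f (adaptedTarget n Fm F x₀ ×ˢ Set.univ) ∧
      ∀ (ψ : Sec n Fm F), ∀ y ∈ adaptedTarget n Fm F x₀,
        formInChart (ρ.along ψ) x₀ y = f (y, jetCoord s ψ x₀ y) := by
  obtain ⟨f, hf, hfψ⟩ := h
  refine ⟨fun p => f (p.1, fun i => p.2 (Fin.castLE (by omega) i)), ?_, fun ψ y hy => hfψ ψ y hy⟩
  have hg : ContDiff ℝ ∞
      (fun p : Coord n × ((i : Fin (s + 1)) → Coord n [×(i : ℕ)]→L[ℝ] Fm) =>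
        ((p.1, fun i : Fin (r + 1) => p.2 (Fin.castLE (by omega) i)) :
          Coord n × ((i : Fin (r + 1)) → Coord n [×(i : ℕ)]→L[ℝ] Fm))) := by
    refine contDiff_fst.prodMk (contDiff_pi.2 fun i => ?_)
    exact (ContinuousLinearMap.proj (R := ℝ)
      (φ := fun i : Fin (s + 1) => Coord n [×(i : ℕ)]→L[ℝ] Fm)
      (Fin.castLE (by omega) i)).contDiff.comp contDiff_snd
  exact hf.comp hg.contDiffOn fun p hp => ⟨hp.1, trivial⟩

variable (n Fm F) in
/-- `Ω^{k,0}(F)`: the space of local horizontal `k`-forms on `J^∞F`. -/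
def LocalForm (k : ℕ) : Submodule ℝ (RawLocalForm n Fm F k) where
  carrier := {ρ | IsLocalForm ρ}
  add_mem' := by
    rintro ρ ρ' ⟨r, h⟩ ⟨r', h'⟩
    refine ⟨max r r', fun x₀ => ?_⟩
    obtain ⟨f, hf, hfψ⟩ := exists_factor_mono (le_max_left r r') (h x₀)
    obtain ⟨f', hf', hfψ'⟩ := exists_factor_mono (le_max_right r r') (h' x₀)
    refine ⟨f + f', hf.add hf', fun ψ y hy => ?_⟩
    exact congrArg₂ (· + ·) (hfψ ψ y hy) (hfψ' ψ y hy)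
  zero_mem' := ⟨0, fun _ => ⟨0, contDiffOn_const, fun _ _ _ => rfl⟩⟩
  smul_mem' := by
    rintro c ρ ⟨r, h⟩
    refine ⟨r, fun x₀ => ?_⟩
    obtain ⟨f, hf, hfψ⟩ := h x₀
    exact ⟨c • f, contDiffOn_const.smul hf, fun ψ y hy => congrArg (c • ·) (hfψ ψ y hy)⟩

/-- The pullback to `J^∞F` of a form on `M`: a field-independent local form. -/
def fieldIndependent (k : ℕ) : RawForm n M k →ₗ[ℝ] RawLocalForm n Fm F k where
  toFun α := fun θ => α θ.1
  map_add' _ _ := rfl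
  map_smul' _ _ := rfl

/-- The horizontal differential: `IsHorizontalDiff j ρ` means `ρ = d_h j`. The differential `d_h` is
characterized by `(j^∞ψ)^* (d_h j) = d ((j^∞ψ)^* j)` for all sections `ψ`. -/
def IsHorizontalDiff {k l : ℕ} (j : RawLocalForm n Fm F k) (ρ : RawLocalForm n Fm F l) : Prop :=
  ∀ ψ : Sec n Fm F, IsExtDeriv (j.along ψ) (ρ.along ψ)

theorem isOpen_adaptedTarget (x₀ : M) : IsOpen (adaptedTarget n Fm F x₀) :=
  (continuousOn_extChartAt_symm x₀).isOpen_inter_preimage (isOpen_extChartAt_target x₀)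
    (trivializationAt Fm F x₀).open_baseSet

theorem mem_adaptedTarget (x₀ : M) : extChartAt (𝓡 n) x₀ x₀ ∈ adaptedTarget n Fm F x₀ := by
  refine ⟨mem_extChartAt_target x₀, ?_⟩
  rw [Set.mem_preimage, extChartAt_to_inv]
  exact FiberBundle.mem_baseSet_trivializationAt' x₀

section Smoothness

variable [IsManifold (𝓡 n) ∞ M] [∀ x, AddCommGroup (F x)] [∀ x, Module ℝ (F x)]
  [VectorBundle ℝ Fm F] [ContMDiffVectorBundle ∞ Fm F (𝓡 n)]

theorem contDiffOn_secInChart (ψ : Sec n Fm F) (x₀ : M) :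
    ContDiffOn ℝ ∞ (secInChart ψ x₀) (adaptedTarget n Fm F x₀) := by
  rw [← contMDiffOn_iff_contDiffOn]
  have h1 : ContMDiffOn (𝓡 n) 𝓘(ℝ, Fm) ∞
      (fun x => (trivializationAt Fm F x₀ ⟨x, ψ x⟩).2) (trivializationAt Fm F x₀).baseSet := by
    intro x hx
    exact (((trivializationAt Fm F x₀).contMDiffAt_section_iff hx).1
      (ψ.contMDiff x)).contMDiffWithinAt
  exact h1.comp ((contMDiffOn_extChartAt_symm x₀).mono Set.inter_subset_left) fun y hy => hy.2

theorem contDiffOn_jetCoord (r : ℕ) (ψ : Sec n Fm F) (x₀ : M) :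
    ContDiffOn ℝ ∞ (jetCoord r ψ x₀) (adaptedTarget n Fm F x₀) := by
  refine contDiffOn_pi.2 fun i => ?_
  have h := contDiffOn_secInChart ψ x₀
  have ho := isOpen_adaptedTarget (n := n) (Fm := Fm) (F := F) x₀
  intro y hy
  refine ContDiffAt.contDiffWithinAt ?_
  exact (h.contDiffAt (ho.mem_nhds hy)).iteratedFDeriv_right (i := (i : ℕ)) (by exact_mod_cast le_top)

theorem IsLocalForm.diffInChart {k : ℕ} {ρ : RawLocalForm n Fm F k} (hρ : IsLocalForm ρ)
    (ψ : Sec n Fm F) : DiffInChart (ρ.along ψ) := by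
  intro x₀
  obtain ⟨r, h⟩ := hρ
  obtain ⟨f, hf, hfψ⟩ := h x₀
  have h1 : ContDiffOn ℝ ∞ (formInChart (ρ.along ψ) x₀) (adaptedTarget n Fm F x₀) :=
    (hf.comp (contDiffOn_id.prodMk (contDiffOn_jetCoord r ψ x₀))
      fun y hy => ⟨hy, trivial⟩).congr fun y hy => hfψ ψ y hy
  exact (h1.contDiffAt ((isOpen_adaptedTarget x₀).mem_nhds (mem_adaptedTarget x₀))).differentiableAt
    (by simp)

theorem secInChart_add_smul (ψ η : Sec n Fm F) (t : ℝ) (x₀ : M) {y : Coord n}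
    (hy : y ∈ adaptedTarget n Fm F x₀) :
    secInChart (ψ + t • η) x₀ y = secInChart ψ x₀ y + t • secInChart η x₀ y := by
  have hl := (trivializationAt Fm F x₀).linear ℝ hy.2
  unfold secInChart
  rw [ContMDiffSection.coe_add, ContMDiffSection.coe_smul]
  exact (hl.1 _ _).trans (congrArg _ (hl.2 t _))

theorem jetCoord_add_smul (r : ℕ) (ψ η : Sec n Fm F) (t : ℝ) (x₀ : M) {y : Coord n}
    (hy : y ∈ adaptedTarget n Fm F x₀) :
    jetCoord r (ψ + t • η) x₀ y = jetCoord r ψ x₀ y + t • jetCoord r η x₀ y := by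
  funext i
  have ho := (isOpen_adaptedTarget (n := n) (Fm := Fm) (F := F) x₀).mem_nhds hy
  have h1 : ContDiffAt ℝ (i : ℕ) (secInChart ψ x₀) y :=
    ((contDiffOn_secInChart ψ x₀).contDiffAt ho).of_le (by exact_mod_cast le_top)
  have h2 : ContDiffAt ℝ (i : ℕ) (secInChart η x₀) y :=
    ((contDiffOn_secInChart η x₀).contDiffAt ho).of_le (by exact_mod_cast le_top)
  have h3 : secInChart (ψ + t • η) x₀ =ᶠ[𝓝 y] secInChart ψ x₀ + t • secInChart η x₀ := by
    filter_upwards [ho] with z hz using secInChart_add_smul ψ η t x₀ hz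
  have h4 := (h3.iteratedFDeriv ℝ (i : ℕ)).eq_of_nhds
  have h5 := iteratedFDeriv_const_smul_apply (a := t) h2
  have h6 := iteratedFDeriv_add_apply h1 (h2.const_smul t)
  exact h4.trans (h6.trans (congrArg _ h5))

/-- The first variation `d/dt|_{t=0} L[ψ + tη]` of a local form in the adapted coordinates at `x₀`,
evaluated on the vectors `v`. -/
def firstVariation {k : ℕ} (L : RawLocalForm n Fm F k) (ψ η : Sec n Fm F) (x₀ : M)
    (v : Fin k → Coord n) (y : Coord n) : ℝ :=
  deriv (fun t : ℝ => formInChart (L.along (ψ + t • η)) x₀ y v) 0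

/-- `η` is compactly supported inside the domain of the adapted coordinates at `x₀`. -/
def HasAdaptedSupport (η : Sec n Fm F) (x₀ : M) : Prop :=
  ∃ K : Set (Coord n), IsCompact K ∧ K ⊆ adaptedTarget n Fm F x₀ ∧
    ∀ x : M, x ∉ (extChartAt (𝓡 n) x₀).symm '' K → η x = 0

/-- `δ_EL L = 0`, for a local form `L` of top degree `n`: the Euler-Lagrange derivative, i.e. the
coefficient of `η` in the first variation of `∫ L` after integration by parts, vanishes identically
on `J^∞F`. In other words, every section `ψ` is stationary for `∫ L` under all variations `η` with
compact support in a coordinate domain. -/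
def EulerLagrangeVanishes {k : ℕ} (L : RawLocalForm n Fm F k) : Prop :=
  ∀ (x₀ : M) (ψ η : Sec n Fm F), HasAdaptedSupport η x₀ → ∀ v : Fin k → Coord n,
    ∫ y in adaptedTarget n Fm F x₀, firstVariation L ψ η x₀ v y = 0

theorem firstVariation_aux {k : ℕ} {L : RawLocalForm n Fm F k} (hL : IsLocalForm L)
    (ψ η : Sec n Fm F) (x₀ : M) (v : Fin k → Coord n) :
    (∀ y ∈ adaptedTarget n Fm F x₀,
      DifferentiableAt ℝ (fun t : ℝ => formInChart (L.along (ψ + t • η)) x₀ y v) 0) ∧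
    (HasAdaptedSupport η x₀ →
      IntegrableOn (firstVariation L ψ η x₀ v) (adaptedTarget n Fm F x₀)) := by
  obtain ⟨r, h⟩ := hL
  obtain ⟨f, hf, hfψ⟩ := h x₀
  have ho := isOpen_adaptedTarget (n := n) (Fm := Fm) (F := F) x₀
  have hou := ho.prod (isOpen_univ (X := (i : Fin (r + 1)) → Coord n [×(i : ℕ)]→L[ℝ] Fm))
  let ev : (Coord n [⋀^Fin k]→L[ℝ] ℝ) →L[ℝ] ℝ := ContinuousAlternatingMap.apply ℝ (Coord n) ℝ v
  have hd : ∀ y ∈ adaptedTarget n Fm F x₀,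
      HasDerivAt (fun t : ℝ => formInChart (L.along (ψ + t • η)) x₀ y v)
        (ev (fderiv ℝ f (y, jetCoord r ψ x₀ y) (0, jetCoord r η x₀ y))) 0 := by
    intro y hy
    have e : (fun t : ℝ => formInChart (L.along (ψ + t • η)) x₀ y v) =
        fun t : ℝ => ev (f (y, jetCoord r ψ x₀ y + t • jetCoord r η x₀ y)) := by
      funext t
      rw [hfψ _ y hy, jetCoord_add_smul r ψ η t x₀ hy]
      rfl
    rw [e]
    have hfd : HasFDerivAt f (fderiv ℝ f (y, jetCoord r ψ x₀ y)) (y, jetCoord r ψ x₀ y) :=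
      ((hf.contDiffAt (hou.mem_nhds ⟨hy, trivial⟩)).differentiableAt (by simp)).hasFDerivAt
    have hc : HasDerivAt (fun t : ℝ => (y, jetCoord r ψ x₀ y + t • jetCoord r η x₀ y))
        (0, jetCoord r η x₀ y) 0 := by
      refine (hasDerivAt_const (0 : ℝ) y).prodMk ?_
      simpa using ((hasDerivAt_id (0 : ℝ)).smul_const (jetCoord r η x₀ y)).const_add
        (jetCoord r ψ x₀ y)
    have hfd' : HasFDerivAt f (fderiv ℝ f (y, jetCoord r ψ x₀ y))
        (y, jetCoord r ψ x₀ y + (0 : ℝ) • jetCoord r η x₀ y) := by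
      rwa [zero_smul, add_zero]
    exact ev.hasFDerivAt.comp_hasDerivAt (0 : ℝ) (hfd'.comp_hasDerivAt (0 : ℝ) hc)
  refine ⟨fun y hy => (hd y hy).differentiableAt, ?_⟩
  rintro ⟨K, hK, hKU, hKη⟩
  have hcont : ContinuousOn (firstVariation L ψ η x₀ v) (adaptedTarget n Fm F x₀) := by
    have h1 : ContinuousOn
        (fun y => ev (fderiv ℝ f (y, jetCoord r ψ x₀ y) (0, jetCoord r η x₀ y)))
        (adaptedTarget n Fm F x₀) := by
      refine ev.continuous.comp_continuousOn ?_
      have h2 : ContinuousOn (fderiv ℝ f) (adaptedTarget n Fm F x₀ ×ˢ Set.univ) :=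
        hf.continuousOn_fderiv_of_isOpen hou (by simp)
      have h3 : ContinuousOn (fun y => fderiv ℝ f (y, jetCoord r ψ x₀ y))
          (adaptedTarget n Fm F x₀) :=
        h2.comp (continuousOn_id.prodMk (contDiffOn_jetCoord r ψ x₀).continuousOn)
          fun y hy => ⟨hy, trivial⟩
      exact h3.clm_apply (continuousOn_const.prodMk (contDiffOn_jetCoord r η x₀).continuousOn)
    exact h1.congr fun y hy => (hd y hy).deriv
  have hz : ∀ y ∈ adaptedTarget n Fm F x₀ \ K, firstVariation L ψ η x₀ v y = 0 := by
    intro y hy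
    have hnear : secInChart η x₀ =ᶠ[𝓝 y] fun _ => (0 : Fm) := by
      filter_upwards [(ho.sdiff hK.isClosed).mem_nhds hy] with z hz
      have hη : η ((extChartAt (𝓡 n) x₀).symm z) = 0 := by
        refine hKη _ ?_
        rintro ⟨w, hw, hwz⟩
        have := (extChartAt (𝓡 n) x₀).symm.injOn (hKU hw).1 hz.1.1 hwz
        exact hz.2 (this ▸ hw)
      unfold secInChart
      rw [hη]
      exact ((trivializationAt Fm F x₀).linear ℝ hz.1.2).map_zero
    have hjet : jetCoord r η x₀ y = 0 := by
      funext i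
      have := (hnear.iteratedFDeriv ℝ (i : ℕ)).eq_of_nhds
      refine this.trans ?_
      exact congrFun (iteratedFDeriv_fun_zero (n := (i : ℕ))) y
    refine (hd y hy.1).deriv.trans ?_
    rw [hjet]
    have h0 : ((0 : Coord n), (0 : (i : Fin (r + 1)) → Coord n [×(i : ℕ)]→L[ℝ] Fm)) = 0 := rfl
    rw [h0, map_zero, map_zero]
  exact ((hcont.mono hKU).integrableOn_compact hK).of_forall_sdiff_eq_zero ho.measurableSet hz

theorem EulerLagrangeVanishes.add {k : ℕ} {L L' : RawLocalForm n Fm F k} (hL : IsLocalForm L)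
    (hL' : IsLocalForm L') (h : EulerLagrangeVanishes L) (h' : EulerLagrangeVanishes L') :
    EulerLagrangeVanishes (L + L') := by
  intro x₀ ψ η hη v
  have e : Set.EqOn (firstVariation (L + L') ψ η x₀ v)
      (fun y => firstVariation L ψ η x₀ v y + firstVariation L' ψ η x₀ v y)
      (adaptedTarget n Fm F x₀) := fun y hy =>
    deriv_fun_add ((firstVariation_aux hL ψ η x₀ v).1 y hy)
      ((firstVariation_aux hL' ψ η x₀ v).1 y hy)
  rw [setIntegral_congr_fun (isOpen_adaptedTarget x₀).measurableSet e,
    integral_add ((firstVariation_aux hL ψ η x₀ v).2 hη) ((firstVariation_aux hL' ψ η x₀ v).2 hη),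
    h x₀ ψ η hη v, h' x₀ ψ η hη v, add_zero]

theorem EulerLagrangeVanishes.smul {k : ℕ} {L : RawLocalForm n Fm F k} (hL : IsLocalForm L)
    (c : ℝ) (h : EulerLagrangeVanishes L) : EulerLagrangeVanishes (c • L) := by
  intro x₀ ψ η hη v
  have e : Set.EqOn (firstVariation (c • L) ψ η x₀ v)
      (fun y => c * firstVariation L ψ η x₀ v y) (adaptedTarget n Fm F x₀) := fun y hy =>
    deriv_const_mul c ((firstVariation_aux hL ψ η x₀ v).1 y hy)
  rw [setIntegral_congr_fun (isOpen_adaptedTarget x₀).measurableSet e, integral_const_mul,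
    h x₀ ψ η hη v, mul_zero]

theorem IsHorizontalDiff.add {k l : ℕ} {j j' : RawLocalForm n Fm F k}
    {ρ ρ' : RawLocalForm n Fm F l} (hj : IsLocalForm j) (hj' : IsLocalForm j')
    (h : IsHorizontalDiff j ρ) (h' : IsHorizontalDiff j' ρ') :
    IsHorizontalDiff (j + j') (ρ + ρ') := fun ψ =>
  (h ψ).add (hj.diffInChart ψ) (hj'.diffInChart ψ) (h' ψ)

theorem IsHorizontalDiff.smul {k l : ℕ} (c : ℝ) {j : RawLocalForm n Fm F k}
    {ρ : RawLocalForm n Fm F l} (h : IsHorizontalDiff j ρ) :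
    IsHorizontalDiff (c • j) (c • ρ) := fun ψ => (h ψ).smul c

theorem IsHorizontalDiff.zero (k : ℕ) :
    IsHorizontalDiff (0 : RawLocalForm n Fm F k) (0 : RawLocalForm n Fm F (k + 1)) := fun _ =>
  IsExtDeriv.zero k

/-- The horizontal differentials `d_h j` of those local `(k-1)`-forms `j` that belong to `S`, as a
space of `k`-forms (in degree `0` only `0`). -/
def horizontalImage (S : (m : ℕ) → Submodule ℝ (RawLocalForm n Fm F m)) (k : ℕ) :
    Submodule ℝ (RawLocalForm n Fm F k) where
  carrier := {ρ | ρ = 0 ∨ ∃ (m : ℕ) (j : RawLocalForm n Fm F m),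
    j ∈ LocalForm n Fm F m ⊓ S m ∧ IsHorizontalDiff j ρ}
  add_mem' := by
    rintro ρ ρ' h h'
    rcases h with rfl | ⟨m, j, hj, h⟩
    · rwa [zero_add]
    rcases h' with rfl | ⟨m', j', hj', h'⟩
    · rw [add_zero]
      exact Or.inr ⟨m, j, hj, h⟩
    obtain rfl : m = m' := by
      obtain ⟨e, -⟩ := h 0
      obtain ⟨e', -⟩ := h' 0
      omega
    exact Or.inr ⟨m, j + j', add_mem hj hj', h.add hj.1 hj'.1 h'⟩
  zero_mem' := Or.inl rfl
  smul_mem' := by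
    rintro c ρ h
    rcases h with rfl | ⟨m, j, hj, h⟩
    · exact Or.inl (smul_zero c)
    · exact Or.inr ⟨m, c • j, Submodule.smul_mem _ c hj, h.smul c⟩

end Smoothness

end Jets

/-! ## Linear PDE systems: on-shell forms, null forms, and their cohomologies -/

section PDE

variable {n : ℕ} {M : Type*} [TopologicalSpace M] [ChartedSpace (Coord n) M]
  [IsManifold (𝓡 n) ∞ M]
  {Fm : Type*} [NormedAddCommGroup Fm] [NormedSpace ℝ Fm]
  {F : M → Type*} [TopologicalSpace (TotalSpace Fm F)] [∀ x, TopologicalSpace (F x)]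
  [FiberBundle Fm F] [∀ x, AddCommGroup (F x)] [∀ x, Module ℝ (F x)]
  [VectorBundle ℝ Fm F] [ContMDiffVectorBundle ∞ Fm F (𝓡 n)]
  {Gm : Type*} [NormedAddCommGroup Gm] [NormedSpace ℝ Gm]
  {G : M → Type*} [TopologicalSpace (TotalSpace Gm G)] [∀ x, TopologicalSpace (G x)]
  [FiberBundle Gm G] [∀ x, AddCommGroup (G x)] [∀ x, Module ℝ (G x)]
  [VectorBundle ℝ Gm G] [ContMDiffVectorBundle ∞ Gm G (𝓡 n)]

/-- The linear map `e : Γ(F) → Γ(G)` is a differential operator of some finite order `r`: in adapted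
coordinates `e[ψ](x)` is a smooth function of `x` and the derivatives of `ψ` at `x` of order at most
`r`. -/
def IsDifferentialOperator (e : Sec n Fm F →ₗ[ℝ] Sec n Gm G) : Prop :=
  ∃ r : ℕ, ∀ x₀ : M,
    ∃ f : Coord n × ((i : Fin (r + 1)) → Coord n [×(i : ℕ)]→L[ℝ] Fm) → Gm,
      ContDiffOn ℝ ∞ f
        ((adaptedTarget n Fm F x₀ ∩ adaptedTarget n Gm G x₀) ×ˢ Set.univ) ∧
      ∀ (ψ : Sec n Fm F), ∀ y ∈ adaptedTarget n Fm F x₀ ∩ adaptedTarget n Gm G x₀,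
        secInChart (e ψ) x₀ y = f (y, jetCoord r ψ x₀ y)

/-- The PDE submanifold `𝓔^∞ ⊆ J^∞F` of the linear system `e[ψ] = 0`: the zero set of the infinite
prolongation `p_∞ e : J^∞F → J^∞G`, `j^∞_x ψ ↦ j^∞_x (e[ψ])`. -/
def pde (e : Sec n Fm F →ₗ[ℝ] Sec n Gm G) : Set (JetSpace n Fm F) :=
  {θ | ∃ ψ : Sec n Fm F, prolong ψ θ.1 = θ ∧ prolong (e ψ) θ.1 = prolong 0 θ.1}

variable (e : Sec n Fm F →ₗ[ℝ] Sec n Gm G)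

/-- Null local horizontal `k`-forms: those that vanish on `𝓔^∞`. -/
def nullForms (k : ℕ) : Submodule ℝ (RawLocalForm n Fm F k) where
  carrier := {ρ | ρ ∈ LocalForm n Fm F k ∧ ∀ θ ∈ pde e, ρ θ = 0}
  add_mem' {ρ ρ'} h h' := ⟨add_mem h.1 h'.1, fun θ hθ => by
    have : (ρ + ρ') θ = ρ θ + ρ' θ := rfl
    rw [this, h.2 θ hθ, h'.2 θ hθ, add_zero]⟩
  zero_mem' := ⟨zero_mem _, fun _ _ => rfl⟩
  smul_mem' c ρ h := ⟨Submodule.smul_mem _ c h.1, fun θ hθ => by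
    have : (c • ρ) θ = c • ρ θ := rfl
    rw [this, h.2 θ hθ, smul_zero]⟩

/-- Cocycles of the complex of null local horizontal forms: `d_h ρ = 0` in degrees `k < n`. In the
top degree `k = n`, where `d_h ρ = 0` always holds, the next arrow of the variational bicomplex is
the Euler-Lagrange derivative, and a cocycle is required to satisfy `δ_EL ρ = 0`. -/
def nullCocycles (k : ℕ) : Submodule ℝ (RawLocalForm n Fm F k) where
  carrier := {ρ | ρ ∈ nullForms e k ∧
    IsHorizontalDiff ρ (0 : RawLocalForm n Fm F (k + 1)) ∧ (k = n → EulerLagrangeVanishes ρ)}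
  add_mem' {ρ ρ'} h h' := by
    refine ⟨add_mem h.1 h'.1, ?_, fun hk => (h.2.2 hk).add h.1.1 h'.1.1 (h'.2.2 hk)⟩
    have := h.2.1.add h.1.1 h'.1.1 h'.2.1
    rwa [add_zero] at this
  zero_mem' := by
    refine ⟨zero_mem _, IsHorizontalDiff.zero k, fun _ x₀ ψ η _ v => ?_⟩
    have h0 : firstVariation (0 : RawLocalForm n Fm F k) ψ η x₀ v = fun _ => 0 := by
      funext y
      exact deriv_const (0 : ℝ) (0 : ℝ)
    rw [h0, integral_zero]
  smul_mem' c ρ h := by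
    refine ⟨Submodule.smul_mem _ c h.1, ?_, fun hk => (h.2.2 hk).smul h.1.1 c⟩
    have := h.2.1.smul c
    rwa [smul_zero] at this

/-- Null forms `ρ = d_h j` with `j` null. -/
def nullCoboundaries (k : ℕ) : Submodule ℝ (RawLocalForm n Fm F k) :=
  nullForms e k ⊓ horizontalImage (nullForms e) k

/-- `H^k_null(𝓔)`. -/
abbrev HNull (k : ℕ) : Type _ :=
  nullCocycles e k ⧸ (nullCoboundaries e k).submoduleOf (nullCocycles e k)

/-- Null local `p`-sources: null local horizontal `(n-p)`-forms `ρ` with `ρ = d_h j` for some local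
horizontal `(n-p-1)`-form `j`. -/
def nullSources (p : ℕ) : Submodule ℝ (RawLocalForm n Fm F (n - p)) :=
  nullForms e (n - p) ⊓ horizontalImage (LocalForm n Fm F) (n - p)

/-- `H^p_src(𝓔)`: null `p`-sources modulo the trivial ones, `ρ = d_h j` with `j` null. -/
abbrev HSrc (p : ℕ) : Type _ :=
  nullSources e p ⧸ (nullCoboundaries e (n - p)).submoduleOf (nullSources e p)

/-- Fields of `k`-forms on `𝓔^∞` with values in the horizontal cotangent directions. -/
def RawOnShellForm (k : ℕ) : Type _ :=
  (θ : pde e) → TangentSpace (𝓡 n) θ.1.1 [⋀^Fin k]→L[ℝ] ℝ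

instance (k : ℕ) : AddCommGroup (RawOnShellForm e k) :=
  inferInstanceAs (AddCommGroup ((θ : pde e) → TangentSpace (𝓡 n) θ.1.1 [⋀^Fin k]→L[ℝ] ℝ))

instance (k : ℕ) : Module ℝ (RawOnShellForm e k) :=
  inferInstanceAs (Module ℝ ((θ : pde e) → TangentSpace (𝓡 n) θ.1.1 [⋀^Fin k]→L[ℝ] ℝ))

/-- Pullback (restriction) of horizontal forms along `𝓔^∞ ⊆ J^∞F`. The space `Ω^{k,0}(𝓔)` of on-shell
forms is the image of `Ω^{k,0}(F)`. -/
def restrict (k : ℕ) : RawLocalForm n Fm F k →ₗ[ℝ] RawOnShellForm e k where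
  toFun ρ := fun θ => ρ θ.1
  map_add' _ _ := rfl
  map_smul' _ _ := rfl

/-- Local forms `j` on `J^∞F` that are conserved: `d_h j` vanishes on `𝓔^∞`. -/
def conservedForms (k : ℕ) : Submodule ℝ (RawLocalForm n Fm F k) where
  carrier := {j | j ∈ LocalForm n Fm F k ∧ ∃ ρ ∈ nullForms e (k + 1), IsHorizontalDiff j ρ}
  add_mem' := by
    rintro j j' ⟨hj, ρ, hρ, h⟩ ⟨hj', ρ', hρ', h'⟩
    exact ⟨add_mem hj hj', ρ + ρ', add_mem hρ hρ', h.add hj hj' h'⟩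
  zero_mem' := ⟨zero_mem _, 0, zero_mem _, IsHorizontalDiff.zero k⟩
  smul_mem' := by
    rintro c j ⟨hj, ρ, hρ, h⟩
    exact ⟨Submodule.smul_mem _ c hj, c • ρ, Submodule.smul_mem _ c hρ, h.smul c⟩

/-- Horizontally closed on-shell `k`-forms. -/
def onShellClosed (k : ℕ) : Submodule ℝ (RawOnShellForm e k) :=
  (conservedForms e k).map (restrict e k)

/-- Horizontally exact on-shell `k`-forms. -/
def onShellExact (k : ℕ) : Submodule ℝ (RawOnShellForm e k) :=
  (LocalForm n Fm F k ⊓ horizontalImage (LocalForm n Fm F) k).map (restrict e k)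

/-- The characteristic cohomology `H^k_char(𝓔)`, the cohomology of on-shell local horizontal forms
(for `k < n`). -/
abbrev HChar (k : ℕ) : Type _ :=
  onShellClosed e k ⧸ (onShellExact e k).submoduleOf (onShellClosed e k)

theorem fieldIndependent_mem {k : ℕ} {α : RawForm n M k} (hα : α ∈ SmoothForm n M k) :
    fieldIndependent k α ∈ LocalForm n Fm F k := by
  refine ⟨0, fun x₀ => ⟨fun p => formInChart α x₀ p.1, ?_, fun _ _ _ => rfl⟩⟩
  exact (hα x₀).comp contDiffOn_fst fun p hp => hp.1.1

theorem fieldIndependent_mem_conserved {k : ℕ} {α : RawForm n M k} (hα : α ∈ closedForms n M k) :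
    fieldIndependent k α ∈ conservedForms e k :=
  ⟨fieldIndependent_mem hα.1, 0, zero_mem _, fun _ => hα.2⟩

/-- The on-shell form defined by a closed form on `M`. -/
def closedToOnShell (k : ℕ) : closedForms n M k →ₗ[ℝ] onShellClosed e k :=
  ((restrict e k ∘ₗ fieldIndependent k) ∘ₗ (closedForms n M k).subtype).codRestrict _ fun α =>
    Submodule.mem_map_of_mem (fieldIndependent_mem_conserved e α.2)

/-- The natural map `H^k_dR(M) → H^k_char(𝓔)`, `[α] ↦ [α]`. -/
def deRhamToChar (k : ℕ) : HdR n M k →ₗ[ℝ] HChar e k :=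
  Submodule.mapQ _ _ (closedToOnShell e k) (by
    rintro ⟨α, hα⟩ ⟨hs, h⟩
    have key : fieldIndependent k α ∈
        LocalForm n Fm F k ⊓ horizontalImage (LocalForm n Fm F) k → _ :=
      Submodule.mem_map_of_mem (f := restrict e k)
    refine key ⟨fieldIndependent_mem hs, ?_⟩
    rcases h with h | ⟨m, β, hβ, h⟩
    · refine Or.inl ?_
      have h' : α = 0 := h
      rw [h']
      exact map_zero _
    · exact Or.inr ⟨m, fieldIndependent m β, ⟨fieldIndependent_mem hβ, fieldIndependent_mem hβ⟩,
        fun _ => h⟩)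

/-- `H^p_cur(𝓔) = H^{n-p}_char(𝓔) / H^{n-p}_dR(M)`: classes of conserved local `p`-currents. -/
abbrev HCur (p : ℕ) : Type _ := HChar e (n - p) ⧸ LinearMap.range (deRhamToChar e (n - p))

end PDE

end

end VarBicomplex

open VarBicomplex

/-! A linear system is solved by the zero section, so every null form vanishes along it. The theorem
rests on one fact about local forms that vanish along the zero section, independent of the equation:
a `d_h`-closed one of degree 0 is zero, and a `d_h`-closed one of degree 1 to `n` is `d_h j` for a
local `j`, provided in degree `n` that its Euler-Lagrange derivative vanishes
(`eq_zero_of_isHorizontalDiff_zero`, `exists_isHorizontalDiff`). Hence null cocycles of positive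
degree are null sources; conversely null sources are cocycles by `d² = 0` and, in degree `n`, Stokes
(`eulerLagrangeVanishes_of_isHorizontalDiff`). Both cohomologies divide by the same coboundaries.
Subtracting from a closed local form of degree below `n` its value along the zero section leaves an
exact form (`exists_closedForm_sub_mem`); this computes the kernel of `j ↦ [d_h j]` as the on-shell
trivial currents together with the closed forms on `M` (`ker_currentClass`). Restriction to the zero
section also shows that de Rham classes survive in characteristic cohomology.

The exactness is first proved for linearizations in a coordinate domain. For a fixed field `φ`, the
linearization `P φ` of a closed local form is a linear differential operator in `η` with values in
closed forms. Put `K P = ∑ ι_j [P, x_j]`, with commutators by coordinate functions. Cartan's formula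
gives `d (K P) = ∑ ∂_j [P, x_j] + (n - deg) P`, where `deg` is the form degree of the values, and `∑
∂_j [P, x_j] = m P` modulo lower order when `P` has order at most `m`. So `(n - deg + m) P` is exact
up to a closed operator of lower order, and induction on `m` produces a primitive
(`exists_primitive_op`). The factor vanishes only in top degree and order zero; there `P` commutes
with multiplication by functions, and `∫ P φ η = 0` for all test fields `η` forces `P = 0`.

To return to the nonlinear form, write `ρ[ψ] = ∫₀¹ P (t ψ) ψ dt`. With local primitives `Q_i`,
normalized by `Q_i φ 0 = 0`, and a partition of unity `c_i`, take `j[ψ] = ∑ ∫₀¹ Q_i (t ψ) (c_i ψ)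
dt`. The partition multiplies the argument of `Q_i` and not its value, so no derivative of `c_i`
disturbs `d j`; the normalization makes each summand vanish off the support of `c_i`, hence extend
by zero. The notion `JetLocal` records throughout that all these expressions depend smoothly on
finitely many jet coordinates. -/

namespace VarBicomplex
set_option linter.unusedSectionVars false
noncomputable section

/-! ## Integrals depending smoothly on parameters -/

section ParametricIntegral

variable {H X : Type*} [NormedAddCommGroup H] [NormedSpace ℝ H]
  [NormedAddCommGroup X] [NormedSpace ℝ X]

/-- The integral is the value at 0 of the convolution of the integrand, cut off in `t`, with the
indicator function of `(-1, 0]`. Convolutions with a compactly supported smooth family are jointly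
smooth in the parameter and the point. -/
theorem contDiffOn_intervalIntegral {Ω : Set H} (hΩ : IsOpen Ω) {g : H → ℝ → X}
    (hg : ContDiffOn ℝ ∞ (fun p : H × ℝ => g p.1 p.2) (Ω ×ˢ Set.univ)) :
    ContDiffOn ℝ ∞ (fun z => ∫ t in (0 : ℝ)..1, g z t) Ω := by
  -- The bump equals one on `[-1/2, 3/2]`, which contains `[0, 1]`, so it does not change the
  -- integral.
  let χ : ContDiffBump (1 / 2 : ℝ) := ⟨1, 2, one_pos, one_lt_two⟩
  let h : H → ℝ → X := fun z t => χ t • g z t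
  let f : ℝ → ℝ := Set.indicator (Set.Ioc (-1) 0) fun _ => 1
  have hf : LocallyIntegrable f := by
    refine Integrable.locallyIntegrable ?_
    exact (integrable_indicator_iff measurableSet_Ioc).2 (integrableOn_const (by simp))
  have hh : ContDiffOn ℝ ((⊤ : ℕ∞) : WithTop ℕ∞) (fun p : H × ℝ => h p.1 p.2) (Ω ×ˢ Set.univ) :=
    ContDiffOn.smul (χ.contDiff.comp contDiff_snd).contDiffOn hg
  have key := contDiffOn_convolution_right_with_param (μ := volume) (f := f)
    (ContinuousLinearMap.lsmul ℝ ℝ : ℝ →L[ℝ] X →L[ℝ] X) (g := h) hΩ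
    (isCompact_closedBall (1 / 2 : ℝ) 2) (fun z t _ ht => by
      have : χ t = 0 := χ.zero_of_le_dist (by
        rw [Metric.mem_closedBall, not_le] at ht
        exact ht.le)
      simp [h, this]) hf hh
  have key2 := key.comp (s := Ω) (contDiff_id.prodMk (contDiff_const (c := (0 : ℝ)))).contDiffOn
    fun z hz => ⟨hz, trivial⟩
  refine key2.congr fun z hz => ?_
  have h1 : ∀ t ∈ Set.Icc (0 : ℝ) 1, h z t = g z t := by
    intro t ht
    have : χ t = 1 := χ.one_of_mem_closedBall (by
      rw [Metric.mem_closedBall, Real.dist_eq, abs_le]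
      constructor <;> norm_num <;> linarith [ht.1, ht.2])
    simp [h, this]
  have h2 : ∫ t in (0 : ℝ)..1, g z t = ∫ t in (0 : ℝ)..1, h z t :=
    intervalIntegral.integral_congr fun t ht => (h1 t (by simpa using ht)).symm
  have h3 := intervalIntegral.integral_comp_neg (a := -1) (b := 0) (h z)
  rw [neg_zero, neg_neg] at h3
  rw [h2, ← h3, intervalIntegral.integral_of_le (by norm_num),
    ← integral_indicator measurableSet_Ioc]
  simp only [Function.comp_apply, id, convolution_def, ContinuousLinearMap.lsmul_apply]
  refine integral_congr_ae (Filter.Eventually.of_forall fun t => ?_)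
  by_cases ht : t ∈ Set.Ioc (-1 : ℝ) 0
  · simp [f, ht]
  · simp [f, ht]

/-- Differentiation under the integral sign. The dominating constant is the maximum of the
derivative on the product of a small closed ball with `[0, 1]`, which is compact because `H` is
proper. -/
theorem hasFDerivAt_intervalIntegral [ProperSpace H] {Ω : Set H} (hΩ : IsOpen Ω)
    {g : H → ℝ → X} (hg : ContDiffOn ℝ ∞ (fun p : H × ℝ => g p.1 p.2) (Ω ×ˢ Set.univ))
    {z : H} (hz : z ∈ Ω) :
    IntervalIntegrable (fun t => fderiv ℝ (fun w => g w t) z) volume 0 1 ∧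
    HasFDerivAt (fun w => ∫ t in (0 : ℝ)..1, g w t)
      (∫ t in (0 : ℝ)..1, fderiv ℝ (fun w => g w t) z) z := by
  have hO : IsOpen (Ω ×ˢ (Set.univ : Set ℝ)) := hΩ.prod isOpen_univ
  have hd : ∀ w ∈ Ω, ∀ t : ℝ, HasFDerivAt (fun w => g w t)
      ((fderiv ℝ (fun p : H × ℝ => g p.1 p.2) (w, t)).comp (ContinuousLinearMap.inl ℝ H ℝ)) w := by
    intro w hw t
    have h1 : HasFDerivAt (fun p : H × ℝ => g p.1 p.2) _ (w, t) :=
      ((hg.contDiffAt (hO.mem_nhds ⟨hw, trivial⟩)).differentiableAt (by simp)).hasFDerivAt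
    exact h1.comp (f := fun w : H => (w, t)) w ((hasFDerivAt_id w).prodMk (hasFDerivAt_const t w))
  have hc : ContinuousOn (fun p : H × ℝ => fderiv ℝ (fun w => g w p.2) p.1) (Ω ×ˢ Set.univ) := by
    have h2 : ContinuousOn (fderiv ℝ (fun p : H × ℝ => g p.1 p.2)) (Ω ×ˢ Set.univ) :=
      hg.continuousOn_fderiv_of_isOpen hO (by simp)
    exact (h2.clm_comp continuousOn_const).congr fun p hp => (hd p.1 hp.1 p.2).fderiv
  have hline : ∀ w ∈ Ω, Continuous fun t : ℝ => g w t := by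
    intro w hw
    have := hg.continuousOn.comp (s := Set.univ)
      (continuous_const.prodMk continuous_id : Continuous fun t : ℝ => (w, t)).continuousOn
      fun t _ => ⟨hw, trivial⟩
    exact continuousOn_univ.1 this
  have hline' : ∀ w ∈ Ω, Continuous fun t : ℝ => fderiv ℝ (fun w => g w t) w := by
    intro w hw
    have := hc.comp (s := Set.univ)
      (continuous_const.prodMk continuous_id : Continuous fun t : ℝ => (w, t)).continuousOn
      fun t _ => ⟨hw, trivial⟩
    exact continuousOn_univ.1 this
  obtain ⟨ε, hε, hball⟩ := Metric.nhds_basis_closedBall.mem_iff.1 (hΩ.mem_nhds hz)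
  obtain ⟨C, hC⟩ := (((isCompact_closedBall z ε).prod (isCompact_Icc (a := (0 : ℝ)) (b := 1))
    ).image_of_continuousOn (hc.mono (Set.prod_mono hball (Set.subset_univ _)))).isBounded.exists_norm_le
  refine ⟨(hline' z hz).intervalIntegrable 0 1, ?_⟩
  refine (intervalIntegral.hasFDerivAt_integral_of_dominated_of_fderiv_le
    (bound := fun _ => C) (F' := fun w t => fderiv ℝ (fun w => g w t) w)
    (Metric.closedBall_mem_nhds z hε) ?_ ?_ ?_ ?_ ?_ ?_)
  · filter_upwards [hΩ.mem_nhds hz] with w hw using (hline w hw).aestronglyMeasurable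
  · exact (hline z hz).intervalIntegrable 0 1
  · exact (hline' z hz).aestronglyMeasurable
  · refine Filter.Eventually.of_forall fun t ht w hw => ?_
    refine hC _ ⟨(w, t), ⟨hw, ?_⟩, rfl⟩
    rw [Set.uIoc_of_le zero_le_one] at ht
    exact ⟨ht.1.le, ht.2⟩
  · exact intervalIntegrable_const
  · exact Filter.Eventually.of_forall fun t _ w hw =>
      (hd w (hball hw) t).differentiableAt.hasFDerivAt

end ParametricIntegral

/-! ## Calculus of jets in `ℝⁿ` -/

section JetCalculus

variable {n : ℕ} {V V' X Y : Type*} [NormedAddCommGroup V] [NormedSpace ℝ V]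
  [NormedAddCommGroup V'] [NormedSpace ℝ V'] [NormedAddCommGroup X] [NormedSpace ℝ X]
  [NormedAddCommGroup Y] [NormedSpace ℝ Y] {I : Type*}

variable (n V) in
/-- Values of the derivatives of order at most `s` of a `V`-valued function on `ℝⁿ`. -/
abbrev Jet (s : ℕ) : Type _ := (i : Fin (s + 1)) → Coord n [×(i : ℕ)]→L[ℝ] V

/-- The `s`-jet of a function. -/
def jet (s : ℕ) (u : Coord n → V) (y : Coord n) : Jet n V s :=
  fun i => iteratedFDeriv ℝ (i : ℕ) u y

theorem jet_congr {s : ℕ} {u v : Coord n → V} {y : Coord n} (h : u =ᶠ[𝓝 y] v) :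
    jet s u y = jet s v y :=
  funext fun i => (h.iteratedFDeriv ℝ (i : ℕ)).eq_of_nhds

theorem jet_add {s : ℕ} {u v : Coord n → V} {y : Coord n} (hu : ContDiffAt ℝ ∞ u y)
    (hv : ContDiffAt ℝ ∞ v y) : jet s (u + v) y = jet s u y + jet s v y :=
  funext fun i => iteratedFDeriv_add_apply (hu.of_le (by exact_mod_cast le_top))
    (hv.of_le (by exact_mod_cast le_top))

theorem jet_smul {s : ℕ} (c : ℝ) {u : Coord n → V} {y : Coord n} (hu : ContDiffAt ℝ ∞ u y) :
    jet s (c • u) y = c • jet s u y :=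
  funext fun _ => iteratedFDeriv_const_smul_apply (hu.of_le (by exact_mod_cast le_top))

/-- `A` sends the functions `u i` to functions `A i` whose value at each point of `U` depends
smoothly on the point and on the `s`-jet of `u i` there. -/
def JetLocal (s : ℕ) (u : I → Coord n → V) (U : Set (Coord n)) (A : I → Coord n → X) : Prop :=
  ∃ p : Coord n × Jet n V s → X, ContDiffOn ℝ ∞ p (U ×ˢ Set.univ) ∧
    ∀ i, ∀ y ∈ U, A i y = p (y, jet s (u i) y)

variable {s : ℕ} {u : I → Coord n → V} {U : Set (Coord n)} {A : I → Coord n → X}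

theorem contDiffOn_jet {v : Coord n → V} (hU : IsOpen U) (hv : ContDiffOn ℝ ∞ v U) (s : ℕ) :
    ContDiffOn ℝ ∞ (jet s v) U := by
  refine contDiffOn_pi.2 fun i y hy => ContDiffAt.contDiffWithinAt ?_
  exact (hv.contDiffAt (hU.mem_nhds hy)).iteratedFDeriv_right (i := (i : ℕ))
    (by exact_mod_cast le_top)

/-- Forgetting the derivatives of order larger than `s`. -/
def truncJet {s s' : ℕ} (h : s ≤ s') : Jet n V s' →L[ℝ] Jet n V s :=
  ContinuousLinearMap.pi fun i =>
    ContinuousLinearMap.proj (φ := fun i : Fin (s' + 1) => Coord n [×(i : ℕ)]→L[ℝ] V)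
      (Fin.castLE (by omega) i)

theorem contDiff_jet_apply {s : ℕ} (i : Fin (s + 1)) :
    ContDiff ℝ ∞ fun a : Jet n V s => a i :=
  (ContinuousLinearMap.proj (R := ℝ)
    (φ := fun i : Fin (s + 1) => Coord n [×(i : ℕ)]→L[ℝ] V) i).contDiff

theorem contDiff_prod_truncJet {s s' : ℕ} (h : s ≤ s') :
    ContDiff ℝ ∞ fun q : Coord n × Jet n V s' => (q.1, truncJet h q.2) :=
  contDiff_fst.prodMk
    ((truncJet h : Jet n V s' →L[ℝ] Jet n V s).contDiff.comp contDiff_snd)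

namespace JetLocal

theorem congr {A' : I → Coord n → X} (h : JetLocal s u U A)
    (e : ∀ i, ∀ y ∈ U, A' i y = A i y) : JetLocal s u U A' := by
  obtain ⟨p, hp, hA⟩ := h
  exact ⟨p, hp, fun i y hy => (e i y hy).trans (hA i y hy)⟩

theorem mono_order {s' : ℕ} (hs : s ≤ s') (h : JetLocal s u U A) : JetLocal s' u U A := by
  obtain ⟨p, hp, hA⟩ := h
  refine ⟨fun q => p (q.1, truncJet hs q.2), ?_, fun i y hy => hA i y hy⟩
  exact hp.comp (contDiff_prod_truncJet hs).contDiffOn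
    fun q hq => ⟨hq.1, trivial⟩

theorem comp {g : Coord n × X → Y} (hg : ContDiffOn ℝ ∞ g (U ×ˢ Set.univ))
    (h : JetLocal s u U A) : JetLocal s u U fun i y => g (y, A i y) := by
  obtain ⟨p, hp, hA⟩ := h
  refine ⟨fun q => g (q.1, p q), ?_, fun i y hy => by simp only [hA i y hy]⟩
  exact hg.comp (contDiff_fst.contDiffOn.prodMk hp) fun q hq => ⟨hq.1, trivial⟩

theorem comp_contDiff {g : X → Y} (hg : ContDiff ℝ ∞ g) (h : JetLocal s u U A) :
    JetLocal s u U fun i y => g (A i y) :=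
  h.comp (g := fun q => g q.2) (hg.comp contDiff_snd).contDiffOn

theorem prodMk {B : I → Coord n → Y} (hA : JetLocal s u U A) (hB : JetLocal s u U B) :
    JetLocal s u U fun i y => (A i y, B i y) := by
  obtain ⟨p, hp, hA⟩ := hA
  obtain ⟨q, hq, hB⟩ := hB
  exact ⟨fun z => (p z, q z), hp.prodMk hq, fun i y hy => by simp only [hA i y hy, hB i y hy]⟩

theorem pi {ι : Type*} [Fintype ι] {X : ι → Type*} [∀ j, NormedAddCommGroup (X j)]
    [∀ j, NormedSpace ℝ (X j)] {A : (j : ι) → I → Coord n → X j}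
    (h : ∀ j, JetLocal s u U (A j)) : JetLocal s u U fun i y j => A j i y := by
  choose p hp hA using h
  exact ⟨fun z j => p j z, contDiffOn_pi.2 hp, fun i y hy => funext fun j => hA j i y hy⟩

theorem of_contDiffOn {g : Coord n → X} (hg : ContDiffOn ℝ ∞ g U) :
    JetLocal s u U fun _ => g :=
  ⟨fun q => g q.1, hg.comp contDiff_fst.contDiffOn fun _ hq => hq.1, fun _ _ _ => rfl⟩

theorem self : JetLocal 0 u U u := by
  refine ⟨fun q => q.2 0 0, ?_, fun i y _ => rfl⟩
  have : ContDiff ℝ ∞ fun q : Coord n × Jet n V 0 =>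
      (ContinuousMultilinearMap.apply ℝ (fun _ : Fin 0 => Coord n) V 0) (q.2 0) :=
    (ContinuousLinearMap.contDiff _).comp ((contDiff_jet_apply 0).comp contDiff_snd)
  exact this.contDiffOn

theorem contDiffOn (hU : IsOpen U) (hu : ∀ i, ContDiffOn ℝ ∞ (u i) U) (h : JetLocal s u U A)
    (i : I) : ContDiffOn ℝ ∞ (A i) U := by
  obtain ⟨p, hp, hA⟩ := h
  exact (hp.comp (contDiffOn_id.prodMk (contDiffOn_jet hU (hu i) s))
    fun y hy => ⟨hy, trivial⟩).congr fun y hy => hA i y hy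

theorem add {B : I → Coord n → X} (hA : JetLocal s u U A) (hB : JetLocal s u U B) :
    JetLocal s u U fun i y => A i y + B i y :=
  (hA.prodMk hB).comp_contDiff contDiff_add

theorem sub {B : I → Coord n → X} (hA : JetLocal s u U A) (hB : JetLocal s u U B) :
    JetLocal s u U fun i y => A i y - B i y :=
  (hA.prodMk hB).comp_contDiff (contDiff_fst.sub contDiff_snd)

theorem smul {g : Coord n → ℝ} (hg : ContDiffOn ℝ ∞ g U) (hA : JetLocal s u U A) :
    JetLocal s u U fun i y => g y • A i y :=
  ((of_contDiffOn hg).prodMk hA).comp_contDiff contDiff_smul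

theorem const_smul (c : ℝ) (hA : JetLocal s u U A) : JetLocal s u U fun i y => c • A i y :=
  hA.smul contDiffOn_const

theorem sum {ι : Type*} (T : Finset ι) {A : ι → I → Coord n → X}
    (h : ∀ j ∈ T, JetLocal s u U (A j)) : JetLocal s u U fun i y => ∑ j ∈ T, A j i y := by
  classical
  induction T using Finset.induction_on with
  | empty => exact (of_contDiffOn contDiffOn_const (g := fun _ => 0)).congr (by simp)
  | insert j T hj ih =>
    simp_rw [Finset.sum_insert hj]
    exact (h j (Finset.mem_insert_self j T)).add
      (ih fun k hk => h k (Finset.mem_insert_of_mem hk))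

/-- The derivative of a function of the `s`-jet is a function of the `(s+1)`-jet. -/
theorem fderiv (hU : IsOpen U) (hu : ∀ i, ContDiffOn ℝ ∞ (u i) U) (h : JetLocal s u U A) :
    JetLocal (s + 1) u U fun i => fderiv ℝ (A i) := by
  obtain ⟨p, hp, hA⟩ := h
  -- The derivative of the `s`-jet of a function is read off its `(s+1)`-jet by shifting the order
  -- by one; the chain rule for `p (y, jet s u y)` then gives the formula below.
  let D : Jet n V (s + 1) → Coord n →L[ℝ] Jet n V s := fun a =>
    ContinuousLinearMap.pi fun i => (a i.succ).curryLeft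
  have hD : ContDiff ℝ ∞ D := by
    rw [contDiff_clm_apply_iff]
    refine fun v => contDiff_pi.2 fun i => ?_
    have h1 : ContDiff ℝ ∞ fun a : Jet n V (s + 1) =>
        continuousMultilinearCurryLeftEquiv ℝ (fun _ : Fin ((i : ℕ) + 1) => Coord n) V
          (a i.succ) :=
      (LinearIsometryEquiv.contDiff _).comp (contDiff_jet_apply i.succ)
    exact h1.clm_apply contDiff_const
  have hjet : ∀ i, ∀ y ∈ U, HasFDerivAt (jet s (u i)) (D (jet (s + 1) (u i) y)) y := by
    intro i y hy
    refine hasFDerivAt_pi.2 fun j => ?_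
    have h2 : ContDiffAt ℝ 1 (iteratedFDeriv ℝ (j : ℕ) (u i)) y :=
      (((hu i).contDiffAt (hU.mem_nhds hy)).iteratedFDeriv_right (i := (j : ℕ)) (m := ∞)
        (by exact_mod_cast le_top)).of_le (by simp)
    have h3 := (h2.differentiableAt (by simp)).hasFDerivAt
    have h4 : _root_.fderiv ℝ (iteratedFDeriv ℝ (j : ℕ) (u i)) y =
        (iteratedFDeriv ℝ ((j : ℕ) + 1) (u i) y).curryLeft := by
      rw [iteratedFDeriv_succ_eq_comp_left]
      exact ((continuousMultilinearCurryLeftEquiv ℝ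
        (fun _ : Fin ((j : ℕ) + 1) => Coord n) V).apply_symm_apply _).symm
    rw [h4] at h3
    exact h3
  have hO : IsOpen (U ×ˢ (Set.univ : Set (Jet n V s))) := hU.prod isOpen_univ
  refine ⟨fun q => (_root_.fderiv ℝ p (q.1, truncJet (Nat.le_succ s) q.2)).comp
    ((ContinuousLinearMap.id ℝ (Coord n)).prod (D q.2)), ?_, ?_⟩
  · refine ContDiffOn.clm_comp ?_ ?_
    · exact (hp.fderiv_of_isOpen hO (m := ∞) (by simp)).comp
        (contDiff_prod_truncJet _).contDiffOn
        fun q hq => ⟨hq.1, trivial⟩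
    · have : ContDiff ℝ ∞ fun q : Coord n × Jet n V (s + 1) =>
          (ContinuousLinearMap.id ℝ (Coord n)).prod (D q.2) := by
        rw [contDiff_clm_apply_iff]
        exact fun v => contDiff_const.prodMk
          ((hD.comp contDiff_snd).clm_apply contDiff_const)
      exact this.contDiffOn
  · intro i y hy
    have h1 : A i =ᶠ[𝓝 y] fun z => p (z, jet s (u i) z) := by
      filter_upwards [hU.mem_nhds hy] with z hz using hA i z hz
    refine h1.fderiv_eq.trans ?_
    have h2 : HasFDerivAt p (_root_.fderiv ℝ p (y, jet s (u i) y)) (y, jet s (u i) y) :=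
      ((hp.contDiffAt (hO.mem_nhds ⟨hy, trivial⟩)).differentiableAt (by simp)).hasFDerivAt
    exact (h2.comp y ((hasFDerivAt_id y).prodMk (hjet i y hy))).fderiv

/-- Jets of functions obtained from the `u i` by a change of variables `σ` and an operation of order
zero depend smoothly on the jets of the `u i`. -/
theorem jet_transform {u' : I → Coord n → V'} {σ : Coord n → Coord n}
    {κ : Coord n → Coord n →L[ℝ] Coord n} {U' : Set (Coord n)} (hU : IsOpen U) (hU' : IsOpen U')
    (hu : ∀ i, ContDiffOn ℝ ∞ (u i) U) (hu' : ∀ i, ContDiffOn ℝ ∞ (u' i) U')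
    (hσ : ContDiffOn ℝ ∞ σ U) (hκ : ContDiffOn ℝ ∞ κ U)
    (hσκ : ∀ y ∈ U, (_root_.fderiv ℝ σ y).comp (κ y) = ContinuousLinearMap.id ℝ (Coord n))
    (hmaps : Set.MapsTo σ U U') (h : JetLocal 0 u U fun i y => u' i (σ y)) (s : ℕ) :
    JetLocal s u U fun i y => jet s (u' i) (σ y) := by
  -- Differentiating the `m`-th derivative of `u'` composed with `σ` gives the next derivative at `σ
  -- y`, composed with `fderiv ℝ σ y`. The right inverse `κ y` removes that factor.
  have key : ∀ m : ℕ, JetLocal m u U fun i y => iteratedFDeriv ℝ m (u' i) (σ y) := by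
    intro m
    induction m with
    | zero =>
      exact h.comp_contDiff (g := (continuousMultilinearCurryFin0 ℝ (Coord n) V').symm)
        (LinearIsometryEquiv.contDiff _)
    | succ m ih =>
      have h1 := ((ih.fderiv hU hu).prodMk (of_contDiffOn hκ)).comp_contDiff
        (g := fun q => q.1.comp q.2) (contDiff_fst.clm_comp contDiff_snd)
      have h2 := h1.comp_contDiff (g := (continuousMultilinearCurryLeftEquiv ℝ
        (fun _ : Fin (m + 1) => Coord n) V').symm) (LinearIsometryEquiv.contDiff _)
      refine h2.congr fun i y hy => ?_
      rw [iteratedFDeriv_succ_eq_comp_left, Function.comp_apply]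
      congr 1
      have h3 : ContDiffAt ℝ 1 (iteratedFDeriv ℝ m (u' i)) (σ y) :=
        (((hu' i).contDiffAt (hU'.mem_nhds (hmaps hy))).iteratedFDeriv_right (i := m) (m := ∞)
          (by exact_mod_cast le_top)).of_le (by simp)
      have h4 := ((hσ.contDiffAt (hU.mem_nhds hy)).differentiableAt (by simp)).hasFDerivAt
      have h5 := ((h3.differentiableAt (by simp)).hasFDerivAt.comp y h4).fderiv
      have h6 : _root_.fderiv ℝ (fun y => iteratedFDeriv ℝ m (u' i) (σ y)) y =
        (_root_.fderiv ℝ (iteratedFDeriv ℝ m (u' i)) (σ y)).comp (_root_.fderiv ℝ σ y) := h5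
      rw [h6, ContinuousLinearMap.comp_assoc, hσκ y hy, ContinuousLinearMap.comp_id]
  exact pi fun j => (key j).mono_order (Nat.lt_succ_iff.1 j.2)

/-- The case without change of variables. It replaces explicit Leibniz formulas: an operation of
order zero acts on jets smoothly and without raising their order. -/
theorem jet_map {u' : I → Coord n → V'} (hU : IsOpen U)
    (hu : ∀ i, ContDiffOn ℝ ∞ (u i) U) (h : JetLocal 0 u U u') (s : ℕ) :
    JetLocal s u U fun i => jet s (u' i) :=
  jet_transform (σ := id) (κ := fun _ => ContinuousLinearMap.id ℝ (Coord n)) hU hU hu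
    (fun i => h.contDiffOn hU hu i) contDiffOn_id contDiffOn_const
    (fun y _ => by simp) (fun _ hy => hy) h s

theorem eq_of_jet_eq (h : JetLocal s u U A) {i j : I} {y : Coord n} (hy : y ∈ U)
    (e : jet s (u i) y = jet s (u j) y) : A i y = A j y := by
  obtain ⟨p, -, hA⟩ := h
  rw [hA i y hy, hA j y hy, e]

end JetLocal

/-- Hadamard's lemma. -/
theorem exists_hadamard {g : Coord n → ℝ} (hg : ContDiff ℝ ∞ g) (y : Coord n) :
    ∃ h : Fin n → Coord n → ℝ, (∀ j, ContDiff ℝ ∞ (h j)) ∧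
      ∀ z, g z = g y + ∑ j, (z j - y j) * h j z := by
  let e : Fin n → Coord n := fun j => EuclideanSpace.single j 1
  refine ⟨fun j z => ∫ t in (0 : ℝ)..1, fderiv ℝ g (y + t • (z - y)) (e j), fun j => ?_,
    fun z => ?_⟩
  · rw [← contDiffOn_univ]
    refine contDiffOn_intervalIntegral isOpen_univ (ContDiff.contDiffOn ?_)
    refine ContDiff.clm_apply ((hg.fderiv_right (m := ∞) (by simp)).comp ?_) contDiff_const
    exact contDiff_const.add (contDiff_snd.smul (contDiff_fst.sub contDiff_const))
  · have hd : ∀ t : ℝ, HasDerivAt (fun t : ℝ => g (y + t • (z - y)))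
        (fderiv ℝ g (y + t • (z - y)) (z - y)) t := by
      intro t
      have h1 : HasDerivAt (fun t : ℝ => y + t • (z - y)) (z - y) t := by
        simpa using ((hasDerivAt_id t).smul_const (z - y)).const_add y
      exact ((hg.differentiable (by simp)) _).hasFDerivAt.comp_hasDerivAt t h1
    have hc : ∀ v : Coord n, Continuous fun t : ℝ => fderiv ℝ g (y + t • (z - y)) v := by
      intro v
      exact ((hg.continuous_fderiv (by simp)).comp (by fun_prop)).clm_apply continuous_const
    have h2 := intervalIntegral.integral_eq_sub_of_hasDerivAt (a := 0) (b := 1)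
      (fun t _ => hd t) ((hc _).intervalIntegrable 0 1)
    have h3 : z - y = ∑ j, (z j - y j) • e j := by
      ext i
      simp [e, Pi.single_apply]
    have h4 : ∀ t : ℝ, fderiv ℝ g (y + t • (z - y)) (z - y) =
        ∑ j, (z j - y j) * fderiv ℝ g (y + t • (z - y)) (e j) := by
      intro t
      generalize fderiv ℝ g (y + t • (z - y)) = L
      conv_lhs => rw [h3]
      rw [map_sum]
      simp [e]
    simp_rw [h4] at h2
    rw [intervalIntegral.integral_finsetSum
      fun j _ => ((hc (e j)).const_mul _).intervalIntegrable 0 1] at h2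
    simp_rw [intervalIntegral.integral_const_mul] at h2
    rw [h2]
    simp

end JetCalculus

end

end VarBicomplex

namespace VarBicomplex
set_option linter.unusedSectionVars false
noncomputable section

/-! ## Forms on open subsets of `ℝⁿ` -/

section EuclideanForms

variable {n k : ℕ}

open ContinuousAlternatingMap

/-- A family of forms is smooth if its values on all vectors are. -/
theorem contDiffWithinAt_form {H : Type*} [NormedAddCommGroup H] [NormedSpace ℝ H] {S : Set H}
    {β : H → Coord n [⋀^Fin k]→L[ℝ] ℝ} {x : H}
    (h : ∀ v : Fin k → Coord n, ContDiffWithinAt ℝ ∞ (fun z => β z v) S x) :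
    ContDiffWithinAt ℝ ∞ β S x := by
  let b := EuclideanSpace.basisFun (Fin n) ℝ
  -- Evaluation on all tuples of basis vectors embeds forms into a finite-dimensional coordinate
  -- space; a linear left inverse is automatically continuous, so smoothness of the components gives
  -- smoothness of the form.
  let T : (Coord n [⋀^Fin k]→L[ℝ] ℝ) →ₗ[ℝ] ((Fin k → Fin n) → ℝ) :=
    { toFun := fun α J => α fun i => b (J i)
      map_add' := fun _ _ => rfl
      map_smul' := fun _ _ => rfl }
  have hT : LinearMap.ker T = ⊥ := by
    rw [LinearMap.ker_eq_bot]
    intro α α' h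
    refine ContinuousAlternatingMap.toAlternatingMap_injective ?_
    refine AlternatingMap.coe_multilinearMap_injective ?_
    exact Module.Basis.ext_multilinear (fun _ => b.toBasis) fun J => by
      simpa [T, b] using congrFun h J
  obtain ⟨S', hS'⟩ := T.exists_leftInverse_of_injective hT
  have h1 : ContDiffWithinAt ℝ ∞ (fun z => T (β z)) S x := contDiffWithinAt_pi.2 fun J => h _
  have h2 : ContDiff ℝ ∞ S' := (LinearMap.toContinuousLinearMap S').contDiff
  have h3 : (fun z => S' (T (β z))) = β := funext fun z => LinearMap.congr_fun hS' (β z)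
  exact h3 ▸ h2.contDiffAt.comp_contDiffWithinAt x h1

/-- Multilinear expansion in the standard basis writes each component of the pullback as a finite
sum of products of entries of `L` and components of `β`. -/
theorem contDiffWithinAt_compContinuousLinearMap {H : Type*} [NormedAddCommGroup H]
    [NormedSpace ℝ H] {S : Set H} {β : H → Coord n [⋀^Fin k]→L[ℝ] ℝ}
    {L : H → Coord n →L[ℝ] Coord n} {x : H}
    (hβ : ContDiffWithinAt ℝ ∞ β S x) (hL : ContDiffWithinAt ℝ ∞ L S x) :
    ContDiffWithinAt ℝ ∞ (fun z => (β z).compContinuousLinearMap (L z)) S x := by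
  refine contDiffWithinAt_form fun v => ?_
  let b := EuclideanSpace.basisFun (Fin n) ℝ
  have h1 : ∀ z, (β z).compContinuousLinearMap (L z) v =
      ∑ J : Fin k → Fin n, (∏ i, L z (v i) (J i)) * β z fun i => b (J i) := by
    intro z
    have h2 : (fun i => L z (v i)) = fun i => ∑ j, L z (v i) j • b j := by
      funext i
      exact (b.sum_repr (L z (v i))).symm
    have h3 := (β z).toMultilinearMap.map_sum (fun i j => L z (v i) j • b j)
    have h4 : ∀ J : Fin k → Fin n, (β z).toMultilinearMap (fun i => L z (v i) (J i) • b (J i)) =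
        (∏ i, L z (v i) (J i)) * β z fun i => b (J i) := fun J =>
      (β z).toMultilinearMap.map_smul_univ _ _
    calc (β z).compContinuousLinearMap (L z) v = β z fun i => L z (v i) := rfl
      _ = β z fun i => ∑ j, L z (v i) j • b j := congrArg (β z) h2
      _ = _ := h3
      _ = _ := Finset.sum_congr rfl fun J _ => h4 J
  simp_rw [h1]
  refine ContDiffWithinAt.sum fun J _ =>
    ContDiffWithinAt.mul (contDiffWithinAt_prod fun i _ => ?_) ?_
  · exact (EuclideanSpace.proj (𝕜 := ℝ) (J i)).contDiff.contDiffAt.comp_contDiffWithinAt x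
      (hL.clm_apply contDiffWithinAt_const)
  · exact (ContinuousAlternatingMap.apply ℝ (Coord n) ℝ
      fun i => b (J i)).contDiff.contDiffAt.comp_contDiffWithinAt x hβ

theorem contDiffOn_compContinuousLinearMap {H : Type*} [NormedAddCommGroup H] [NormedSpace ℝ H]
    {S : Set H} {β : H → Coord n [⋀^Fin k]→L[ℝ] ℝ} {L : H → Coord n →L[ℝ] Coord n}
    (hβ : ContDiffOn ℝ ∞ β S) (hL : ContDiffOn ℝ ∞ L S) :
    ContDiffOn ℝ ∞ (fun z => (β z).compContinuousLinearMap (L z)) S := fun z hz =>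
  contDiffWithinAt_compContinuousLinearMap (hβ z hz) (hL z hz)

theorem ContDiffOn.extDeriv {U : Set (Coord n)} (hU : IsOpen U)
    {β : Coord n → Coord n [⋀^Fin k]→L[ℝ] ℝ} (hβ : ContDiffOn ℝ ∞ β U) :
    ContDiffOn ℝ ∞ (extDeriv β) U :=
  (alternatizeUncurryFinCLM ℝ (Coord n) ℝ).contDiff.comp_contDiffOn
    (hβ.fderiv_of_isOpen hU (by simp))

/-- Contraction of a form with a vector. -/
def contraction (v : Coord n) :
    (Coord n [⋀^Fin (k + 1)]→L[ℝ] ℝ) →L[ℝ] (Coord n [⋀^Fin k]→L[ℝ] ℝ) :=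
  (ContinuousLinearMap.apply ℝ (Coord n [⋀^Fin k]→L[ℝ] ℝ) v).comp
    (curryLeftLI (𝕜 := ℝ) (E := Coord n) (F := ℝ) (n := k)).toContinuousLinearMap

theorem contraction_apply (v : Coord n) (β : Coord n [⋀^Fin (k + 1)]→L[ℝ] ℝ) (w : Fin k → Coord n) :
    contraction v β w = β (Matrix.vecCons v w) := rfl

/-- Cartan's formula for constant vector fields. -/
theorem alternatizeUncurryFin_contraction_comp
    (A : Coord n →L[ℝ] Coord n [⋀^Fin (k + 1)]→L[ℝ] ℝ) (v : Coord n) :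
    alternatizeUncurryFin ((contraction v).comp A) = A v - contraction v (alternatizeUncurryFin A) := by
  ext w
  rw [ContinuousAlternatingMap.sub_apply, contraction_apply, alternatizeUncurryFin_apply]
  -- In the alternating sum on `(v, w)` the zeroth term is `A v w`, and the others reproduce the
  -- left-hand side with opposite sign, because the slots are shifted by one.
  conv_rhs => rw [alternatizeUncurryFin_apply, Fin.sum_univ_succ]
  have h0 : Fin.removeNth 0 (Matrix.vecCons v w) = w := by
    funext i
    simp [Fin.removeNth]
  have h1 : ∀ a : Fin (k + 1), Fin.removeNth a.succ (Matrix.vecCons v w) =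
      Matrix.vecCons v (a.removeNth w) := by
    intro a
    funext i
    refine Fin.cases ?_ (fun i => ?_) i <;> simp [Fin.removeNth]
  simp [h0, h1, contraction_apply, pow_succ]

/-- `∑ ι_j (dx_j ∧ β) = (n - k) β` for a `k`-form `β`, `k ≥ 1`. -/
theorem sum_contraction_alternatizeUncurryFin (β : Coord n [⋀^Fin (k + 1)]→L[ℝ] ℝ) :
    ∑ j : Fin n, contraction (EuclideanSpace.single j 1)
      (alternatizeUncurryFin ((EuclideanSpace.proj (𝕜 := ℝ) j).smulRight β)) =
      ((n : ℝ) - (k + 1)) • β := by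
  have h1 : ∀ j : Fin n, contraction (EuclideanSpace.single j 1)
      (alternatizeUncurryFin ((EuclideanSpace.proj (𝕜 := ℝ) j).smulRight β)) =
      β - alternatizeUncurryFin ((contraction (EuclideanSpace.single j 1)).comp
        ((EuclideanSpace.proj (𝕜 := ℝ) j).smulRight β)) := by
    intro j
    rw [alternatizeUncurryFin_contraction_comp]
    simp
  -- The sum of `dx_j ⊗ ι_j β` is `β` with its first slot split off; antisymmetrizing it gives `β`
  -- back once for each of its `k + 1` slots.
  have h2 : ∑ j : Fin n, (contraction (EuclideanSpace.single j 1)).comp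
      ((EuclideanSpace.proj (𝕜 := ℝ) j).smulRight β) = curryLeft β := by
    ext v w
    have h3 : v = ∑ j, v j • EuclideanSpace.single j (1 : ℝ) := by
      ext i
      simp [Pi.single_apply]
    conv_rhs => rw [h3, _root_.map_sum]
    simp only [_root_.sum_apply, map_smul]
    congr 1
  have h4 : ∑ j : Fin n, alternatizeUncurryFin ((contraction (EuclideanSpace.single j 1)).comp
      ((EuclideanSpace.proj (𝕜 := ℝ) j).smulRight β)) = (k + 1) • β := by
    rw [← alternatizeUncurryFin_curryLeft, ← h2]
    exact (_root_.map_sum (alternatizeUncurryFinCLM ℝ (Coord n) ℝ) _ _).symm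
  simp_rw [h1]
  rw [Finset.sum_sub_distrib, h4]
  ext w
  simp
  ring

/-- The integral of an exact form with compact support vanishes. -/
theorem setIntegral_extDeriv_eq_zero {U K : Set (Coord n)} (hU : IsOpen U) (hK : IsCompact K)
    (hKU : K ⊆ U) {β : Coord n → Coord n [⋀^Fin k]→L[ℝ] ℝ} (hβ : ContDiffOn ℝ ∞ β U)
    (h0 : ∀ y ∈ U \ K, β y = 0) (v : Fin (k + 1) → Coord n) :
    ∫ y in U, extDeriv β y v = 0 := by
  classical
  let β' : Coord n → Coord n [⋀^Fin k]→L[ℝ] ℝ := fun y => if y ∈ K then β y else 0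
  have e1 : ∀ y ∈ U, β' =ᶠ[𝓝 y] β := by
    intro y hy
    filter_upwards [hU.mem_nhds hy] with z hz
    by_cases hzK : z ∈ K
    · simp [β', hzK]
    · simp [β', hzK, h0 z ⟨hz, hzK⟩]
  have e2 : ∀ y ∉ K, β' =ᶠ[𝓝 y] 0 := by
    intro y hy
    filter_upwards [hK.isClosed.isOpen_compl.mem_nhds hy] with z hz
    have : z ∉ K := hz
    simp [β', this]
  have hs : ContDiff ℝ ∞ β' := by
    rw [contDiff_iff_contDiffAt]
    intro y
    by_cases hy : y ∈ U
    · exact (hβ.contDiffAt (hU.mem_nhds hy)).congr_of_eventuallyEq (e1 y hy)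
    · exact contDiffAt_const.congr_of_eventuallyEq (e2 y fun h => hy (hKU h))
  have h1 : ∀ (w : Fin k → Coord n) (z : Coord n),
      Integrable (fun y => fderiv ℝ (fun y => β' y w) y z) ∧
        ∫ y, fderiv ℝ (fun y => β' y w) y z = 0 := by
    intro w z
    let g : Coord n → ℝ := fun y => β' y w
    have hg : ContDiff ℝ ∞ g :=
      (ContinuousAlternatingMap.apply ℝ (Coord n) ℝ w).contDiff.comp hs
    have hgc : HasCompactSupport g := HasCompactSupport.intro hK fun y hy => by
      simp [g, β', hy]
    have hi : Integrable fun y => fderiv ℝ g y z :=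
      ((hg.continuous_fderiv (by simp)).clm_apply continuous_const).integrable_of_hasCompactSupport
        (hgc.fderiv_apply ℝ z)
    refine ⟨hi, ?_⟩
    -- Integration by parts against the constant function one.
    have := integral_mul_fderiv_eq_neg_fderiv_mul_of_integrable (μ := (volume : Measure (Coord n)))
      (f := fun _ : Coord n => (1 : ℝ)) (g := g) (v := z) (by simp) (by simpa using hi)
      (by simpa using hg.continuous.integrable_of_hasCompactSupport hgc)
      (fun _ _ => differentiableAt_const _) fun y _ => hg.differentiable (by simp) y
    simpa using this
  have h2 : ∀ y, extDeriv β' y v =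
      ∑ i : Fin (k + 1), (-1 : ℝ) ^ (i : ℕ) * fderiv ℝ (fun y => β' y (i.removeNth v)) y (v i) := by
    intro y
    rw [extDeriv_apply (hs.differentiable (by simp) y)]
    exact Finset.sum_congr rfl fun i _ => by simp
  have h3 : ∫ y in U, extDeriv β y v = ∫ y in U, extDeriv β' y v :=
    setIntegral_congr_fun hU.measurableSet fun y hy => by
      simp only [(e1 y hy).extDeriv_eq]
  have h4 : ∫ y in U, extDeriv β' y v = ∫ y, extDeriv β' y v := by
    refine setIntegral_eq_integral_of_forall_compl_eq_zero fun y hy => ?_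
    rw [(e2 y fun h => hy (hKU h)).extDeriv_eq]
    have : extDeriv (0 : Coord n → Coord n [⋀^Fin k]→L[ℝ] ℝ) y = 0 := by
      have h := extDeriv_smul (x := y) (0 : ℝ) (0 : Coord n → Coord n [⋀^Fin k]→L[ℝ] ℝ)
      rwa [zero_smul, zero_smul] at h
    rw [this]
    rfl
  rw [h3, h4]
  simp_rw [h2]
  rw [integral_finsetSum _ fun i _ => (h1 _ _).1.const_mul _]
  refine Finset.sum_eq_zero fun i _ => ?_
  rw [integral_const_mul, (h1 _ _).2, mul_zero]

end EuclideanForms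

end

end VarBicomplex

namespace VarBicomplex
set_option linter.unusedSectionVars false
noncomputable section

/-! ## Linear local operators on open subsets of `ℝⁿ` -/

section LocalOperators

variable {n : ℕ} {U : Set (Coord n)} {V X : Type*} [NormedAddCommGroup V] [NormedSpace ℝ V]
  [NormedAddCommGroup X] [NormedSpace ℝ X]

/-- Functions that are smooth on `U`. -/
def Fld (U : Set (Coord n)) (V : Type*) [NormedAddCommGroup V] [NormedSpace ℝ V] :
    Submodule ℝ (Coord n → V) where
  carrier := {u | ContDiffOn ℝ ∞ u U}
  add_mem' hu hv := ContDiffOn.add hu hv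
  zero_mem' := contDiffOn_const
  smul_mem' _ _ hu := contDiffOn_const.smul hu

/-- The product of a field with a smooth function. -/
def Fld.mul (g : Coord n → ℝ) (hg : ContDiffOn ℝ ∞ g U) (η : Fld U V) : Fld U V :=
  ⟨fun y => g y • (η : Coord n → V) y, ContDiffOn.smul hg η.2⟩

/-- The product of a field with a coordinate function. -/
def Fld.coordMul (j : Fin n) (η : Fld U V) : Fld U V :=
  Fld.mul (fun y => y j) (EuclideanSpace.proj (𝕜 := ℝ) j).contDiff.contDiffOn η

/-- The function `(φ, η)` defined by a pair of fields. -/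
def pairFun (w : Fld U V × Fld U V) (y : Coord n) : V × V :=
  ((w.1 : Coord n → V) y, (w.2 : Coord n → V) y)

theorem contDiffOn_pairFun (w : Fld U V × Fld U V) : ContDiffOn ℝ ∞ (pairFun w) U :=
  ContDiffOn.prodMk w.1.2 w.2.2

/-- `P φ η` depends smoothly on the `s`-jets of `φ` and `η`. -/
def IsLocOp (s : ℕ) (P : Fld U V → Fld U V → Coord n → X) : Prop :=
  JetLocal s pairFun U fun w => P w.1 w.2

/-- `P φ η` is linear in `η`. -/
structure IsLinOp (P : Fld U V → Fld U V → Coord n → X) : Prop where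
  add : ∀ φ η η', ∀ y ∈ U, P φ (η + η') y = P φ η y + P φ η' y
  smul : ∀ φ (c : ℝ) η, ∀ y ∈ U, P φ (c • η) y = c • P φ η y

theorem IsLinOp.zero {P : Fld U V → Fld U V → Coord n → X} (hP : IsLinOp P) (φ : Fld U V)
    {y : Coord n} (hy : y ∈ U) : P φ 0 y = 0 := by
  have := hP.smul φ 0 0 y hy
  rwa [zero_smul, zero_smul] at this

theorem IsLinOp.sum {P : Fld U V → Fld U V → Coord n → X} (hP : IsLinOp P) (φ : Fld U V)
    {ι : Type*} (T : Finset ι) (η : ι → Fld U V) {y : Coord n} (hy : y ∈ U) :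
    P φ (∑ j ∈ T, η j) y = ∑ j ∈ T, P φ (η j) y := by
  classical
  induction T using Finset.induction_on with
  | empty => simpa using hP.zero φ hy
  | insert j T hj ih => rw [Finset.sum_insert hj, Finset.sum_insert hj, hP.add _ _ _ y hy, ih]

/-- The commutator of an operator with the `j`-th coordinate function. -/
def comm (j : Fin n) (P : Fld U V → Fld U V → Coord n → X) (φ η : Fld U V) (y : Coord n) : X :=
  P φ (Fld.coordMul j η) y - y j • P φ η y

/-- `P` has order less than `m` in `η`: its `m`-fold commutators with coordinates vanish. -/
def HasOrderLT : ℕ → (Fld U V → Fld U V → Coord n → X) → Prop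
  | 0, P => ∀ φ η, ∀ y ∈ U, P φ η y = 0
  | m + 1, P => ∀ j, HasOrderLT m (comm j P)

/-- The operator `∑ ∂_j ∘ [P, x_j]`. -/
def eulerOp (P : Fld U V → Fld U V → Coord n → X) (φ η : Fld U V) (y : Coord n) : X :=
  ∑ j, fderiv ℝ (comm j P φ η) y (EuclideanSpace.single j 1)

variable {s : ℕ} {P : Fld U V → Fld U V → Coord n → X}

theorem IsLocOp.contDiffOn (hU : IsOpen U) (hP : IsLocOp s P) (φ η : Fld U V) :
    ContDiffOn ℝ ∞ (P φ η) U :=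
  JetLocal.contDiffOn hU contDiffOn_pairFun hP (φ, η)

/-- Multiplication by a fixed smooth function has order zero, so it does not raise the jet order.
This keeps commutators with coordinates at the jet order of the original operator. -/
theorem jetLocal_mul (hU : IsOpen U) {g : Coord n → ℝ} (hg : ContDiffOn ℝ ∞ g U) (s : ℕ) :
    JetLocal s pairFun U fun (w : Fld U V × Fld U V) => jet s (pairFun (w.1, Fld.mul g hg w.2)) := by
  refine JetLocal.jet_map hU contDiffOn_pairFun ?_ s
  refine JetLocal.congr (((JetLocal.self.comp_contDiff contDiff_fst).prodMk
    ((JetLocal.self.comp_contDiff contDiff_snd).smul hg))) fun i y hy => rfl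

theorem IsLocOp.mul (hU : IsOpen U) (hP : IsLocOp s P) {g : Coord n → ℝ}
    (hg : ContDiffOn ℝ ∞ g U) : IsLocOp s fun φ η => P φ (Fld.mul g hg η) := by
  obtain ⟨p, hp, hP⟩ := hP
  exact ((jetLocal_mul hU hg s).comp hp).congr fun w y hy => hP (w.1, Fld.mul g hg w.2) y hy

theorem IsLocOp.comm (hU : IsOpen U) (hP : IsLocOp s P) (j : Fin n) : IsLocOp s (comm j P) :=
  JetLocal.sub (hP.mul hU _)
    (JetLocal.smul (EuclideanSpace.proj (𝕜 := ℝ) j).contDiff.contDiffOn hP)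

theorem IsLocOp.eulerOp (hU : IsOpen U) (hP : IsLocOp s P) : IsLocOp (s + 1) (eulerOp P) :=
  JetLocal.sum _ fun j _ =>
    (JetLocal.fderiv hU contDiffOn_pairFun (hP.comm hU j)).comp_contDiff
      (g := fun L => L (EuclideanSpace.single j 1)) (contDiff_id.clm_apply contDiff_const)

/-- Local operators depend only on the germs of the fields. -/
theorem IsLocOp.congr_germ (hP : IsLocOp s P) {φ φ' η η' : Fld U V} {y : Coord n} (hy : y ∈ U)
    (h : (φ : Coord n → V) =ᶠ[𝓝 y] φ') (h' : (η : Coord n → V) =ᶠ[𝓝 y] η') :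
    P φ η y = P φ' η' y := by
  refine JetLocal.eq_of_jet_eq hP (i := (φ, η)) (j := (φ', η')) hy (jet_congr ?_)
  filter_upwards [h, h'] with z h1 h2
  simp [pairFun, h1, h2]

theorem IsLinOp.comm (hP : IsLinOp P) (j : Fin n) : IsLinOp (comm j P) := by
  constructor
  · intro φ η η' y hy
    have : Fld.coordMul j (η + η') = Fld.coordMul j η + Fld.coordMul j η' :=
      Subtype.ext (funext fun z => smul_add _ _ _)
    simp only [VarBicomplex.comm, this, hP.add _ _ _ y hy, smul_add]
    abel
  · intro φ c η y hy
    have : Fld.coordMul j (c • η) = c • Fld.coordMul j η :=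
      Subtype.ext (funext fun z => smul_comm _ _ _)
    simp only [VarBicomplex.comm, this, hP.smul _ _ _ y hy, smul_sub, smul_comm c]

theorem IsLinOp.eulerOp (hU : IsOpen U) (hl : IsLocOp s P) (hP : IsLinOp P) :
    IsLinOp (eulerOp P) := by
  have hd : ∀ j φ η, ∀ y ∈ U, DifferentiableAt ℝ (VarBicomplex.comm j P φ η) y :=
    fun j φ η y hy => (((hl.comm hU j).contDiffOn hU φ η).contDiffAt
      (hU.mem_nhds hy)).differentiableAt (by simp)
  constructor
  · intro φ η η' y hy
    simp only [VarBicomplex.eulerOp, ← Finset.sum_add_distrib]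
    refine Finset.sum_congr rfl fun j _ => ?_
    have e : VarBicomplex.comm j P φ (η + η') =ᶠ[𝓝 y]
        VarBicomplex.comm j P φ η + VarBicomplex.comm j P φ η' := by
      filter_upwards [hU.mem_nhds hy] with z hz using (hP.comm j).add φ η η' z hz
    rw [e.fderiv_eq, fderiv_add (hd j φ η y hy) (hd j φ η' y hy)]
    rfl
  · intro φ c η y hy
    simp only [VarBicomplex.eulerOp, Finset.smul_sum]
    refine Finset.sum_congr rfl fun j _ => ?_
    have e : VarBicomplex.comm j P φ (c • η) =ᶠ[𝓝 y] c • VarBicomplex.comm j P φ η := by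
      filter_upwards [hU.mem_nhds hy] with z hz using (hP.comm j).smul φ c η z hz
    rw [e.fderiv_eq, fderiv_const_smul (hd j φ η y hy)]
    rfl

theorem IsLinOp.sub {Q : Fld U V → Fld U V → Coord n → X} (hP : IsLinOp P) (hQ : IsLinOp Q) :
    IsLinOp fun φ η y => P φ η y - Q φ η y := by
  constructor
  · intro φ η η' y hy
    simp only [hP.add _ _ _ y hy, hQ.add _ _ _ y hy]
    abel
  · intro φ c η y hy
    simp only [hP.smul _ _ _ y hy, hQ.smul _ _ _ y hy, smul_sub]

theorem IsLinOp.const_smul (c : ℝ) (hP : IsLinOp P) : IsLinOp fun φ η y => c • P φ η y := by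
  constructor
  · intro φ η η' y hy
    simp only [hP.add _ _ _ y hy, smul_add]
  · intro φ c' η y hy
    simp only [hP.smul _ _ _ y hy, smul_comm c]

theorem HasOrderLT.congr : ∀ {m : ℕ} {P P' : Fld U V → Fld U V → Coord n → X},
    (∀ φ η, ∀ y ∈ U, P' φ η y = P φ η y) → HasOrderLT m P → HasOrderLT m P'
  | 0, _, _, h, hP => fun φ η y hy => (h φ η y hy).trans (hP φ η y hy)
  | _ + 1, _, _, h, hP => fun j => HasOrderLT.congr
      (fun φ η y hy => by simp only [comm, h _ _ y hy]) (hP j)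

/-- `∑ ∂_j ∘ [P, x_j] = m P` modulo operators of lower order. -/
theorem HasOrderLT.eulerOp_sub (hU : IsOpen U) : ∀ {m : ℕ} {P : Fld U V → Fld U V → Coord n → X},
    IsLocOp s P → HasOrderLT (m + 1) P →
      HasOrderLT m fun φ η y => eulerOp P φ η y - (m : ℝ) • P φ η y
  | 0, P, _, hP => by
    intro φ η y hy
    have h : ∀ j, comm j P φ η =ᶠ[𝓝 y] 0 := fun j => by
      filter_upwards [hU.mem_nhds hy] with z hz using hP j φ η z hz
    simp [eulerOp, (h _).fderiv_eq]
  | m + 1, P, hl, hP => by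
    intro i
    refine HasOrderLT.congr (fun φ η y hy => ?_)
      (HasOrderLT.eulerOp_sub hU (hl.comm hU i) (hP i))
    have hd : ∀ j η, DifferentiableAt ℝ (comm j P φ η) y :=
      fun j η => (((hl.comm hU j).contDiffOn hU φ η).contDiffAt
        (hU.mem_nhds hy)).differentiableAt (by simp)
    have h1 : ∀ j, comm j (comm i P) φ η =
        fun z => comm j P φ (Fld.coordMul i η) z - z i • comm j P φ η z := by
      intro j
      funext z
      have : Fld.coordMul i (Fld.coordMul j η) = Fld.coordMul j (Fld.coordMul i η) :=
        Subtype.ext (funext fun z => smul_comm _ _ _)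
      simp only [comm, this, smul_sub, smul_comm (z j)]
      abel
    have hx : HasFDerivAt (fun z : Coord n => z i) (EuclideanSpace.proj (𝕜 := ℝ) i) y :=
      (EuclideanSpace.proj (𝕜 := ℝ) i).hasFDerivAt
    have h2 : ∀ j, fderiv ℝ (comm j (comm i P) φ η) y (EuclideanSpace.single j 1) =
        fderiv ℝ (comm j P φ (Fld.coordMul i η)) y (EuclideanSpace.single j 1) -
          (y i • fderiv ℝ (comm j P φ η) y (EuclideanSpace.single j 1) +
            (if i = j then (1 : ℝ) else 0) • comm j P φ η y) := by
      intro j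
      have h3 := ((hd j (Fld.coordMul i η)).hasFDerivAt.sub
        (hx.smul (hd j η).hasFDerivAt)).fderiv
      rw [h1 j]
      refine (congrArg (fun L : Coord n →L[ℝ] X => L (EuclideanSpace.single j 1)) h3).trans ?_
      simp
    -- Thus the commutator of `eulerOp P` with `x_i` is `eulerOp [P, x_i] + [P, x_i]`: the extra
    -- term comes from `∂_j` hitting `x_i`. It accounts for the step from `m` to `m + 1` in the
    -- induction.
    have h5 : eulerOp (comm i P) φ η y =
        eulerOp P φ (Fld.coordMul i η) y - (y i • eulerOp P φ η y + comm i P φ η y) := by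
      simp only [eulerOp, h2, Finset.sum_sub_distrib, Finset.sum_add_distrib, Finset.smul_sum]
      simp
    simp only [h5]
    simp only [comm]
    push_cast
    module

/-- If `η` vanishes to order `s` at `y`, then an operator of jet order `s` cannot distinguish it
from zero there. -/
theorem jet_pairFun (hU : IsOpen U) (φ η : Fld U V) {y : Coord n} (hy : y ∈ U)
    (h : ∀ i : ℕ, i < s + 1 → iteratedFDeriv ℝ i (η : Coord n → V) y = 0) :
    jet s (pairFun (φ, η)) y = jet s (pairFun (φ, 0)) y := by
  have h1 : ContDiffAt ℝ ∞ (pairFun (φ, 0)) y :=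
    (contDiffOn_pairFun (φ, 0)).contDiffAt (hU.mem_nhds hy)
  have hη : ContDiffAt ℝ ∞ (η : Coord n → V) y := ContDiffOn.contDiffAt η.2 (hU.mem_nhds hy)
  have h2 : ContDiffAt ℝ ∞ (ContinuousLinearMap.inr ℝ V V ∘ (η : Coord n → V)) y :=
    (ContinuousLinearMap.contDiff _).contDiffAt.comp y hη
  have h3 : pairFun (φ, η) = pairFun (φ, 0) + ContinuousLinearMap.inr ℝ V V ∘ (η : Coord n → V) := by
    funext z
    simp [pairFun]
  rw [h3, jet_add h1 h2]
  refine add_eq_left.2 (funext fun i => ?_)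
  have h4 := (ContinuousLinearMap.inr ℝ V V).iteratedFDeriv_comp_left (i := (i : ℕ)) hη
    (by exact_mod_cast le_top)
  refine h4.trans ?_
  rw [h i i.2]
  ext v <;> simp

/-- In the Leibniz bound, the term without derivatives on the factor `z j - y j` vanishes at `y`,
and every other term contains a derivative of `η` of order below `m`. -/
theorem iteratedFDeriv_sub_mul_eq_zero (hU : IsOpen U) (j : Fin n) {η : Coord n → V}
    (hη : ContDiffOn ℝ ∞ η U) {y : Coord n} (hy : y ∈ U) {m : ℕ}
    (h : ∀ i < m, iteratedFDeriv ℝ i η y = 0) :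
    ∀ i < m + 1, iteratedFDeriv ℝ i (fun z => (z j - y j) • η z) y = 0 := by
  intro i hi
  have hg : ContDiffOn ℝ ∞ (fun z : Coord n => z j - y j) U :=
    ((EuclideanSpace.proj (𝕜 := ℝ) j).contDiff.sub contDiff_const).contDiffOn
  have h1 := norm_iteratedFDerivWithin_smul_le hg hη hU.uniqueDiffOn hy (n := i)
    (by exact_mod_cast le_top)
  rw [iteratedFDerivWithin_of_isOpen i hU hy] at h1
  rw [← norm_le_zero_iff]
  refine h1.trans (Finset.sum_eq_zero fun l hl => ?_).le
  rcases Nat.eq_zero_or_pos l with rfl | hl0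
  · simp
  · have h2 := iteratedFDerivWithin_of_isOpen (𝕜 := ℝ) (f := η) (i - l) hU hy
    rw [h2, h (i - l) (by rw [Finset.mem_range] at hl; omega)]
    simp

/-- At the point `y`, the commutator with `x_j` applied to `η` equals `P` applied to `(x_j - y_j)
η`, which vanishes at `y` to one order more than `η`. So each commutator lowers the required order
of vanishing by one. -/
theorem HasOrderLT.of_vanishing (hU : IsOpen U) : ∀ {m : ℕ}
    {P : Fld U V → Fld U V → Coord n → X}, IsLinOp P →
    (∀ φ η : Fld U V, ∀ y ∈ U, (∀ i < m, iteratedFDeriv ℝ i (η : Coord n → V) y = 0) → P φ η y = 0) →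
    HasOrderLT m P
  | 0, _, _, h => fun φ η y hy => h φ η y hy fun i hi => absurd hi (Nat.not_lt_zero i)
  | m + 1, P, hP, h => fun j => by
    refine HasOrderLT.of_vanishing hU (hP.comm j) fun φ η y hy hi => ?_
    have hg : ContDiffOn ℝ ∞ (fun z : Coord n => z j - y j) U :=
      ((EuclideanSpace.proj (𝕜 := ℝ) j).contDiff.sub contDiff_const).contDiffOn
    have h1 := h φ (Fld.mul (fun z => z j - y j) hg η) y hy
      (iteratedFDeriv_sub_mul_eq_zero hU j η.2 hy hi)
    have h2 : Fld.coordMul j η = Fld.mul (fun z => z j - y j) hg η + y j • η :=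
      Subtype.ext (funext fun z => by
        change z j • (η : Coord n → V) z =
          (z j - y j) • (η : Coord n → V) z + y j • (η : Coord n → V) z
        rw [← add_smul, sub_add_cancel])
    rw [comm, h2, hP.add _ _ _ y hy, hP.smul _ _ _ y hy, h1, zero_add, sub_self]

/-- Connects jet order with the algebraic notion of order on which the inductions run. -/
theorem IsLocOp.hasOrderLT (hU : IsOpen U) (hl : IsLocOp s P) (hP : IsLinOp P) :
    HasOrderLT (s + 1) P :=
  HasOrderLT.of_vanishing hU hP fun φ η _ hy h =>
    (JetLocal.eq_of_jet_eq hl (i := (φ, η)) (j := (φ, 0)) hy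
      (jet_pairFun hU φ η hy h)).trans (hP.zero φ hy)

/-- Operators of order zero commute with smooth functions. -/
theorem HasOrderLT.map_mul (hP : IsLinOp P) (h : HasOrderLT 1 P)
    {g : Coord n → ℝ} (hg : ContDiff ℝ ∞ g) (φ η : Fld U V) {y : Coord n} (hy : y ∈ U) :
    P φ (Fld.mul g hg.contDiffOn η) y = g y • P φ η y := by
  obtain ⟨q, hq, hgq⟩ := exists_hadamard hg y
  -- By Hadamard's lemma at `y`, what remains after `g y • η` is a sum of terms `(x_j - y_j) (q_j
  -- η)`; on each of them `P` evaluates at `y` to a commutator, which is zero.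
  have h1 : Fld.mul g hg.contDiffOn η = g y • η + ∑ j,
      (Fld.coordMul j (Fld.mul (q j) (hq j).contDiffOn η) +
        (-y j) • Fld.mul (q j) (hq j).contDiffOn η) := by
    refine Subtype.ext (funext fun z => ?_)
    have h2 : ((∑ j, (Fld.coordMul j (Fld.mul (q j) (hq j).contDiffOn η) +
        (-y j) • Fld.mul (q j) (hq j).contDiffOn η) : Fld U V) : Coord n → V) z =
        ∑ j, ((z j - y j) * q j z) • (η : Coord n → V) z := by
      rw [AddSubmonoidClass.coe_finsetSum, Finset.sum_apply]
      refine Finset.sum_congr rfl fun j _ => ?_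
      change z j • q j z • (η : Coord n → V) z + (-y j) • q j z • (η : Coord n → V) z = _
      module
    change g z • (η : Coord n → V) z = g y • (η : Coord n → V) z + _
    rw [h2, hgq z, add_smul, Finset.sum_smul]
  rw [h1, hP.add _ _ _ y hy, hP.smul _ _ _ y hy, hP.sum φ _ _ hy]
  refine add_eq_left.2 (Finset.sum_eq_zero fun j _ => ?_)
  have h3 := h j φ (Fld.mul (q j) (hq j).contDiffOn η) y hy
  rw [hP.add _ _ _ y hy, hP.smul _ _ _ y hy, neg_smul, ← sub_eq_add_neg]
  exact h3

/-- `∫ P φ η = 0` for all `η` with compact support in `U`. -/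
def IntegralVanishes {k : ℕ} (P : Fld U V → Fld U V → Coord n → Coord n [⋀^Fin k]→L[ℝ] ℝ) :
    Prop :=
  ∀ φ η : Fld U V, (∃ K, IsCompact K ∧ K ⊆ U ∧ ∀ y ∉ K, (η : Coord n → V) y = 0) →
    ∀ v, ∫ y in U, P φ η y v = 0

/-- An operator of order zero commutes with multiplication by test functions `g`, so `∫ g (P φ η) =
0` for all `g`. The fundamental lemma of the calculus of variations gives zero almost everywhere,
and continuity gives zero everywhere. -/
theorem eq_zero_of_integralVanishes (hU : IsOpen U) {k : ℕ}
    {P : Fld U V → Fld U V → Coord n → Coord n [⋀^Fin k]→L[ℝ] ℝ} (hl : IsLocOp s P)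
    (hP : IsLinOp P) (h : HasOrderLT 1 P) (hi : IntegralVanishes P) (φ η : Fld U V) {y : Coord n}
    (hy : y ∈ U) : P φ η y = 0 := by
  ext v
  let f : Coord n → ℝ := fun y => P φ η y v
  have hf : ContinuousOn f U :=
    ((ContinuousAlternatingMap.apply ℝ (Coord n) ℝ v).contDiff.comp_contDiffOn
      (hl.contDiffOn hU φ η)).continuousOn
  have h1 : ∀ᵐ x ∂(volume : Measure (Coord n)), x ∈ U → f x = 0 := by
    refine hU.ae_eq_zero_of_integral_contDiff_smul_eq_zero
      (hf.locallyIntegrableOn hU.measurableSet) fun g hg hgc hgU => ?_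
    have h2 := hi φ (Fld.mul g hg.contDiffOn η) ⟨tsupport g, hgc, hgU, fun z hz => by
      change g z • (η : Coord n → V) z = _
      rw [image_eq_zero_of_notMem_tsupport hz, zero_smul]⟩ v
    rw [← setIntegral_eq_integral_of_forall_compl_eq_zero (s := U), ← h2]
    · refine setIntegral_congr_fun hU.measurableSet fun z hz => ?_
      simp only [h.map_mul hP hg φ η hz]
      rfl
    · intro z hz
      rw [image_eq_zero_of_notMem_tsupport fun h => hz (hgU h), zero_smul]
  have h3 : f =ᵐ[volume.restrict U] 0 := (ae_restrict_iff' hU.measurableSet).2 h1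
  exact Measure.eqOn_open_of_ae_eq h3 hU hf continuousOn_const hy

end LocalOperators

end

end VarBicomplex

namespace VarBicomplex
set_option linter.unusedSectionVars false
noncomputable section

/-! ## Exactness of the complex of linear local operators -/

section Exactness

variable {n : ℕ} {U : Set (Coord n)} {V : Type*} [NormedAddCommGroup V] [NormedSpace ℝ V] {k s : ℕ}

/-- The operator `∑ ι_j ∘ [P, x_j]`. -/
def contractOp (P : Fld U V → Fld U V → Coord n → Coord n [⋀^Fin (k + 1)]→L[ℝ] ℝ) (φ η : Fld U V)
    (y : Coord n) : Coord n [⋀^Fin k]→L[ℝ] ℝ :=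
  ∑ j, contraction (EuclideanSpace.single j 1) (comm j P φ η y)

/-- `P φ η` is a closed form on `U` for all `φ`, `η`. -/
def IsClosedOp (P : Fld U V → Fld U V → Coord n → Coord n [⋀^Fin k]→L[ℝ] ℝ) : Prop :=
  ∀ φ η, ∀ y ∈ U, extDeriv (P φ η) y = 0

theorem IsLocOp.contractOp (hU : IsOpen U)
    {P : Fld U V → Fld U V → Coord n → Coord n [⋀^Fin (k + 1)]→L[ℝ] ℝ} (hP : IsLocOp s P) :
    IsLocOp s (contractOp P) :=
  JetLocal.sum _ fun j _ => (hP.comm hU j).comp_contDiff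
    (contraction (EuclideanSpace.single j 1)).contDiff

theorem HasOrderLT.const_smul {X : Type*} [NormedAddCommGroup X] [NormedSpace ℝ X] (c : ℝ) :
    ∀ {m : ℕ} {P : Fld U V → Fld U V → Coord n → X}, HasOrderLT m P →
      HasOrderLT m fun φ η y => c • P φ η y
  | 0, _, h => fun φ η y hy => by simp only [h φ η y hy, smul_zero]
  | _ + 1, _, h => fun j => HasOrderLT.congr
      (fun φ η y _ => by simp only [comm, smul_sub, smul_comm c]) (HasOrderLT.const_smul c (h j))

/-- The last summand, `dx_j ⊗ P φ η`, is all that survives antisymmetrization when `P` has closed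
values: then `d ([P, x_j] η) = - dx_j ∧ P η`. -/
theorem hasFDerivAt_comm (hU : IsOpen U) {P : Fld U V → Fld U V → Coord n →
    Coord n [⋀^Fin k]→L[ℝ] ℝ} (hl : IsLocOp s P) (j : Fin n) (φ η : Fld U V) {y : Coord n}
    (hy : y ∈ U) : HasFDerivAt (comm j P φ η) (fderiv ℝ (P φ (Fld.coordMul j η)) y -
      (y j • fderiv ℝ (P φ η) y +
        (EuclideanSpace.proj (𝕜 := ℝ) j).smulRight (P φ η y))) y := by
  have hd : ∀ η, HasFDerivAt (P φ η) (fderiv ℝ (P φ η) y) y := fun η =>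
    (((hl.contDiffOn hU φ η).contDiffAt (hU.mem_nhds hy)).differentiableAt (by simp)).hasFDerivAt
  exact (hd _).sub ((EuclideanSpace.proj (𝕜 := ℝ) j).hasFDerivAt.smul (hd η))

-- Cartan's formula gives `d ι_j = ∂_j - ι_j d`. The first part sums to `eulerOp P`; in the second,
-- `d ([P, x_j] η) = - dx_j ∧ P η`, and `∑ ι_j (dx_j ∧ ·)` is multiplication by `n` minus the
-- degree.
open ContinuousAlternatingMap in
theorem IsClosedOp.extDeriv_contractOp (hU : IsOpen U)
    {P : Fld U V → Fld U V → Coord n → Coord n [⋀^Fin (k + 1)]→L[ℝ] ℝ} (hl : IsLocOp s P)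
    (hc : IsClosedOp P) (φ η : Fld U V) {y : Coord n} (hy : y ∈ U) :
    extDeriv (contractOp P φ η) y = eulerOp P φ η y + ((n : ℝ) - (k + 1)) • P φ η y := by
  have h1 : HasFDerivAt (contractOp P φ η) (∑ j, (contraction (EuclideanSpace.single j 1)).comp
      (fderiv ℝ (comm j P φ η) y)) y :=
    HasFDerivAt.fun_sum fun j _ => (contraction (EuclideanSpace.single j 1)).hasFDerivAt.comp y
      (hasFDerivAt_comm hU hl j φ η hy).differentiableAt.hasFDerivAt
  have h2 : ∀ j, alternatizeUncurryFin (fderiv ℝ (comm j P φ η) y) =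
      - alternatizeUncurryFin ((EuclideanSpace.proj (𝕜 := ℝ) j).smulRight (P φ η y)) := by
    intro j
    have h3 := congrArg (alternatizeUncurryFinCLM ℝ (Coord n) ℝ)
      (hasFDerivAt_comm hU hl j φ η hy).fderiv
    rw [map_sub, map_add, map_smul] at h3
    have h4 : alternatizeUncurryFinCLM ℝ (Coord n) ℝ (fderiv ℝ (P φ (Fld.coordMul j η)) y) = 0 :=
      hc φ _ y hy
    have h5 : alternatizeUncurryFinCLM ℝ (Coord n) ℝ (fderiv ℝ (P φ η) y) = 0 := hc φ η y hy
    rw [h4, h5, smul_zero, zero_add, zero_sub] at h3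
    exact h3
  rw [extDeriv, h1.fderiv, ← alternatizeUncurryFinCLM_apply, _root_.map_sum]
  simp only [alternatizeUncurryFinCLM_apply, alternatizeUncurryFin_contraction_comp, h2, map_neg,
    sub_neg_eq_add]
  rw [Finset.sum_add_distrib, sum_contraction_alternatizeUncurryFin]
  rfl

/-- A closed 0-form has zero derivative, so in `∂_j (P (x_j η) - x_j P η)` only the derivative of
the factor `x_j` contributes. This replaces the homotopy formula in degree zero, where there is
nothing to contract. -/
theorem IsClosedOp.eulerOp_zero_form (hU : IsOpen U)
    {P : Fld U V → Fld U V → Coord n → Coord n [⋀^Fin 0]→L[ℝ] ℝ} (hl : IsLocOp s P)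
    (hc : IsClosedOp P) (φ η : Fld U V) {y : Coord n} (hy : y ∈ U) :
    eulerOp P φ η y = - (n : ℝ) • P φ η y := by
  have h0 : ∀ η, fderiv ℝ (P φ η) y = 0 := by
    intro η
    ext v w
    have := congrArg (fun β => β fun _ => v) (hc φ η y hy)
    simp only [extDeriv, ContinuousAlternatingMap.alternatizeUncurryFin_apply] at this
    have hw : w = (0 : Fin 1).removeNth (fun _ => v) := Subsingleton.elim _ _
    rw [hw]
    simpa using this
  have h1 : ∀ j, fderiv ℝ (comm j P φ η) y (EuclideanSpace.single j 1) = - P φ η y := by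
    intro j
    rw [(hasFDerivAt_comm hU hl j φ η hy).fderiv, h0, h0]
    simp
  simp only [eulerOp, h1]
  ext v
  simp

/-- Closed linear local operators with values in functions vanish. -/
theorem eq_zero_of_isClosedOp (hU : IsOpen U) : ∀ {m : ℕ}
    {P : Fld U V → Fld U V → Coord n → Coord n [⋀^Fin 0]→L[ℝ] ℝ}, IsLocOp s P → IsLinOp P →
    HasOrderLT m P → IsClosedOp P → (0 = n → IntegralVanishes P) →
    ∀ φ η, ∀ y ∈ U, P φ η y = 0
  | 0, _, _, _, hm, _, _ => hm
  | m + 1, P, hl, hP, hm, hc, hi => by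
    intro φ η y hy
    -- The exceptional case is dimension zero and order zero, the only one that needs the integral
    -- condition.
    by_cases hnm : n + m = 0
    · obtain rfl : m = 0 := by omega
      exact eq_zero_of_integralVanishes hU hl hP hm (hi (by omega)) φ η hy
    -- The operator `eulerOp P - m P` of lower order is here `-(n + m) P`, so `P` itself already has
    -- lower order.
    · refine eq_zero_of_isClosedOp hU (m := m) hl hP ?_ hc hi φ η y hy
      have hnm' : ((n : ℝ) + m) ≠ 0 := by exact_mod_cast hnm
      refine HasOrderLT.congr (fun φ η y hy => ?_)
        ((hm.eulerOp_sub hU hl).const_smul (-((n : ℝ) + m)⁻¹))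
      simp only [hc.eulerOp_zero_form hU hl φ η hy]
      ext v
      simp only [ContinuousAlternatingMap.smul_apply, ContinuousAlternatingMap.sub_apply,
        smul_eq_mul]
      field_simp
      ring

theorem two_le_infty : minSmoothness ℝ 2 ≤ (∞ : WithTop ℕ∞) := by
  rw [minSmoothness_of_isRCLikeNormedField]
  exact WithTop.coe_le_coe.2 (le_top : (2 : ℕ∞) ≤ ⊤)

theorem extDeriv_zero (y : Coord n) :
    extDeriv (0 : Coord n → Coord n [⋀^Fin k]→L[ℝ] ℝ) y = 0 := by
  have h := extDeriv_smul (x := y) (0 : ℝ) (0 : Coord n → Coord n [⋀^Fin k]→L[ℝ] ℝ)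
  rwa [zero_smul, zero_smul] at h

/-- Closed linear local operators with values in `(k+1)`-forms, `k + 1 ≤ n`, are exact; in the top
degree the integrals of their values are required to vanish. -/
theorem exists_primitive_op (hU : IsOpen U) (hk : k + 1 ≤ n) : ∀ {m s : ℕ}
    {P : Fld U V → Fld U V → Coord n → Coord n [⋀^Fin (k + 1)]→L[ℝ] ℝ}, IsLocOp s P → IsLinOp P →
    HasOrderLT m P → IsClosedOp P → (k + 1 = n → IntegralVanishes P) →
    ∃ Q : Fld U V → Fld U V → Coord n → Coord n [⋀^Fin k]→L[ℝ] ℝ, IsLocOp (s + m) Q ∧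
      ∀ φ η, ∀ y ∈ U, extDeriv (Q φ η) y = P φ η y
  | 0, _, _, _, _, hm, _, _ =>
    ⟨fun _ _ => 0, JetLocal.of_contDiffOn contDiffOn_const, fun φ η y hy =>
      (extDeriv_zero y).trans (hm φ η y hy).symm⟩
  | m + 1, s, P, hl, hP, hm, hc, hi => by
    -- Exactly when the constant `c` below would vanish: top degree and order zero. There the
    -- integral condition forces `P = 0`.
    by_cases hnm : k + 1 = n ∧ m = 0
    · obtain ⟨hkn, rfl⟩ := hnm
      exact ⟨fun _ _ => 0, JetLocal.of_contDiffOn contDiffOn_const, fun φ η y hy =>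
        (extDeriv_zero y).trans (eq_zero_of_integralVanishes hU hl hP hm (hi hkn) φ η hy).symm⟩
    set c : ℝ := (n : ℝ) - (k + 1) + m with hcdef
    have hc0 : c ≠ 0 := by
      have h1 : c = ((n - (k + 1) + m : ℕ) : ℝ) := by
        rw [hcdef, Nat.cast_add, Nat.cast_sub hk]
        push_cast
        ring
      rw [h1, Nat.cast_ne_zero]
      omega
    have hsm : ∀ φ η, ContDiffOn ℝ ∞ (contractOp P φ η) U :=
      fun φ η => (hl.contractOp hU).contDiffOn hU φ η
    have hde : ∀ φ η, ContDiffOn ℝ ∞ (extDeriv (contractOp P φ η)) U :=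
      fun φ η => ContDiffOn.extDeriv hU (hsm φ η)
    have hdiff : ∀ {l : ℕ} {β : Coord n → Coord n [⋀^Fin l]→L[ℝ] ℝ}, ContDiffOn ℝ ∞ β U →
        ∀ y ∈ U, DifferentiableAt ℝ β y :=
      fun h y hy => (h.contDiffAt (hU.mem_nhds hy)).differentiableAt (by simp)
    -- The remainder of the homotopy formula, equal to `d (contractOp P) - c P`. It has lower order
    -- in `η` and is again closed; its jet order may rise by one because of the derivative in
    -- `eulerOp`, whence the bound `s + m` in the conclusion.
    let P' : Fld U V → Fld U V → Coord n → Coord n [⋀^Fin (k + 1)]→L[ℝ] ℝ :=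
      fun φ η y => eulerOp P φ η y - (m : ℝ) • P φ η y
    have hP' : ∀ φ η, ∀ y ∈ U, P' φ η y = extDeriv (contractOp P φ η) y - c • P φ η y := by
      intro φ η y hy
      simp only [P', hc.extDeriv_contractOp hU hl φ η hy, hcdef]
      module
    have hl' : IsLocOp (s + 1) P' := (hl.eulerOp hU).sub ((hl.mono_order (Nat.le_succ s)).const_smul _)
    have hc' : IsClosedOp P' := by
      intro φ η y hy
      have e : P' φ η =ᶠ[𝓝 y] extDeriv (contractOp P φ η) + (-c) • P φ η := by
        filter_upwards [hU.mem_nhds hy] with z hz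
        rw [hP' φ η z hz]
        ext v
        simp [sub_eq_add_neg]
      rw [e.extDeriv_eq, extDeriv_add (hdiff (hde φ η) y hy)
        ((hdiff (hl.contDiffOn hU φ η) y hy).const_smul (-c)), extDeriv_smul, hc φ η y hy,
        extDeriv_extDeriv_apply ((hsm φ η).contDiffAt (hU.mem_nhds hy)) two_le_infty]
      simp
    -- By locality `contractOp P φ η` vanishes off the support of `η`, so its differential
    -- integrates to zero and `∫ P' φ η = -c ∫ P φ η = 0`.
    have hi' : k + 1 = n → IntegralVanishes P' := by
      rintro hkn φ η ⟨K, hK, hKU, hη⟩ v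
      have hη0 : ∀ y ∈ U \ K, (η : Coord n → V) =ᶠ[𝓝 y] (0 : Fld U V) := by
        intro y hy
        filter_upwards [hK.isClosed.isOpen_compl.mem_nhds hy.2] with z hz using hη z hz
      have hP0 : ∀ y ∈ U \ K, P φ η y = 0 := fun y hy =>
        (hl.congr_germ hy.1 Filter.EventuallyEq.rfl (hη0 y hy)).trans (hP.zero φ hy.1)
      have hcon0 : ∀ y ∈ U \ K, contractOp P φ η y = 0 := by
        intro y hy
        refine Finset.sum_eq_zero fun j _ => ?_
        have h1 : comm j P φ η y = 0 :=
          ((hl.comm hU j).congr_germ hy.1 Filter.EventuallyEq.rfl (hη0 y hy)).trans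
            ((hP.comm j).zero φ hy.1)
        rw [h1, map_zero]
      have h1 := setIntegral_extDeriv_eq_zero hU hK hKU (hsm φ η) hcon0 v
      have h2 : ∫ y in U, P φ η y v = 0 := hi hkn φ η ⟨K, hK, hKU, hη⟩ v
      have hint : ∀ {β : Coord n → Coord n [⋀^Fin (k + 1)]→L[ℝ] ℝ}, ContDiffOn ℝ ∞ β U →
          (∀ y ∈ U \ K, β y = 0) → IntegrableOn (fun y => β y v) U := by
        intro β hβ hβ0
        have h3 : ContinuousOn (fun y => β y v) U :=
          (ContinuousAlternatingMap.apply ℝ (Coord n) ℝ v).continuous.comp_continuousOn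
            hβ.continuousOn
        exact ((h3.mono hKU).integrableOn_compact hK).of_forall_sdiff_eq_zero hU.measurableSet
          fun y hy => by rw [hβ0 y hy]; rfl
      have h4 : ∀ y ∈ U \ K, extDeriv (contractOp P φ η) y = 0 := by
        intro y hy
        have e : contractOp P φ η =ᶠ[𝓝 y] 0 := by
          filter_upwards [(hU.sdiff hK.isClosed).mem_nhds hy] with z hz using hcon0 z hz
        rw [e.extDeriv_eq, extDeriv_zero]
      have h5 : ∀ y ∈ U, P' φ η y v = extDeriv (contractOp P φ η) y v - c * P φ η y v := by
        intro y hy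
        rw [hP' φ η y hy]
        rfl
      rw [setIntegral_congr_fun hU.measurableSet h5,
        integral_sub (hint (hde φ η) h4) ((hint (hl.contDiffOn hU φ η) hP0).const_mul c), h1,
        integral_const_mul, h2, mul_zero, sub_zero]
    obtain ⟨Q, hQ, hQd⟩ := exists_primitive_op hU hk hl'
      ((hP.eulerOp hU hl).sub (hP.const_smul m)) (hm.eulerOp_sub hU hl) hc' hi'
    have hQl : IsLocOp (s + (m + 1)) fun φ η y => c⁻¹ • (contractOp P φ η y - Q φ η y) := by
      refine JetLocal.const_smul _ (((hl.contractOp hU).mono_order (by omega)).sub ?_)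
      have : s + 1 + m = s + (m + 1) := by omega
      rwa [this] at hQ
    -- From `P' = d (contractOp P) - c P = d Q` the primitive of `P` is `c⁻¹ (contractOp P - Q)`.
    refine ⟨_, hQl, fun φ η y hy => ?_⟩
    have e : (fun y => c⁻¹ • (contractOp P φ η y - Q φ η y)) =
        c⁻¹ • (contractOp P φ η + (-1 : ℝ) • Q φ η) := by
      funext z
      ext v
      simp [sub_eq_add_neg]
    rw [e, extDeriv_smul, extDeriv_add (hdiff (hsm φ η) y hy)
      ((hdiff (hQ.contDiffOn hU φ η) y hy).const_smul _), extDeriv_smul, hQd φ η y hy,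
      hP' φ η y hy]
    ext v
    simp only [ContinuousAlternatingMap.smul_apply, ContinuousAlternatingMap.add_apply,
      ContinuousAlternatingMap.sub_apply, smul_eq_mul]
    field_simp
    ring

end Exactness

end

end VarBicomplex

namespace VarBicomplex
set_option linter.unusedSectionVars false
noncomputable section

/-! ## Change of charts for differential forms -/

section Charts

variable {n : ℕ} {M : Type*} [TopologicalSpace M] [ChartedSpace (Coord n) M] {k : ℕ}

/-- The derivative of the inverse of the chart at `x₀`. -/
def symmDeriv (x₀ : M) (y : Coord n) : Coord n →L[ℝ] Coord n :=
  mfderiv 𝓘(ℝ, Coord n) (𝓡 n) (extChartAt (𝓡 n) x₀).symm y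

/-- The derivative of the chart at `x₀`. -/
def chartDeriv (x₀ x : M) : Coord n →L[ℝ] Coord n :=
  mfderiv (𝓡 n) 𝓘(ℝ, Coord n) (extChartAt (𝓡 n) x₀) x

/-- The value of a form at a point, as a form on `ℝⁿ`. -/
def RawForm.at (α : RawForm n M k) (x : M) : Coord n [⋀^Fin k]→L[ℝ] ℝ := α x

theorem formInChart_eq (α : RawForm n M k) (x₀ : M) (y : Coord n) :
    formInChart α x₀ y =
      (α.at ((extChartAt (𝓡 n) x₀).symm y)).compContinuousLinearMap (symmDeriv x₀ y) := rfl

/-- The coordinate change from the chart at `x₀` to the chart at `x₁`. -/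
def transition (x₀ x₁ : M) (y : Coord n) : Coord n :=
  extChartAt (𝓡 n) x₁ ((extChartAt (𝓡 n) x₀).symm y)

/-- The domain of the coordinate change from the chart at `x₀` to the chart at `x₁`. -/
def overlap (x₀ x₁ : M) : Set (Coord n) :=
  (extChartAt (𝓡 n) x₀).target ∩ (extChartAt (𝓡 n) x₀).symm ⁻¹' (extChartAt (𝓡 n) x₁).source

theorem isOpen_overlap (x₀ x₁ : M) : IsOpen (overlap (n := n) x₀ x₁) :=
  (continuousOn_extChartAt_symm x₀).isOpen_inter_preimage (isOpen_extChartAt_target x₀)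
    (isOpen_extChartAt_source x₁)

theorem transition_mem_overlap {x₀ x₁ : M} {y : Coord n} (hy : y ∈ overlap x₀ x₁) :
    transition x₀ x₁ y ∈ overlap x₁ x₀ := by
  refine ⟨(extChartAt (𝓡 n) x₁).map_source hy.2, ?_⟩
  rw [Set.mem_preimage, transition, (extChartAt (𝓡 n) x₁).left_inv hy.2]
  exact (extChartAt (𝓡 n) x₀).map_target hy.1

theorem transition_transition {x₀ x₁ : M} {y : Coord n} (hy : y ∈ overlap x₀ x₁) :
    transition x₁ x₀ (transition x₀ x₁ y) = y := by
  rw [transition, transition, (extChartAt (𝓡 n) x₁).left_inv hy.2,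
    (extChartAt (𝓡 n) x₀).right_inv hy.1]

theorem symm_transition {x₀ x₁ : M} {y : Coord n} (hy : y ∈ overlap x₀ x₁) :
    (extChartAt (𝓡 n) x₁).symm (transition x₀ x₁ y) = (extChartAt (𝓡 n) x₀).symm y :=
  (extChartAt (𝓡 n) x₁).left_inv hy.2

theorem mem_overlap_of_mem {x₀ x : M} (hx : x ∈ (extChartAt (𝓡 n) x₀).source) :
    extChartAt (𝓡 n) x x ∈ overlap x x₀ := by
  refine ⟨mem_extChartAt_target x, ?_⟩
  rw [Set.mem_preimage, extChartAt_to_inv]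
  exact hx

theorem transition_self_point (x₀ x : M) :
    transition x x₀ (extChartAt (𝓡 n) x x) = extChartAt (𝓡 n) x₀ x := by
  rw [transition, extChartAt_to_inv]

variable [IsManifold (𝓡 n) ∞ M]

theorem contDiffOn_transition (x₀ x₁ : M) :
    ContDiffOn ℝ ∞ (transition x₀ x₁) (overlap (n := n) x₀ x₁) :=
  contDiffOn_ext_coord_change x₁ x₀

theorem contDiffAt_transition {x₀ x₁ : M} {y : Coord n} (hy : y ∈ overlap x₀ x₁) :
    ContDiffAt ℝ ∞ (transition x₀ x₁) y :=
  (contDiffOn_transition x₀ x₁).contDiffAt ((isOpen_overlap x₀ x₁).mem_nhds hy)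

theorem mdifferentiableAt_symm {x₀ : M} {y : Coord n} (hy : y ∈ (extChartAt (𝓡 n) x₀).target) :
    MDifferentiableAt 𝓘(ℝ, Coord n) (𝓡 n) (extChartAt (𝓡 n) x₀).symm y :=
  ((contMDiffOn_extChartAt_symm (n := ∞) x₀).contMDiffAt
    ((isOpen_extChartAt_target x₀).mem_nhds hy)).mdifferentiableAt (by simp)

theorem mdifferentiableAt_chart {x₀ x : M} (hx : x ∈ (extChartAt (𝓡 n) x₀).source) :
    MDifferentiableAt (𝓡 n) 𝓘(ℝ, Coord n) (extChartAt (𝓡 n) x₀) x :=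
  (contMDiffAt_extChartAt' (n := ∞) (by rwa [extChartAt_source] at hx)).mdifferentiableAt (by simp)

theorem symmDeriv_eq {x₀ x₁ : M} {y : Coord n} (hy : y ∈ overlap x₀ x₁) :
    symmDeriv x₀ y =
      (symmDeriv x₁ (transition x₀ x₁ y)).comp (fderiv ℝ (transition x₀ x₁) y) := by
  have e : (extChartAt (𝓡 n) x₀).symm =ᶠ[𝓝 y]
      (extChartAt (𝓡 n) x₁).symm ∘ transition x₀ x₁ := by
    filter_upwards [(isOpen_overlap x₀ x₁).mem_nhds hy] with z hz using (symm_transition hz).symm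
  have h1 := mfderiv_comp (I := 𝓘(ℝ, Coord n)) (I' := 𝓘(ℝ, Coord n)) (I'' := 𝓡 n) y
    (mdifferentiableAt_symm (transition_mem_overlap hy).1)
    (((contDiffAt_transition hy).differentiableAt (by simp)).mdifferentiableAt)
  have h2 := e.mfderiv_eq (I := 𝓘(ℝ, Coord n)) (I' := 𝓡 n)
  rw [mfderiv_eq_fderiv] at h1
  exact h2.trans h1

theorem chartDeriv_comp_symmDeriv {x₀ x₁ : M} {y : Coord n} (hy : y ∈ overlap x₀ x₁) :
    (chartDeriv x₁ ((extChartAt (𝓡 n) x₀).symm y)).comp (symmDeriv x₀ y) =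
      fderiv ℝ (transition x₀ x₁) y := by
  have h1 := mfderiv_comp (I := 𝓘(ℝ, Coord n)) (I' := 𝓡 n) (I'' := 𝓘(ℝ, Coord n)) y
    (mdifferentiableAt_chart hy.2) (mdifferentiableAt_symm hy.1)
  exact h1.symm.trans mfderiv_eq_fderiv

theorem mem_overlap_self {x₀ : M} {y : Coord n} (hy : y ∈ (extChartAt (𝓡 n) x₀).target) :
    y ∈ overlap x₀ x₀ :=
  ⟨hy, (extChartAt (𝓡 n) x₀).map_target hy⟩

theorem fderiv_transition_self {x₀ : M} {y : Coord n}
    (hy : y ∈ (extChartAt (𝓡 n) x₀).target) :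
    fderiv ℝ (transition x₀ x₀) y = ContinuousLinearMap.id ℝ (Coord n) := by
  have e : transition x₀ x₀ =ᶠ[𝓝 y] id := by
    filter_upwards [(isOpen_extChartAt_target x₀).mem_nhds hy] with z hz using
      (extChartAt (𝓡 n) x₀).right_inv hz
  rw [e.fderiv_eq, fderiv_id]

theorem fderiv_transition_comp {x₀ x₁ : M} {y : Coord n} (hy : y ∈ overlap x₀ x₁) :
    (fderiv ℝ (transition x₁ x₀) (transition x₀ x₁ y)).comp (fderiv ℝ (transition x₀ x₁) y) =
      ContinuousLinearMap.id ℝ (Coord n) := by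
  have e : transition x₁ x₀ ∘ transition x₀ x₁ =ᶠ[𝓝 y] id := by
    filter_upwards [(isOpen_overlap x₀ x₁).mem_nhds hy] with z hz using transition_transition hz
  have h := fderiv_comp y
    ((contDiffAt_transition (transition_mem_overlap hy)).differentiableAt (by simp))
    ((contDiffAt_transition hy).differentiableAt (by simp))
  rw [← h, e.fderiv_eq, fderiv_id]

theorem chartDeriv_comp_symmDeriv_self {x₀ : M} {y : Coord n}
    (hy : y ∈ (extChartAt (𝓡 n) x₀).target) :
    (chartDeriv x₀ ((extChartAt (𝓡 n) x₀).symm y)).comp (symmDeriv x₀ y) =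
      ContinuousLinearMap.id ℝ (Coord n) :=
  (chartDeriv_comp_symmDeriv (mem_overlap_self hy)).trans (fderiv_transition_self hy)

/-- In finite dimension a one-sided inverse is two-sided, so this follows from the opposite
composition. -/
theorem symmDeriv_comp_chartDeriv {x₀ : M} {y : Coord n}
    (hy : y ∈ (extChartAt (𝓡 n) x₀).target) :
    (symmDeriv x₀ y).comp (chartDeriv x₀ ((extChartAt (𝓡 n) x₀).symm y)) =
      ContinuousLinearMap.id ℝ (Coord n) := by
  let A : Module.End ℝ (Coord n) :=
    (chartDeriv x₀ ((extChartAt (𝓡 n) x₀).symm y)).toLinearMap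
  let B : Module.End ℝ (Coord n) := (symmDeriv x₀ y).toLinearMap
  have h : A * B = 1 := LinearMap.ext fun v =>
    congrArg (fun L : Coord n →L[ℝ] Coord n => L v) (chartDeriv_comp_symmDeriv_self hy)
  exact ContinuousLinearMap.ext fun v => LinearMap.congr_fun (mul_eq_one_comm.1 h) v

/-- The coordinate expressions of a form in two charts. -/
theorem formInChart_transition (α : RawForm n M k) {x₀ x₁ : M} {y : Coord n}
    (hy : y ∈ overlap x₀ x₁) :
    formInChart α x₀ y = (formInChart α x₁ (transition x₀ x₁ y)).compContinuousLinearMap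
      (fderiv ℝ (transition x₀ x₁) y) := by
  rw [formInChart_eq, formInChart_eq, symm_transition hy, symmDeriv_eq hy]
  rfl

theorem formInChart_eventuallyEq (α : RawForm n M k) {x₀ x₁ : M} {y : Coord n}
    (hy : y ∈ overlap x₀ x₁) :
    formInChart α x₀ =ᶠ[𝓝 y] fun z =>
      (formInChart α x₁ (transition x₀ x₁ z)).compContinuousLinearMap
        (fderiv ℝ (transition x₀ x₁) z) := by
  filter_upwards [(isOpen_overlap x₀ x₁).mem_nhds hy] with z hz using formInChart_transition α hz

/-- Smoothness at a point can be checked in any chart. -/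
theorem contDiffAt_formInChart {α : RawForm n M k} {x₀ x₁ : M} {y : Coord n}
    (hy : y ∈ overlap x₀ x₁) (h : ContDiffAt ℝ ∞ (formInChart α x₁) (transition x₀ x₁ y)) :
    ContDiffAt ℝ ∞ (formInChart α x₀) y := by
  refine ContDiffAt.congr_of_eventuallyEq ?_ (formInChart_eventuallyEq α hy)
  exact contDiffWithinAt_compContinuousLinearMap (S := Set.univ)
    (ContDiffAt.comp y h (contDiffAt_transition hy))
    ((contDiffAt_transition hy).fderiv_right (m := ∞) (by simp))

/-- It suffices to look at each point in its own chart. This matters for local forms, whose formulas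
cover only the part of a chart over which the bundle is trivialized. -/
theorem isSmoothForm_of_contDiffAt {α : RawForm n M k}
    (h : ∀ x : M, ContDiffAt ℝ ∞ (formInChart α x) (extChartAt (𝓡 n) x x)) : IsSmoothForm α := by
  intro x₀ y hy
  have hy' : y ∈ overlap x₀ ((extChartAt (𝓡 n) x₀).symm y) := ⟨hy, mem_extChartAt_source _⟩
  exact (contDiffAt_formInChart hy' (h _)).contDiffWithinAt

theorem IsSmoothForm.contDiffAt {α : RawForm n M k} (hα : IsSmoothForm α) {x₀ : M} {y : Coord n}
    (hy : y ∈ (extChartAt (𝓡 n) x₀).target) : ContDiffAt ℝ ∞ (formInChart α x₀) y :=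
  (hα x₀).contDiffAt ((isOpen_extChartAt_target x₀).mem_nhds hy)

/-- The exterior derivative can be computed in any chart. -/
theorem extDerivAt_eq (α : RawForm n M k) {x₀ x : M} (hx : x ∈ (extChartAt (𝓡 n) x₀).source)
    (h : DifferentiableAt ℝ (formInChart α x₀) (extChartAt (𝓡 n) x₀ x)) :
    extDerivAt α x =
      (extDeriv (formInChart α x₀) (extChartAt (𝓡 n) x₀ x)).compContinuousLinearMap
        (chartDeriv x₀ x) := by
  have hy := mem_overlap_of_mem hx
  have h0 : DifferentiableAt ℝ (formInChart α x₀) (transition x x₀ (extChartAt (𝓡 n) x x)) := by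
    rwa [transition_self_point]
  have h1 := extDeriv_pullback h0 (contDiffAt_transition hy) two_le_infty
  rw [← (formInChart_eventuallyEq α hy).extDeriv_eq, transition_self_point,
    ← chartDeriv_comp_symmDeriv hy] at h1
  have h2 := symmDeriv_comp_chartDeriv (mem_extChartAt_target (I := 𝓡 n) x)
  rw [extChartAt_to_inv] at h1 h2
  have h3 : extDerivAt α x = (extDeriv (formInChart α x)
      (extChartAt (𝓡 n) x x)).compContinuousLinearMap (chartDeriv x x) := rfl
  rw [h3, h1]
  have h4 : ((chartDeriv x₀ x).comp (symmDeriv x (extChartAt (𝓡 n) x x))).comp (chartDeriv x x) =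
      chartDeriv x₀ x := by
    rw [ContinuousLinearMap.comp_assoc, h2, ContinuousLinearMap.comp_id]
  conv_rhs => rw [← h4]
  rfl

theorem isExtDeriv_iff {α : RawForm n M k} {β : RawForm n M (k + 1)} :
    IsExtDeriv α β ↔ ∀ x, β x = extDerivAt α x :=
  ⟨fun ⟨_, h⟩ x => ContinuousAlternatingMap.ext fun v => h x v,
    fun h => ⟨rfl, fun x v => congrArg (fun β => β v) (h x)⟩⟩

/-- `extDerivAt` uses the chart centred at the point. This form allows `β = dα` to be checked as an
identity in `ℝⁿ` in any chart around the point. -/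
theorem eq_extDerivAt_iff {α : RawForm n M k} {β : RawForm n M (k + 1)} {x₀ x : M}
    (hx : x ∈ (extChartAt (𝓡 n) x₀).source)
    (h : DifferentiableAt ℝ (formInChart α x₀) (extChartAt (𝓡 n) x₀ x)) :
    β x = extDerivAt α x ↔ formInChart β x₀ (extChartAt (𝓡 n) x₀ x) =
      extDeriv (formInChart α x₀) (extChartAt (𝓡 n) x₀ x) := by
  have hy := (extChartAt (𝓡 n) x₀).map_source hx
  have h1 := chartDeriv_comp_symmDeriv_self hy
  have h2 := symmDeriv_comp_chartDeriv hy
  rw [(extChartAt (𝓡 n) x₀).left_inv hx] at h1 h2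
  have h3 : formInChart β x₀ (extChartAt (𝓡 n) x₀ x) = (β.at x).compContinuousLinearMap
      (symmDeriv x₀ (extChartAt (𝓡 n) x₀ x)) := by
    rw [formInChart_eq, (extChartAt (𝓡 n) x₀).left_inv hx]
  rw [extDerivAt_eq α hx h, h3]
  constructor
  · intro e
    have e' : β.at x = (extDeriv (formInChart α x₀)
      (extChartAt (𝓡 n) x₀ x)).compContinuousLinearMap (chartDeriv x₀ x) := e
    rw [e']
    ext v
    exact congrArg _ (funext fun i => congrArg (fun L : Coord n →L[ℝ] Coord n => L (v i)) h1)
  · intro e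
    rw [← e]
    refine ContinuousAlternatingMap.ext fun v => ?_
    exact congrArg (β.at x)
      (funext fun i => (congrArg (fun L : Coord n →L[ℝ] Coord n => L (v i)) h2).symm)

theorem IsExtDeriv.formInChart_eq {α : RawForm n M k} {β : RawForm n M (k + 1)}
    (h : IsExtDeriv α β) {x₀ : M} {y : Coord n} (hy : y ∈ (extChartAt (𝓡 n) x₀).target)
    (hα : DifferentiableAt ℝ (formInChart α x₀) y) :
    formInChart β x₀ y = extDeriv (formInChart α x₀) y := by
  have e := (extChartAt (𝓡 n) x₀).right_inv hy
  have := (eq_extDerivAt_iff (β := β) ((extChartAt (𝓡 n) x₀).map_target hy) (by rwa [e])).1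
    (isExtDeriv_iff.1 h _)
  rwa [e] at this

/-- `d² = 0`. -/
theorem IsExtDeriv.isExtDeriv_zero {α : RawForm n M k} {β : RawForm n M (k + 1)}
    (hα : IsSmoothForm α) (h : IsExtDeriv α β) :
    IsExtDeriv β (0 : RawForm n M (k + 1 + 1)) := by
  refine isExtDeriv_iff.2 fun x => ?_
  have hy := mem_extChartAt_target (I := 𝓡 n) x
  have e : formInChart β x =ᶠ[𝓝 (extChartAt (𝓡 n) x x)] extDeriv (formInChart α x) := by
    filter_upwards [(isOpen_extChartAt_target x).mem_nhds hy] with z hz using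
      h.formInChart_eq hz ((hα.contDiffAt hz).differentiableAt (by simp))
  have h1 : ContDiffAt ℝ ∞ (formInChart α x) (extChartAt (𝓡 n) x x) := hα.contDiffAt hy
  have h2 := ((ContDiffOn.extDeriv (isOpen_extChartAt_target x) (hα x)).contDiffAt
    ((isOpen_extChartAt_target x).mem_nhds hy)).congr_of_eventuallyEq e
  refine (eq_extDerivAt_iff (mem_extChartAt_source x) (h2.differentiableAt (by simp))).2 ?_
  rw [e.extDeriv_eq, extDeriv_extDeriv_apply h1 two_le_infty, formInChart_zero]
  rfl

end Charts

end

end VarBicomplex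

namespace VarBicomplex
set_option linter.unusedSectionVars false
noncomputable section

/-! ## Coordinate expressions of sections -/

section Sections

variable {n : ℕ} {M : Type*} [TopologicalSpace M] [ChartedSpace (Coord n) M]
  [IsManifold (𝓡 n) ∞ M]
  {Fm : Type*} [NormedAddCommGroup Fm] [NormedSpace ℝ Fm]
  {F : M → Type*} [TopologicalSpace (TotalSpace Fm F)] [∀ x, TopologicalSpace (F x)]
  [FiberBundle Fm F] [∀ x, AddCommGroup (F x)] [∀ x, Module ℝ (F x)]
  [VectorBundle ℝ Fm F] [ContMDiffVectorBundle ∞ Fm F (𝓡 n)]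

/-- The coordinate expression of a section as a field on the domain of the coordinates. -/
def secFld (ψ : Sec n Fm F) (x₀ : M) : Fld (adaptedTarget n Fm F x₀) Fm :=
  ⟨secInChart ψ x₀, contDiffOn_secInChart ψ x₀⟩

theorem secInChart_smul (t : ℝ) (η : Sec n Fm F) {x₀ : M} {y : Coord n}
    (hy : y ∈ adaptedTarget n Fm F x₀) : secInChart (t • η) x₀ y = t • secInChart η x₀ y :=
  ((trivializationAt Fm F x₀).linear ℝ hy.2).2 t _

variable (n Fm F) in
/-- The domain of the coordinates of `M` and of `F` at `x₀`. -/
def adaptedSource (x₀ : M) : Set M :=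
  (extChartAt (𝓡 n) x₀).source ∩ (trivializationAt Fm F x₀).baseSet

theorem isOpen_adaptedSource (x₀ : M) : IsOpen (adaptedSource n Fm F x₀) :=
  (isOpen_extChartAt_source x₀).inter (trivializationAt Fm F x₀).open_baseSet

theorem mem_adaptedSource (x₀ : M) : x₀ ∈ adaptedSource n Fm F x₀ :=
  ⟨mem_extChartAt_source x₀, FiberBundle.mem_baseSet_trivializationAt' x₀⟩

theorem extChartAt_mem_adaptedTarget {x₀ x : M} (hx : x ∈ adaptedSource n Fm F x₀) :
    extChartAt (𝓡 n) x₀ x ∈ adaptedTarget n Fm F x₀ := by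
  refine ⟨(extChartAt (𝓡 n) x₀).map_source hx.1, ?_⟩
  rw [Set.mem_preimage, (extChartAt (𝓡 n) x₀).left_inv hx.1]
  exact hx.2

theorem symm_mem_adaptedSource {x₀ : M} {y : Coord n} (hy : y ∈ adaptedTarget n Fm F x₀) :
    (extChartAt (𝓡 n) x₀).symm y ∈ adaptedSource n Fm F x₀ :=
  ⟨(extChartAt (𝓡 n) x₀).map_target hy.1, hy.2⟩

variable (n Fm F) in
/-- The domain of the change of adapted coordinates. -/
def adaptedOverlap (x₀ x₁ : M) : Set (Coord n) :=
  adaptedTarget n Fm F x₀ ∩ (extChartAt (𝓡 n) x₀).symm ⁻¹' adaptedSource n Fm F x₁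

theorem isOpen_adaptedOverlap (x₀ x₁ : M) : IsOpen (adaptedOverlap n Fm F x₀ x₁) :=
  ((continuousOn_extChartAt_symm x₀).mono Set.inter_subset_left).isOpen_inter_preimage
    (isOpen_adaptedTarget x₀) (isOpen_adaptedSource x₁)

theorem adaptedOverlap_subset (x₀ x₁ : M) : adaptedOverlap n Fm F x₀ x₁ ⊆ overlap x₀ x₁ :=
  fun _ hy => ⟨hy.1.1, hy.2.1⟩

theorem transition_mem_adaptedTarget {x₀ x₁ : M} {y : Coord n}
    (hy : y ∈ adaptedOverlap n Fm F x₀ x₁) : transition x₀ x₁ y ∈ adaptedTarget n Fm F x₁ :=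
  extChartAt_mem_adaptedTarget hy.2

/-- The jets of the coordinate expressions of sections in two charts determine each other
smoothly. -/
theorem jetLocal_transition (x₀ x₁ : M) (s : ℕ) :
    JetLocal s (fun ψ : Sec n Fm F => secInChart ψ x₀) (adaptedOverlap n Fm F x₀ x₁)
      fun ψ y => jet s (secInChart ψ x₁) (transition x₀ x₁ y) := by
  have hO := isOpen_adaptedOverlap (n := n) (Fm := Fm) (F := F) x₀ x₁
  have hsub := adaptedOverlap_subset (n := n) (Fm := Fm) (F := F) x₀ x₁
  have hσ := (contDiffOn_transition (n := n) x₀ x₁).mono hsub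
  refine JetLocal.jet_transform (U' := adaptedTarget n Fm F x₁)
    (κ := fun y => fderiv ℝ (transition x₁ x₀) (transition x₀ x₁ y)) hO
    (isOpen_adaptedTarget x₁) (fun ψ => (contDiffOn_secInChart ψ x₀).mono fun y hy => hy.1)
    (fun ψ => contDiffOn_secInChart ψ x₁) hσ ?_ ?_ (fun y hy => transition_mem_adaptedTarget hy)
    ?_ s
  · exact ((contDiffOn_transition x₁ x₀).fderiv_of_isOpen (isOpen_overlap x₁ x₀) (by simp)).comp hσ
      fun y hy => transition_mem_overlap (hsub hy)
  · intro y hy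
    have h := fderiv_transition_comp (transition_mem_overlap (hsub hy))
    rwa [transition_transition (hsub hy)] at h
  -- The fibre coordinates change by a linear map depending smoothly on the base point, an operation
  -- of order zero; higher jets follow by `JetLocal.jet_transform`.
  · let g : Coord n → Fm →L[ℝ] Fm := fun y =>
      ((trivializationAt Fm F x₀).coordChangeL ℝ (trivializationAt Fm F x₁)
        ((extChartAt (𝓡 n) x₀).symm y) : Fm →L[ℝ] Fm)
    have hg : ContDiffOn ℝ ∞ g (adaptedOverlap n Fm F x₀ x₁) := by
      rw [← contMDiffOn_iff_contDiffOn]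
      exact (contMDiffOn_coordChangeL (IB := 𝓡 n) (n := ∞) (trivializationAt Fm F x₀)
        (trivializationAt Fm F x₁)).comp
        ((contMDiffOn_extChartAt_symm x₀).mono fun y hy => hy.1.1) fun y hy => ⟨hy.1.2, hy.2.2⟩
    refine (((JetLocal.of_contDiffOn hg).prodMk JetLocal.self).comp_contDiff
      (g := fun q : (Fm →L[ℝ] Fm) × Fm => q.1 q.2) (contDiff_fst.clm_apply contDiff_snd)).congr
      fun ψ y hy => ?_
    have e := symm_transition (hsub hy)
    have h1 : secInChart ψ x₁ (transition x₀ x₁ y) = (trivializationAt Fm F x₁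
        ⟨(extChartAt (𝓡 n) x₀).symm y, ψ ((extChartAt (𝓡 n) x₀).symm y)⟩).2 := by
      unfold secInChart
      rw [e]
    rw [h1]
    change _ = (trivializationAt Fm F x₀).coordChangeL ℝ (trivializationAt Fm F x₁)
        ((extChartAt (𝓡 n) x₀).symm y) _
    rw [Trivialization.coordChangeL_apply _ _ ⟨hy.1.2, hy.2.2⟩]
    unfold secInChart
    rw [(trivializationAt Fm F x₀).symm_apply_apply_mk hy.1.2]

/-- The product of a section with a smooth function. -/
def smulSec (c : M → ℝ) (hc : ContMDiff (𝓡 n) 𝓘(ℝ) ∞ c) (ψ : Sec n Fm F) : Sec n Fm F :=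
  ⟨fun x => c x • ψ x, hc.smul_section ψ.contMDiff⟩

theorem secInChart_smulSec (c : M → ℝ) (hc : ContMDiff (𝓡 n) 𝓘(ℝ) ∞ c) (ψ : Sec n Fm F) {x₀ : M}
    {y : Coord n} (hy : y ∈ adaptedTarget n Fm F x₀) :
    secInChart (smulSec c hc ψ) x₀ y =
      c ((extChartAt (𝓡 n) x₀).symm y) • secInChart ψ x₀ y :=
  ((trivializationAt Fm F x₀).linear ℝ hy.2).2 _ _

theorem contDiffOn_comp_symm {c : M → ℝ} (hc : ContMDiff (𝓡 n) 𝓘(ℝ) ∞ c) (x₀ : M) :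
    ContDiffOn ℝ ∞ (fun y => c ((extChartAt (𝓡 n) x₀).symm y)) (extChartAt (𝓡 n) x₀).target := by
  rw [← contMDiffOn_iff_contDiffOn]
  exact hc.comp_contMDiffOn (contMDiffOn_extChartAt_symm x₀)

/-- Compactly supported fields in a coordinate domain are the coordinate expressions of sections. -/
theorem exists_section [T2Space M] (x₀ : M) {u : Coord n → Fm} {K : Set (Coord n)}
    (hu : ContDiffOn ℝ ∞ u (adaptedTarget n Fm F x₀)) (hK : IsCompact K)
    (hKU : K ⊆ adaptedTarget n Fm F x₀) (h0 : ∀ y ∈ adaptedTarget n Fm F x₀, y ∉ K → u y = 0) :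
    ∃ ψ : Sec n Fm F, HasAdaptedSupport ψ x₀ ∧
      ∀ y ∈ adaptedTarget n Fm F x₀, secInChart ψ x₀ y = u y := by
  classical
  let e := trivializationAt Fm F x₀
  let σ : (x : M) → F x := fun x =>
    if x ∈ adaptedSource n Fm F x₀ then e.symm x (u (extChartAt (𝓡 n) x₀ x)) else 0
  have hσ : ∀ x ∈ adaptedSource n Fm F x₀, (e ⟨x, σ x⟩).2 = u (extChartAt (𝓡 n) x₀ x) := by
    intro x hx
    simp only [σ, if_pos hx]
    rw [e.apply_mk_symm hx.2]
  -- Compact sets are closed because `M` is Hausdorff; otherwise extension by zero could fail to be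
  -- smooth at points outside the chart.
  have hK' : IsClosed ((extChartAt (𝓡 n) x₀).symm '' K) :=
    (hK.image_of_continuousOn ((continuousOn_extChartAt_symm x₀).mono
      fun y hy => (hKU hy).1)).isClosed
  have hz : ∀ x ∉ (extChartAt (𝓡 n) x₀).symm '' K, σ x = 0 := by
    intro x hx
    by_cases hxs : x ∈ adaptedSource n Fm F x₀
    · have : u (extChartAt (𝓡 n) x₀ x) = 0 :=
        h0 _ (extChartAt_mem_adaptedTarget hxs) fun hk =>
          hx ⟨_, hk, (extChartAt (𝓡 n) x₀).left_inv hxs.1⟩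
      simp only [σ, if_pos hxs, this]
      rw [← e.coe_symmₗ (R := ℝ) hxs.2]
      exact map_zero (e.symmₗ ℝ x)
    · simp only [σ, if_neg hxs]
  have hsm : ContMDiff (𝓡 n) ((𝓡 n).prod 𝓘(ℝ, Fm)) ∞ fun x => TotalSpace.mk' Fm x (σ x) := by
    intro x
    by_cases hx : x ∈ adaptedSource n Fm F x₀
    · rw [e.contMDiffAt_section_iff hx.2]
      have h1 : ContMDiffAt (𝓡 n) 𝓘(ℝ, Fm) ∞ (fun x => u (extChartAt (𝓡 n) x₀ x)) x :=
        ((hu.contDiffAt ((isOpen_adaptedTarget x₀).mem_nhds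
          (extChartAt_mem_adaptedTarget hx))).contMDiffAt).comp x
          (contMDiffAt_extChartAt' (by simpa [extChartAt_source] using hx.1))
      refine h1.congr_of_eventuallyEq ?_
      filter_upwards [(isOpen_adaptedSource x₀).mem_nhds hx] with z hz using hσ z hz
    · have hxK : x ∉ (extChartAt (𝓡 n) x₀).symm '' K := by
        rintro ⟨y, hy, rfl⟩
        exact hx (symm_mem_adaptedSource (hKU hy))
      refine (contMDiff_zeroSection ℝ F x).congr_of_eventuallyEq ?_
      filter_upwards [hK'.isOpen_compl.mem_nhds hxK] with z hz'
      rw [hz z hz']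
      rfl
  refine ⟨⟨σ, hsm⟩, ⟨K, hK, hKU, hz⟩, fun y hy => ?_⟩
  refine (hσ _ (symm_mem_adaptedSource hy)).trans ?_
  rw [(extChartAt (𝓡 n) x₀).right_inv hy.1]

theorem exists_cutoff {K U : Set (Coord n)} (hK : IsCompact K) (hU : IsOpen U) (hKU : K ⊆ U) :
    ∃ (c : Coord n → ℝ) (L : Set (Coord n)), ContDiff ℝ ∞ c ∧ IsCompact L ∧ L ⊆ U ∧
      (∀ y ∉ L, c y = 0) ∧ ∀ y ∈ K, c =ᶠ[𝓝 y] fun _ => 1 := by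
  obtain ⟨L, hL, hKL, hLU⟩ := exists_compact_between hK hU hKU
  obtain ⟨c, h1, h0, -⟩ := exists_contMDiffMap_one_nhds_of_subset_interior (n := ⊤)
    𝓘(ℝ, Coord n) hK.isClosed hKL
  exact ⟨c, L, c.contMDiff.contDiff, hL, hLU, h0, fun y hy => h1.filter_mono (nhds_le_nhdsSet hy)⟩

theorem IsLocalForm.isSmoothForm {k : ℕ} {ρ : RawLocalForm n Fm F k} (hρ : IsLocalForm ρ)
    (ψ : Sec n Fm F) : IsSmoothForm (ρ.along ψ) := by
  refine isSmoothForm_of_contDiffAt fun x₀ => ?_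
  obtain ⟨r, h⟩ := hρ
  obtain ⟨f, hf, hfψ⟩ := h x₀
  have h1 : ContDiffOn ℝ ∞ (formInChart (ρ.along ψ) x₀) (adaptedTarget n Fm F x₀) :=
    (hf.comp (contDiffOn_id.prodMk (contDiffOn_jetCoord r ψ x₀))
      fun y hy => ⟨hy, trivial⟩).congr fun y hy => hfψ ψ y hy
  exact h1.contDiffAt ((isOpen_adaptedTarget x₀).mem_nhds (mem_adaptedTarget x₀))

end Sections

end

end VarBicomplex

namespace VarBicomplex
set_option linter.unusedSectionVars false
noncomputable section

/-! ## Linearization of local forms -/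

section Linearization

variable {n r k : ℕ} {U : Set (Coord n)} {V X : Type*} [NormedAddCommGroup V] [NormedSpace ℝ V]
  [NormedAddCommGroup X] [NormedSpace ℝ X]

/-- The linearization of the differential operator `φ ↦ f (y, j^r φ (y))`. -/
def linOp (f : Coord n × Jet n V r → X) (φ η : Fld U V) (y : Coord n) : X :=
  fderiv ℝ f (y, jet r φ y) (0, jet r η y)

theorem Fld.contDiffAt (hU : IsOpen U) (φ : Fld U V) {y : Coord n} (hy : y ∈ U) :
    ContDiffAt ℝ ∞ (φ : Coord n → V) y :=
  ContDiffOn.contDiffAt φ.2 (hU.mem_nhds hy)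

theorem Fld.jet_add_smul (hU : IsOpen U) (φ η : Fld U V) (t : ℝ) {y : Coord n} (hy : y ∈ U) :
    jet r (φ + t • η : Fld U V) y =
      jet r (φ : Coord n → V) y + t • jet r (η : Coord n → V) y := by
  rw [← jet_smul t (Fld.contDiffAt hU η hy)]
  exact jet_add (Fld.contDiffAt hU φ hy) (Fld.contDiffAt hU (t • η) hy)

theorem hasDerivAt_linOp (hU : IsOpen U) {f : Coord n × Jet n V r → X}
    (hf : ContDiffOn ℝ ∞ f (U ×ˢ Set.univ)) (φ η : Fld U V) {y : Coord n} (hy : y ∈ U) (t : ℝ) :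
    HasDerivAt (fun t : ℝ => f (y, jet r (φ : Coord n → V) y + t • jet r (η : Coord n → V) y)) (linOp f (φ + t • η) η y) t := by
  have hfd := ((hf.contDiffAt ((hU.prod isOpen_univ).mem_nhds
    (show (y, jet r (φ : Coord n → V) y + t • jet r (η : Coord n → V) y) ∈ U ×ˢ Set.univ from ⟨hy, trivial⟩))).differentiableAt
    (by simp)).hasFDerivAt
  have hc : HasDerivAt (fun t : ℝ => (y, jet r (φ : Coord n → V) y + t • jet r (η : Coord n → V) y)) (0, jet r (η : Coord n → V) y) t := by
    refine (hasDerivAt_const t y).prodMk ?_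
    simpa using ((hasDerivAt_id t).smul_const (jet r (η : Coord n → V) y)).const_add (jet r (φ : Coord n → V) y)
  rw [linOp, Fld.jet_add_smul hU φ η t hy]
  exact hfd.comp_hasDerivAt t hc

theorem jetLocal_fst (hU : IsOpen U) (s : ℕ) :
    JetLocal s pairFun U fun w : Fld U V × Fld U V => jet s (w.1 : Coord n → V) :=
  JetLocal.jet_map hU contDiffOn_pairFun (JetLocal.self.comp_contDiff contDiff_fst) s

theorem jetLocal_snd (hU : IsOpen U) (s : ℕ) :
    JetLocal s pairFun U fun w : Fld U V × Fld U V => jet s (w.2 : Coord n → V) :=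
  JetLocal.jet_map hU contDiffOn_pairFun (JetLocal.self.comp_contDiff contDiff_snd) s

theorem isLocOp_linOp (hU : IsOpen U) {f : Coord n × Jet n V r → X}
    (hf : ContDiffOn ℝ ∞ f (U ×ˢ Set.univ)) :
    IsLocOp r (linOp f : Fld U V → Fld U V → Coord n → X) := by
  have h1 := (jetLocal_fst (V := V) hU r).prodMk (jetLocal_snd hU r)
  refine h1.comp (g := fun q : Coord n × (Jet n V r × Jet n V r) =>
    fderiv ℝ f (q.1, q.2.1) (0, q.2.2)) ?_
  refine ContDiffOn.clm_apply ((hf.fderiv_of_isOpen (hU.prod isOpen_univ) (by simp)).comp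
    (contDiff_fst.prodMk (contDiff_fst.comp contDiff_snd)).contDiffOn
    fun q hq => ⟨hq.1, trivial⟩) ?_
  exact (contDiff_const.prodMk (contDiff_snd.comp contDiff_snd)).contDiffOn

theorem isLinOp_linOp (hU : IsOpen U) (f : Coord n × Jet n V r → X) :
    IsLinOp (linOp f : Fld U V → Fld U V → Coord n → X) := by
  constructor
  · intro φ η η' y hy
    have h := Fld.jet_add_smul (r := r) hU η η' 1 hy
    rw [one_smul, one_smul] at h
    rw [linOp, linOp, linOp, h, ← map_add, Prod.mk_add_mk, add_zero]
  · intro φ c η y hy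
    have h := jet_smul (s := r) c (Fld.contDiffAt hU η hy)
    have h' : jet r ((c • η : Fld U V) : Coord n → V) y = c • jet r (η : Coord n → V) y := h
    rw [linOp, linOp, h', ← map_smul, Prod.smul_mk, smul_zero]

/-- Derivatives with respect to a parameter and with respect to the point commute. -/
theorem hasDerivAt_fderiv {E : Type*} [NormedAddCommGroup E] [NormedSpace ℝ E] {G : ℝ × E → X}
    {y : E} (hG : ContDiffAt ℝ ∞ G (0, y)) :
    HasDerivAt (fun t : ℝ => fderiv ℝ (fun z => G (t, z)) y)
      (fderiv ℝ (fun z => fderiv ℝ G (0, z) (1, 0)) y) 0 := by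
  have hD : DifferentiableAt ℝ (fderiv ℝ G) (0, y) :=
    (hG.fderiv_right (m := ∞) (by simp)).differentiableAt (by simp)
  have hsymm : IsSymmSndFDerivAt ℝ G (0, y) := hG.isSymmSndFDerivAt two_le_infty
  have hev : ∀ᶠ t : ℝ in 𝓝 0, fderiv ℝ (fun z => G (t, z)) y =
      (fderiv ℝ G (t, y)).comp (ContinuousLinearMap.inr ℝ ℝ E) := by
    have h1 : ∀ᶠ p in 𝓝 ((0 : ℝ), y), ContDiffAt ℝ 1 G p :=
      (hG.of_le (by simp : (1 : WithTop ℕ∞) ≤ ∞)).eventually (by simp)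
    have hc : Filter.Tendsto (fun t : ℝ => (t, y)) (𝓝 0) (𝓝 (0, y)) :=
      (Continuous.prodMk_left y).tendsto 0
    filter_upwards [hc.eventually h1] with t ht
    exact ((ht.differentiableAt (by simp)).hasFDerivAt.comp y (hasFDerivAt_prodMk_right t y)).fderiv
  have h2 : HasDerivAt (fun t : ℝ => (fderiv ℝ G (t, y)).comp (ContinuousLinearMap.inr ℝ ℝ E))
      ((fderiv ℝ (fderiv ℝ G) (0, y) (1, 0)).comp (ContinuousLinearMap.inr ℝ ℝ E)) 0 := by
    have hc : HasDerivAt (fun t : ℝ => (t, y)) (1, 0) 0 :=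
      (hasDerivAt_id (0 : ℝ)).prodMk (hasDerivAt_const (0 : ℝ) y)
    have h3 := hD.hasFDerivAt.comp_hasDerivAt (0 : ℝ) hc
    exact (((ContinuousLinearMap.compL ℝ E (ℝ × E) X).flip
      (ContinuousLinearMap.inr ℝ ℝ E)).hasFDerivAt).comp_hasDerivAt (0 : ℝ) h3
  have h4 : fderiv ℝ (fun z => fderiv ℝ G (0, z) (1, 0)) y =
      (fderiv ℝ (fderiv ℝ G) (0, y) (1, 0)).comp (ContinuousLinearMap.inr ℝ ℝ E) := by
    have h5 := hD.hasFDerivAt.comp y (hasFDerivAt_prodMk_right (0 : ℝ) y)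
    have h6 := ((ContinuousLinearMap.apply ℝ X ((1 : ℝ), (0 : E))).hasFDerivAt).comp y h5
    rw [show (fun z => fderiv ℝ G (0, z) (1, 0)) = (ContinuousLinearMap.apply ℝ X ((1 : ℝ), (0 : E))) ∘
      (fderiv ℝ G ∘ fun z => (0, z)) from rfl, h6.fderiv]
    ext w
    exact hsymm.eq (0, w) (1, 0)
  rw [h4]
  exact h2.congr_of_eventuallyEq hev

/-- Linearization commutes with the exterior derivative, by symmetry of second derivatives in the
parameter and the point. -/
theorem hasDerivAt_extDeriv_linOp (hU : IsOpen U)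
    {f : Coord n × Jet n V r → Coord n [⋀^Fin k]→L[ℝ] ℝ}
    (hf : ContDiffOn ℝ ∞ f (U ×ˢ Set.univ)) (φ η : Fld U V) {y : Coord n} (hy : y ∈ U) :
    HasDerivAt (fun t : ℝ => extDeriv (fun z => f (z, jet r φ z + t • jet r η z)) y)
      (extDeriv (linOp f φ η) y) 0 := by
  let G : ℝ × Coord n → Coord n [⋀^Fin k]→L[ℝ] ℝ := fun p =>
    f (p.2, jet r φ p.2 + p.1 • jet r η p.2)
  have hG : ContDiffOn ℝ ∞ G (Set.univ ×ˢ U) := by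
    refine hf.comp (contDiffOn_snd.prodMk (ContDiffOn.add ?_ (contDiffOn_fst.smul ?_)))
      fun p hp => ⟨hp.2, trivial⟩
    · exact (contDiffOn_jet hU φ.2 r).comp contDiffOn_snd fun p hp => hp.2
    · exact (contDiffOn_jet hU η.2 r).comp contDiffOn_snd fun p hp => hp.2
  have hGa : ∀ z ∈ U, ContDiffAt ℝ ∞ G (0, z) := fun z hz =>
    hG.contDiffAt ((isOpen_univ.prod hU).mem_nhds ⟨trivial, hz⟩)
  have h1 := hasDerivAt_fderiv (hGa y hy)
  have h2 : (fun z => fderiv ℝ G (0, z) (1, 0)) =ᶠ[𝓝 y] linOp f φ η := by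
    filter_upwards [hU.mem_nhds hy] with z hz
    have h3 := hasDerivAt_linOp hU hf φ η hz 0
    rw [zero_smul, add_zero] at h3
    refine HasDerivAt.unique ?_ h3
    exact ((hGa z hz).differentiableAt (by simp)).hasFDerivAt.comp_hasDerivAt (0 : ℝ)
      ((hasDerivAt_id (0 : ℝ)).prodMk (hasDerivAt_const (0 : ℝ) z))
  rw [h2.fderiv_eq] at h1
  exact (ContinuousAlternatingMap.alternatizeUncurryFinCLM ℝ (Coord n) ℝ).hasFDerivAt.comp_hasDerivAt
    (0 : ℝ) h1

end Linearization

/-! ### Linearized local forms: closedness and the Euler-Lagrange condition -/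

section Sections

variable {n k r : ℕ} {M : Type*} [TopologicalSpace M] [ChartedSpace (Coord n) M]
  [IsManifold (𝓡 n) ∞ M]
  {Fm : Type*} [NormedAddCommGroup Fm] [NormedSpace ℝ Fm]
  {F : M → Type*} [TopologicalSpace (TotalSpace Fm F)] [∀ x, TopologicalSpace (F x)]
  [FiberBundle Fm F] [∀ x, AddCommGroup (F x)] [∀ x, Module ℝ (F x)]
  [VectorBundle ℝ Fm F] [ContMDiffVectorBundle ∞ Fm F (𝓡 n)]

/-- `f` is the expression of the local form `ρ` in the adapted coordinates at `x₀`. -/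
def IsFormula (ρ : RawLocalForm n Fm F k) (x₀ : M)
    (f : Coord n × Jet n Fm r → Coord n [⋀^Fin k]→L[ℝ] ℝ) : Prop :=
  ContDiffOn ℝ ∞ f (adaptedTarget n Fm F x₀ ×ˢ Set.univ) ∧
    ∀ (ψ : Sec n Fm F), ∀ y ∈ adaptedTarget n Fm F x₀,
      formInChart (ρ.along ψ) x₀ y = f (y, jetCoord r ψ x₀ y)

variable {ρ : RawLocalForm n Fm F k} {x₀ : M}
  {f : Coord n × Jet n Fm r → Coord n [⋀^Fin k]→L[ℝ] ℝ}

theorem IsFormula.hasDerivAt (h : IsFormula ρ x₀ f) (ψ η : Sec n Fm F) {y : Coord n}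
    (hy : y ∈ adaptedTarget n Fm F x₀) :
    HasDerivAt (fun t : ℝ => formInChart (ρ.along (ψ + t • η)) x₀ y)
      (linOp f (secFld ψ x₀) (secFld η x₀) y) 0 := by
  have h1 := hasDerivAt_linOp (isOpen_adaptedTarget x₀) h.1 (secFld ψ x₀) (secFld η x₀) hy 0
  rw [zero_smul, add_zero] at h1
  refine h1.congr_of_eventuallyEq (Filter.Eventually.of_forall fun t => ?_)
  beta_reduce
  rw [h.2 _ y hy, jetCoord_add_smul r ψ η t x₀ hy]
  rfl

theorem IsFormula.firstVariation_eq (h : IsFormula ρ x₀ f) (ψ η : Sec n Fm F) (v : Fin k → Coord n)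
    {y : Coord n} (hy : y ∈ adaptedTarget n Fm F x₀) :
    firstVariation ρ ψ η x₀ v y = linOp f (secFld ψ x₀) (secFld η x₀) y v :=
  ((ContinuousAlternatingMap.apply ℝ (Coord n) ℝ v).hasFDerivAt.comp_hasDerivAt (0 : ℝ)
    (h.hasDerivAt ψ η hy)).deriv

theorem HasAdaptedSupport.exists_eq_zero {η : Sec n Fm F} (h : HasAdaptedSupport η x₀) :
    ∃ K : Set (Coord n), IsCompact K ∧ K ⊆ adaptedTarget n Fm F x₀ ∧
      ∀ y ∈ adaptedTarget n Fm F x₀, y ∉ K → secInChart η x₀ y = 0 := by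
  obtain ⟨K, hK, hKU, h0⟩ := h
  refine ⟨K, hK, hKU, fun y hy hyK => ?_⟩
  have hη : η ((extChartAt (𝓡 n) x₀).symm y) = 0 := by
    refine h0 _ ?_
    rintro ⟨w, hw, hwz⟩
    exact hyK ((extChartAt (𝓡 n) x₀).symm.injOn (hKU hw).1 hy.1 hwz ▸ hw)
  unfold secInChart
  rw [hη]
  exact ((trivializationAt Fm F x₀).linear ℝ hy.2).map_zero

theorem linOp_eq_zero {U : Set (Coord n)} (hU : IsOpen U)
    (hf : ContDiffOn ℝ ∞ f (U ×ˢ Set.univ)) (φ : Fld U Fm) {η : Fld U Fm} {K : Set (Coord n)}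
    (hK : IsCompact K) (h0 : ∀ y ∈ U, y ∉ K → (η : Coord n → Fm) y = 0) {y : Coord n}
    (hy : y ∈ U) (hyK : y ∉ K) : linOp f φ η y = 0 := by
  rw [IsLocOp.congr_germ (isLocOp_linOp hU hf) hy (Filter.EventuallyEq.rfl (f := (φ : Coord n → Fm)))
    (η' := 0), (isLinOp_linOp hU f).zero φ hy]
  filter_upwards [(hU.sdiff hK.isClosed).mem_nhds ⟨hy, hyK⟩] with z hz using h0 z hz.1 hz.2

/-- The Euler-Lagrange derivative of a horizontal differential vanishes. -/
theorem eulerLagrangeVanishes_of_isHorizontalDiff {j : RawLocalForm n Fm F k}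
    {ρ : RawLocalForm n Fm F (k + 1)} (hj : IsLocalForm j) (h : IsHorizontalDiff j ρ)
    (hk : k + 1 = n) : EulerLagrangeVanishes ρ := by
  intro x₀ ψ η hη v
  obtain ⟨r, hr⟩ := hj
  obtain ⟨f, hf⟩ : ∃ f : Coord n × Jet n Fm r → _, IsFormula j x₀ f := hr x₀
  have hU := isOpen_adaptedTarget (n := n) (Fm := Fm) (F := F) x₀
  obtain ⟨K, hK, hKU, h0⟩ := hη.exists_eq_zero
  -- The first variation of `d j` is the differential of the linearization of `j`, which has compact
  -- support together with `η`; Stokes then applies.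
  have h1 : ∀ y ∈ adaptedTarget n Fm F x₀, firstVariation ρ ψ η x₀ v y =
      extDeriv (linOp f (secFld ψ x₀) (secFld η x₀)) y v := by
    intro y hy
    refine HasDerivAt.deriv ?_
    refine HasDerivAt.congr_of_eventuallyEq ((ContinuousAlternatingMap.apply ℝ (Coord n) ℝ
      v).hasFDerivAt.comp_hasDerivAt (0 : ℝ)
      (hasDerivAt_extDeriv_linOp hU hf.1 (secFld ψ x₀) (secFld η x₀) hy)) ?_
    refine Filter.Eventually.of_forall fun t => ?_
    have h2 : formInChart (j.along (ψ + t • η)) x₀ =ᶠ[𝓝 y]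
        fun z => f (z, jet r (secFld ψ x₀) z + t • jet r (secFld η x₀) z) := by
      filter_upwards [hU.mem_nhds hy] with z hz
      rw [hf.2 _ z hz, jetCoord_add_smul r ψ η t x₀ hz]
      rfl
    have h3 := (h (ψ + t • η)).formInChart_eq hy.1
      (((IsLocalForm.isSmoothForm ⟨r, hr⟩ _).contDiffAt hy.1).differentiableAt (by simp))
    change formInChart (ρ.along (ψ + t • η)) x₀ y v = extDeriv _ y v
    rw [h3, h2.extDeriv_eq]
  rw [setIntegral_congr_fun hU.measurableSet h1]
  subst hk
  exact setIntegral_extDeriv_eq_zero hU hK hKU ((isLocOp_linOp hU hf.1).contDiffOn hU _ _)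
    (fun y hy => linOp_eq_zero hU hf.1 _ hK h0 hy.1 hy.2) v

variable [T2Space M]

/-- Fields on a coordinate domain need not extend to sections of `F`, but after a cutoff their germs
along a compact set do. This transfers hypotheses on global sections to local fields. -/
theorem exists_section_eventuallyEq (φ : Fld (adaptedTarget n Fm F x₀) Fm) {K : Set (Coord n)}
    (hK : IsCompact K) (hKU : K ⊆ adaptedTarget n Fm F x₀) :
    ∃ ψ : Sec n Fm F, ∀ y ∈ K, (secFld ψ x₀ : Coord n → Fm) =ᶠ[𝓝 y] φ := by
  have hU := isOpen_adaptedTarget (n := n) (Fm := Fm) (F := F) x₀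
  obtain ⟨c, L, hc, hL, hLU, h0, h1⟩ := exists_cutoff hK hU hKU
  obtain ⟨ψ, -, hψ⟩ := exists_section x₀ (F := F)
    (u := fun y => c y • (φ : Coord n → Fm) y) (hc.contDiffOn.smul φ.2) hL hLU
    (fun y _ hy => by rw [h0 y hy, zero_smul])
  refine ⟨ψ, fun y hy => ?_⟩
  filter_upwards [h1 y hy, hU.mem_nhds (hKU hy)] with z hz hzU
  refine (hψ z hzU).trans ?_
  rw [hz, one_smul]

/-- Closedness at a point involves only the germ of the field, which a global section realizes. So
`f (z, jet r φ z)` is closed for every field `φ`; differentiating along `φ + t η` gives closedness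
of the linearization. -/
theorem IsFormula.isClosedOp (h : IsFormula ρ x₀ f)
    (hρ : ∀ ψ : Sec n Fm F, IsExtDeriv (ρ.along ψ) (0 : RawForm n M (k + 1))) :
    IsClosedOp (linOp f : Fld (adaptedTarget n Fm F x₀) Fm → _) := by
  have hU := isOpen_adaptedTarget (n := n) (Fm := Fm) (F := F) x₀
  have key : ∀ φ : Fld (adaptedTarget n Fm F x₀) Fm, ∀ y ∈ adaptedTarget n Fm F x₀,
      extDeriv (fun z => f (z, jet r φ z)) y = 0 := by
    intro φ y hy
    obtain ⟨ψ, hψ⟩ := exists_section_eventuallyEq (F := F) φ isCompact_singleton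
      (Set.singleton_subset_iff.2 hy)
    have e : formInChart (ρ.along ψ) x₀ =ᶠ[𝓝 y] fun z => f (z, jet r φ z) := by
      filter_upwards [hU.mem_nhds hy, (hψ y rfl).eventuallyEq_nhds] with z hz hzψ
      rw [h.2 ψ z hz, ← jet_congr hzψ]
      rfl
    have hd : ContDiffAt ℝ ∞ (fun z => f (z, jet r φ z)) y :=
      ContDiffOn.contDiffAt (h.1.comp (contDiffOn_id.prodMk (contDiffOn_jet hU φ.2 r))
        fun z hz => ⟨hz, trivial⟩) (hU.mem_nhds hy)
    rw [← e.extDeriv_eq, ← (hρ ψ).formInChart_eq hy.1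
      ((hd.congr_of_eventuallyEq e).differentiableAt (by simp))]
    rfl
  intro φ η y hy
  have h1 := hasDerivAt_extDeriv_linOp hU h.1 φ η hy
  have h2 : (fun t : ℝ => extDeriv (fun z => f (z, jet r φ z + t • jet r η z)) y) = fun _ => 0 := by
    funext t
    rw [← key (φ + t • η) y hy]
    refine Filter.EventuallyEq.extDeriv_eq ?_
    filter_upwards [hU.mem_nhds hy] with z hz
    rw [Fld.jet_add_smul hU φ η t hz]
  rw [h2] at h1
  exact h1.unique (hasDerivAt_const _ _)

/-- The direction `η` extends by zero to a section, and `φ` may be replaced by a section with the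
same germs along the support of `η`; off that support both integrands vanish. -/
theorem IsFormula.integralVanishes (h : IsFormula ρ x₀ f) (hρ : EulerLagrangeVanishes ρ) :
    IntegralVanishes (linOp f : Fld (adaptedTarget n Fm F x₀) Fm → _) := by
  have hU := isOpen_adaptedTarget (n := n) (Fm := Fm) (F := F) x₀
  rintro φ η ⟨K, hK, hKU, h0⟩ v
  obtain ⟨ψ, hψ⟩ := exists_section_eventuallyEq (F := F) φ hK hKU
  obtain ⟨χ, hχ, hχη⟩ := exists_section x₀ (F := F) η.2 hK hKU fun y _ hy => h0 y hy
  rw [← hρ x₀ ψ χ hχ v]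
  refine setIntegral_congr_fun hU.measurableSet fun y hy => ?_
  have hχη' : (secFld χ x₀ : Coord n → Fm) =ᶠ[𝓝 y] η := by
    filter_upwards [hU.mem_nhds hy] with z hz using hχη z hz
  refine Eq.trans ?_ (h.firstVariation_eq ψ χ v hy).symm
  by_cases hyK : y ∈ K
  · exact congrArg (fun β : Coord n [⋀^Fin k]→L[ℝ] ℝ => β v)
      (IsLocOp.congr_germ (isLocOp_linOp hU h.1) hy (hψ y hyK) hχη').symm
  · beta_reduce
    rw [linOp_eq_zero hU h.1 φ hK (fun z _ hz => h0 z hz) hy hyK,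
      linOp_eq_zero hU h.1 (secFld ψ x₀) hK (η := secFld χ x₀)
        (fun z hz hzK => (hχη z hz).trans (h0 z hzK)) hy hyK]

end Sections

end

end VarBicomplex

namespace VarBicomplex
set_option linter.unusedSectionVars false
noncomputable section

/-! ## Integration of operators along rays -/

section RayIntegral

variable {n s k : ℕ} {U : Set (Coord n)} {V : Type*} [NormedAddCommGroup V] [NormedSpace ℝ V]

/-- The operator `φ ↦ ∫₀¹ Q (t φ, g φ) dt`. -/
def rayIntegral (Q : Fld U V → Fld U V → Coord n → Coord n [⋀^Fin k]→L[ℝ] ℝ) (g : Coord n → ℝ)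
    (hg : ContDiffOn ℝ ∞ g U) (φ : Fld U V) (y : Coord n) : Coord n [⋀^Fin k]→L[ℝ] ℝ :=
  ∫ t in (0 : ℝ)..1, Q (t • φ) (Fld.mul g hg φ) y

variable {Q : Fld U V → Fld U V → Coord n → Coord n [⋀^Fin k]→L[ℝ] ℝ} {g : Coord n → ℝ}
  {hg : ContDiffOn ℝ ∞ g U}

/-- The jet of `(t φ, g φ)` is `t` times the jet of `(φ, 0)` plus the jet of `(0, g φ)`. Hence the
integrand is jointly smooth in `t` and in the jet of `φ`, as needed to integrate over `t`. -/
theorem IsLocOp.exists_ray (hU : IsOpen U) (hQ : IsLocOp s Q) (hg : ContDiffOn ℝ ∞ g U) :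
    ∃ q : (Coord n × Jet n V s) → ℝ → Coord n [⋀^Fin k]→L[ℝ] ℝ,
      ContDiffOn ℝ ∞ (fun p : (Coord n × Jet n V s) × ℝ => q p.1 p.2)
        ((U ×ˢ Set.univ) ×ˢ Set.univ) ∧
      ∀ (φ : Fld U V) (t : ℝ), ∀ y ∈ U,
        Q (t • φ) (Fld.mul g hg φ) y = q (y, jet s (φ : Coord n → V) y) t := by
  obtain ⟨q, hq, hQ⟩ := hQ
  have hu : ∀ φ : Fld U V, ContDiffOn ℝ ∞ (φ : Coord n → V) U := fun φ => φ.2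
  obtain ⟨a, ha, hA⟩ : JetLocal s (fun φ : Fld U V => (φ : Coord n → V)) U
      fun φ => jet s (pairFun (φ, (0 : Fld U V))) :=
    JetLocal.jet_map hU hu (JetLocal.self.prodMk
      (JetLocal.of_contDiffOn (g := fun _ => (0 : V)) contDiffOn_const)) s
  obtain ⟨b, hb, hB⟩ : JetLocal s (fun φ : Fld U V => (φ : Coord n → V)) U
      fun φ => jet s (pairFun ((0 : Fld U V), Fld.mul g hg φ)) :=
    JetLocal.jet_map hU hu ((JetLocal.of_contDiffOn (g := fun _ => (0 : V))
      contDiffOn_const).prodMk (JetLocal.self.smul hg)) s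
  refine ⟨fun p t => q (p.1, t • a p + b p), ?_, fun φ t y hy => ?_⟩
  · refine hq.comp ((contDiffOn_fst.comp contDiffOn_fst fun p hp => hp.1).prodMk
      ((contDiffOn_snd.smul (ha.comp contDiffOn_fst fun p hp => hp.1)).add
        (hb.comp contDiffOn_fst fun p hp => hp.1))) fun p hp => ⟨hp.1.1, trivial⟩
  · refine (hQ (t • φ, Fld.mul g hg φ) y hy).trans ?_
    have h1 := (contDiffOn_pairFun (φ, (0 : Fld U V))).contDiffAt (hU.mem_nhds hy)
    have h2 := (contDiffOn_pairFun ((0 : Fld U V), Fld.mul g hg φ)).contDiffAt (hU.mem_nhds hy)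
    have h3 := jet_add (s := s) (h1.const_smul t) h2
    have h4 : pairFun (t • φ, Fld.mul g hg φ) =
        (t • pairFun (φ, (0 : Fld U V)) + pairFun ((0 : Fld U V), Fld.mul g hg φ)) := by
      funext z
      refine Prod.ext ?_ ?_
      · exact (add_zero (t • (φ : Coord n → V) z)).symm
      · refine Eq.symm ?_
        change t • (0 : V) + _ = _
        rw [smul_zero, zero_add]
        rfl
    rw [h4]
    refine congrArg (fun z => q (y, z)) (h3.trans ?_)
    rw [← hA φ y hy, ← hB φ y hy, ← jet_smul t h1]
    rfl

theorem IsLocOp.jetLocal_rayIntegral (hU : IsOpen U) (hQ : IsLocOp s Q) :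
    JetLocal s (fun φ : Fld U V => (φ : Coord n → V)) U (rayIntegral Q g hg) := by
  obtain ⟨q, hq, h⟩ := hQ.exists_ray hU hg
  refine ⟨fun p => ∫ t in (0 : ℝ)..1, q p t,
    contDiffOn_intervalIntegral (hU.prod isOpen_univ) hq, fun φ y hy => ?_⟩
  exact intervalIntegral.integral_congr fun t _ => h φ t y hy

theorem IsLocOp.contDiffOn_ray (hU : IsOpen U) (hQ : IsLocOp s Q) (φ : Fld U V) :
    ContDiffOn ℝ ∞ (fun p : Coord n × ℝ => Q (p.2 • φ) (Fld.mul g hg φ) p.1)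
      (U ×ˢ Set.univ) := by
  obtain ⟨q, hq, h⟩ := hQ.exists_ray hU hg
  refine ContDiffOn.congr (f := fun p : Coord n × ℝ => q (p.1, jet s (φ : Coord n → V) p.1) p.2) ?_
    fun p hp => h φ p.2 p.1 hp.1
  exact hq.comp ((contDiffOn_fst.prodMk ((contDiffOn_jet hU φ.2 s).comp contDiffOn_fst
    fun p hp => hp.1)).prodMk contDiffOn_snd) fun p hp => ⟨⟨hp.1, trivial⟩, trivial⟩

theorem IsLocOp.extDeriv_rayIntegral (hU : IsOpen U) (hQ : IsLocOp s Q) (φ : Fld U V)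
    {y : Coord n} (hy : y ∈ U) :
    extDeriv (rayIntegral Q g hg φ) y =
      ∫ t in (0 : ℝ)..1, extDeriv (Q (t • φ) (Fld.mul g hg φ)) y := by
  obtain ⟨h1, h2⟩ := hasFDerivAt_intervalIntegral hU
    (g := fun z t => Q (t • φ) (Fld.mul g hg φ) z) (hQ.contDiffOn_ray hU φ) hy
  have h3 : fderiv ℝ (rayIntegral Q g hg φ) y = _ := h2.fderiv
  unfold extDeriv
  rw [h3]
  exact ((ContinuousAlternatingMap.alternatizeUncurryFinCLM ℝ (Coord n)
    ℝ).intervalIntegral_comp_comm h1).symm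

/-- Where `g` vanishes near `y`, the direction `g φ` has zero germ, and the normalization `Q φ 0 =
0` applies. This keeps the ray integral supported in the support of `g`. -/
theorem rayIntegral_eq_zero (hQ : IsLocOp s Q) (h0 : ∀ φ, ∀ y ∈ U, Q φ 0 y = 0) (φ : Fld U V)
    {y : Coord n} (hy : y ∈ U) (h : ∀ᶠ z in 𝓝 y, g z = 0) : rayIntegral Q g hg φ y = 0 := by
  unfold rayIntegral
  rw [intervalIntegral.integral_congr (g := fun _ => 0), intervalIntegral.integral_zero]
  intro t _
  refine (hQ.congr_germ hy Filter.EventuallyEq.rfl (η' := 0) ?_).trans (h0 _ y hy)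
  filter_upwards [h] with z hz
  change g z • _ = (0 : V)
  rw [hz, zero_smul]

/-- A primitive which vanishes for `η = 0`. -/
theorem exists_normalized_primitive_op (hU : IsOpen U) (hk : k + 1 ≤ n) {r : ℕ}
    {P : Fld U V → Fld U V → Coord n → Coord n [⋀^Fin (k + 1)]→L[ℝ] ℝ} (hl : IsLocOp r P)
    (hP : IsLinOp P) (hc : IsClosedOp P) (hi : k + 1 = n → IntegralVanishes P) :
    ∃ Q : Fld U V → Fld U V → Coord n → Coord n [⋀^Fin k]→L[ℝ] ℝ, IsLocOp (r + (r + 1)) Q ∧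
      (∀ φ, ∀ y ∈ U, Q φ 0 y = 0) ∧ ∀ φ η, ∀ y ∈ U, extDeriv (Q φ η) y = P φ η y := by
  obtain ⟨Q, hQ, hd⟩ := exists_primitive_op hU hk hl hP (hl.hasOrderLT hU hP) hc hi
  -- Locality of `Q φ 0` comes from multiplying the direction by the zero function. Subtracting it
  -- does not change the differential, since `d (Q φ 0) = P φ 0 = 0`.
  have hQ0 : IsLocOp (r + (r + 1)) fun φ (_ : Fld U V) => Q φ 0 := by
    refine (hQ.mul hU (g := fun _ => 0) contDiffOn_const).congr fun w y _ => ?_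
    have : Fld.mul (fun _ => 0) contDiffOn_const w.2 = 0 :=
      Subtype.ext (funext fun z => zero_smul ℝ _)
    beta_reduce
    rw [this]
  refine ⟨fun φ η y => Q φ η y - Q φ 0 y, hQ.sub hQ0, fun φ y _ => sub_self _,
    fun φ η y hy => ?_⟩
  have h1 : ∀ η, DifferentiableAt ℝ (Q φ η) y := fun η =>
    ((hQ.contDiffOn hU φ η).contDiffAt (hU.mem_nhds hy)).differentiableAt (by simp)
  have h2 : extDeriv (fun y => Q φ η y - Q φ 0 y) y = extDeriv (Q φ η) y - extDeriv (Q φ 0) y := by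
    unfold extDeriv
    rw [fderiv_fun_sub (h1 η) (h1 0)]
    exact map_sub (ContinuousAlternatingMap.alternatizeUncurryFinCLM ℝ (Coord n) ℝ) _ _
  rw [h2, hd φ η y hy, hd φ 0 y hy, hP.zero φ hy, sub_zero]

end RayIntegral

/-! ### Local forms and their variations on the manifold -/

section Pointwise

variable {n k r : ℕ} {M : Type*} [TopologicalSpace M] [ChartedSpace (Coord n) M]
  [IsManifold (𝓡 n) ∞ M]

theorem RawForm.at_eq (α : RawForm n M k) {x₀ x : M} (hx : x ∈ (extChartAt (𝓡 n) x₀).source) :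
    α.at x = (formInChart α x₀ (extChartAt (𝓡 n) x₀ x)).compContinuousLinearMap
      (chartDeriv x₀ x) := by
  have h2 := symmDeriv_comp_chartDeriv ((extChartAt (𝓡 n) x₀).map_source hx)
  rw [(extChartAt (𝓡 n) x₀).left_inv hx] at h2
  rw [formInChart_eq, (extChartAt (𝓡 n) x₀).left_inv hx]
  ext v
  exact congrArg (α.at x)
    (funext fun i => (congrArg (fun L : Coord n →L[ℝ] Coord n => L (v i)) h2).symm)

variable {Fm : Type*} [NormedAddCommGroup Fm] [NormedSpace ℝ Fm]
  {F : M → Type*} [TopologicalSpace (TotalSpace Fm F)] [∀ x, TopologicalSpace (F x)]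
  [FiberBundle Fm F] [∀ x, AddCommGroup (F x)] [∀ x, Module ℝ (F x)]
  [VectorBundle ℝ Fm F] [ContMDiffVectorBundle ∞ Fm F (𝓡 n)]

theorem RawLocalForm.ext_along {ρ ρ' : RawLocalForm n Fm F k} (h : ∀ ψ, ρ.along ψ = ρ'.along ψ) :
    ρ = ρ' := by
  funext ⟨x, q⟩
  obtain ⟨ψ, rfl⟩ := Quotient.exists_rep q
  exact congrFun (h ψ) x

/-- An assignment of forms to sections which is local in all coordinates comes from a local
form. -/
theorem exists_localForm (A : Sec n Fm F → RawForm n M k)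
    (h : ∀ x₀ : M, ∃ f : Coord n × Jet n Fm r → Coord n [⋀^Fin k]→L[ℝ] ℝ,
      ContDiffOn ℝ ∞ f (adaptedTarget n Fm F x₀ ×ˢ Set.univ) ∧
      ∀ (ψ : Sec n Fm F), ∀ y ∈ adaptedTarget n Fm F x₀,
        formInChart (A ψ) x₀ y = f (y, jetCoord r ψ x₀ y)) :
    ∃ j ∈ LocalForm n Fm F k, ∀ ψ, j.along ψ = A ψ := by
  -- The value at a jet is computed from a chosen section representing it; the formula in the chart
  -- at the base point shows that the choice is irrelevant.
  let j : RawLocalForm n Fm F k := fun θ => A θ.2.out θ.1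
  have hj : ∀ ψ, j.along ψ = A ψ := by
    intro ψ
    funext x
    let χ : Sec n Fm F := (Quotient.mk (jetSetoid n Fm F x) ψ).out
    have hχ : (jetSetoid n Fm F x).r χ ψ := Quotient.mk_out (s := jetSetoid n Fm F x) ψ
    change (A χ).at x = (A ψ).at x
    obtain ⟨f, -, hf⟩ := h x
    rw [RawForm.at_eq _ (mem_extChartAt_source x), RawForm.at_eq _ (mem_extChartAt_source x),
      hf _ _ (mem_adaptedTarget x), hf _ _ (mem_adaptedTarget x)]
    have : jetCoord r χ x (extChartAt (𝓡 n) x x) = jetCoord r ψ x (extChartAt (𝓡 n) x x) :=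
      funext fun i => hχ i
    rw [this]
  refine ⟨j, ⟨r, fun x₀ => ?_⟩, hj⟩
  obtain ⟨f, hf, hfA⟩ := h x₀
  exact ⟨f, hf, fun ψ y hy => by rw [hj ψ, hfA ψ y hy]⟩

/-- The variation of the local form `ρ` at the section `φ` in the direction `η`. -/
def varAt (ρ : RawLocalForm n Fm F k) (φ η : Sec n Fm F) (x : M) : Coord n [⋀^Fin k]→L[ℝ] ℝ :=
  deriv (fun t : ℝ => (ρ.along (φ + t • η)).at x) 0

variable {ρ : RawLocalForm n Fm F k} {x₀ x : M}
  {f : Coord n × Jet n Fm r → Coord n [⋀^Fin k]→L[ℝ] ℝ}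

theorem IsFormula.hasDerivAt_at (h : IsFormula ρ x₀ f) (φ η : Sec n Fm F)
    (hx : x ∈ adaptedSource n Fm F x₀) :
    HasDerivAt (fun t : ℝ => (ρ.along (φ + t • η)).at x)
      ((linOp f (secFld φ x₀) (secFld η x₀) (extChartAt (𝓡 n) x₀ x)).compContinuousLinearMap
        (chartDeriv x₀ x)) 0 := by
  have h1 := (ContinuousAlternatingMap.compContinuousLinearMapCLM (𝕜 := ℝ) (ι := Fin k) (F := ℝ)
    (chartDeriv x₀ x)).hasFDerivAt.comp_hasDerivAt (0 : ℝ)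
    (h.hasDerivAt φ η (extChartAt_mem_adaptedTarget hx))
  refine h1.congr_of_eventuallyEq (Filter.Eventually.of_forall fun t => ?_)
  exact RawForm.at_eq _ hx.1

theorem IsFormula.varAt_eq (h : IsFormula ρ x₀ f) (φ η : Sec n Fm F)
    (hx : x ∈ adaptedSource n Fm F x₀) :
    varAt ρ φ η x = (linOp f (secFld φ x₀) (secFld η x₀)
      (extChartAt (𝓡 n) x₀ x)).compContinuousLinearMap (chartDeriv x₀ x) :=
  (h.hasDerivAt_at φ η hx).deriv

theorem secFld_smul_eventuallyEq (t : ℝ) (ψ : Sec n Fm F) {y : Coord n}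
    (hy : y ∈ adaptedTarget n Fm F x₀) :
    (secFld (t • ψ) x₀ : Coord n → Fm) =ᶠ[𝓝 y]
      (t • secFld ψ x₀ : Fld (adaptedTarget n Fm F x₀) Fm) := by
  filter_upwards [(isOpen_adaptedTarget x₀).mem_nhds hy] with z hz using secInChart_smul t ψ hz

theorem IsFormula.varAt_smul_eq (h : IsFormula ρ x₀ f) (t : ℝ) (ψ η : Sec n Fm F)
    (hx : x ∈ adaptedSource n Fm F x₀) :
    varAt ρ (t • ψ) η x = (linOp f (t • secFld ψ x₀) (secFld η x₀)
      (extChartAt (𝓡 n) x₀ x)).compContinuousLinearMap (chartDeriv x₀ x) := by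
  rw [h.varAt_eq _ _ hx, (isLocOp_linOp (isOpen_adaptedTarget x₀) h.1).congr_germ
    (extChartAt_mem_adaptedTarget hx)
    (secFld_smul_eventuallyEq t ψ (extChartAt_mem_adaptedTarget hx)) Filter.EventuallyEq.rfl]

theorem continuous_linOp_smul {U : Set (Coord n)} (hU : IsOpen U)
    (hf : ContDiffOn ℝ ∞ f (U ×ˢ Set.univ)) (φ η : Fld U Fm) {y : Coord n} (hy : y ∈ U) :
    Continuous fun t : ℝ => linOp f (t • φ) η y := by
  have h1 : (fun t : ℝ => linOp f (t • φ) η y) = fun t : ℝ =>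
      fderiv ℝ f (y, t • jet r (φ : Coord n → Fm) y) (0, jet r (η : Coord n → Fm) y) := by
    funext t
    have := jet_smul (s := r) t (Fld.contDiffAt hU φ hy)
    have h' : jet r ((t • φ : Fld U Fm) : Coord n → Fm) y = t • jet r (φ : Coord n → Fm) y := this
    rw [linOp, h']
  rw [h1]
  have h2 : ContinuousOn (fderiv ℝ f) (U ×ˢ Set.univ) :=
    hf.continuousOn_fderiv_of_isOpen (hU.prod isOpen_univ) (by simp)
  have h3 : Continuous fun t : ℝ => fderiv ℝ f (y, t • jet r (φ : Coord n → Fm) y) :=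
    h2.comp_continuous (continuous_const.prodMk (continuous_id.smul continuous_const))
      fun t => ⟨hy, trivial⟩
  exact h3.clm_apply continuous_const

theorem IsFormula.continuous_varAt (h : IsFormula ρ x₀ f) (ψ η : Sec n Fm F)
    (hx : x ∈ adaptedSource n Fm F x₀) : Continuous fun t : ℝ => varAt ρ (t • ψ) η x := by
  simp only [h.varAt_smul_eq _ ψ η hx]
  exact (ContinuousAlternatingMap.compContinuousLinearMapCLM (𝕜 := ℝ) (ι := Fin k) (F := ℝ)
    (chartDeriv x₀ x)).continuous.comp (continuous_linOp_smul (isOpen_adaptedTarget x₀) h.1 _ _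
      (extChartAt_mem_adaptedTarget hx))

/-- Fundamental theorem of calculus along the ray `t ψ`: it recovers the nonlinear form from its
linearization, up to its value along the zero section. -/
theorem IsFormula.integral_varAt (h : IsFormula ρ x₀ f) (ψ : Sec n Fm F)
    (hx : x ∈ adaptedSource n Fm F x₀) :
    ∫ t in (0 : ℝ)..1, varAt ρ (t • ψ) ψ x = (ρ.along ψ).at x - (ρ.along 0).at x := by
  have h1 : ∀ t : ℝ, HasDerivAt (fun t : ℝ => (ρ.along (t • ψ)).at x) (varAt ρ (t • ψ) ψ x) t := by
    intro t
    have h2 := (h.hasDerivAt_at (t • ψ) ψ hx).differentiableAt.hasDerivAt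
    have h3 : HasDerivAt (fun s : ℝ => (ρ.along (t • ψ + s • ψ)).at x)
      (varAt ρ (t • ψ) ψ x) (t - t) := by rwa [sub_self]
    have h4 := h3.comp_sub_const t t
    refine h4.congr_of_eventuallyEq (Filter.Eventually.of_forall fun s => ?_)
    beta_reduce
    rw [← add_smul, add_sub_cancel]
  rw [intervalIntegral.integral_eq_sub_of_hasDerivAt (fun t _ => h1 t)
    ((h.continuous_varAt ψ ψ hx).intervalIntegrable _ _), one_smul, zero_smul]

/-- Only the germs of the directions at `x` matter, so a partition of unity may be summed after
truncation to the finitely many indices active near `x`. -/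
theorem IsFormula.varAt_sum (h : IsFormula ρ x₀ f) (φ ψ : Sec n Fm F)
    (hx : x ∈ adaptedSource n Fm F x₀) {ι : Type*} (S : Finset ι) (η : ι → Sec n Fm F)
    (hη : ∀ᶠ z in 𝓝 (extChartAt (𝓡 n) x₀ x), ∑ i ∈ S, secInChart (η i) x₀ z = secInChart ψ x₀ z) :
    ∑ i ∈ S, varAt ρ φ (η i) x = varAt ρ φ ψ x := by
  have hy := extChartAt_mem_adaptedTarget hx
  have hU := isOpen_adaptedTarget (n := n) (Fm := Fm) (F := F) x₀
  simp only [h.varAt_eq _ _ hx]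
  have h1 := (isLinOp_linOp hU f).sum (secFld φ x₀) S (fun i => secFld (η i) x₀) hy
  have h2 := (isLocOp_linOp hU h.1).congr_germ hy
    (Filter.EventuallyEq.rfl (f := (secFld φ x₀ : Coord n → Fm)))
    (η := ∑ i ∈ S, secFld (η i) x₀) (η' := secFld ψ x₀) (by
      filter_upwards [hη] with z hz
      rw [Submodule.coe_sum, Finset.sum_apply]
      exact hz)
  rw [← h2, h1]
  let L : (Coord n [⋀^Fin k]→L[ℝ] ℝ) →L[ℝ] (Coord n [⋀^Fin k]→L[ℝ] ℝ) :=
    ContinuousAlternatingMap.compContinuousLinearMapCLM (chartDeriv x₀ x)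
  exact (map_sum L _ S).symm

theorem IsFormula.varAt_eq_zero (h : IsFormula ρ x₀ f) (φ η : Sec n Fm F)
    (hx : x ∈ adaptedSource n Fm F x₀)
    (hη : ∀ᶠ z in 𝓝 (extChartAt (𝓡 n) x₀ x), secInChart η x₀ z = 0) : varAt ρ φ η x = 0 := by
  rw [← h.varAt_sum φ η hx ∅ (fun _ : Empty => 0) (by simpa [eq_comm] using hη), Finset.sum_empty]

end Pointwise

end

end VarBicomplex

namespace VarBicomplex
set_option linter.unusedSectionVars false
noncomputable section

/-! ## Gluing local primitives -/

section Partition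

variable {n : ℕ} {M : Type*} [TopologicalSpace M] [ChartedSpace (Coord n) M]
  [IsManifold (𝓡 n) ∞ M] [T2Space M] [SecondCountableTopology M]

/-- A partition of unity `c` with cutoff functions `θ` equal to one on the supports. -/
theorem exists_partition_cutoff (W : M → Set M) (hW : ∀ x, IsOpen (W x)) (hx : ∀ x, x ∈ W x) :
    ∃ c θ : M → M → ℝ, (∀ i, ContMDiff (𝓡 n) 𝓘(ℝ) ∞ (c i)) ∧
      (∀ i, ContMDiff (𝓡 n) 𝓘(ℝ) ∞ (θ i)) ∧ LocallyFinite (fun i => Function.support (θ i)) ∧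
      (∀ i, tsupport (θ i) ⊆ W i) ∧ (∀ i, ∀ x ∈ tsupport (c i), ∀ᶠ z in 𝓝 x, θ i z = 1) ∧
      ∀ x, ∑ᶠ i, c i x = 1 := by
  have hlc : LocallyCompactSpace M := Manifold.locallyCompact_of_finiteDimensional (𝓡 n)
  obtain ⟨μ, hμ⟩ := SmoothPartitionOfUnity.exists_isSubordinate (𝓡 n) isClosed_univ W hW
    fun x _ => Set.mem_iUnion.2 ⟨x, hx x⟩
  -- The open sets where `μ i ≠ 0` cover `M`. A second partition `c` subordinate to them leaves room
  -- for cutoffs `θ i` equal to one near the support of `c i` and supported where `μ i` is, so that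
  -- local finiteness is inherited from `μ`.
  have hs : ∀ i, IsOpen (Function.support (μ i)) := fun i =>
    (μ i).contMDiff.continuous.isOpen_support
  obtain ⟨c, hc⟩ := SmoothPartitionOfUnity.exists_isSubordinate (𝓡 n) isClosed_univ
    (fun i => Function.support (μ i)) hs (fun x _ => by
      by_contra h
      have h0 : ∀ i, μ i x = 0 := fun i => by
        by_contra hi
        exact h (Set.mem_iUnion.2 ⟨i, hi⟩)
      have h1 := μ.sum_eq_one (Set.mem_univ x)
      simp [h0] at h1)
  have hθ : ∀ i, ∃ θ : M → ℝ, ContMDiff (𝓡 n) 𝓘(ℝ) ∞ θ ∧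
      (∀ x ∈ tsupport (c i), ∀ᶠ z in 𝓝 x, θ z = 1) ∧ Function.support θ ⊆ Function.support (μ i) := by
    intro i
    obtain ⟨θ, h1, h0, -⟩ := exists_contMDiffMap_one_nhds_of_subset_interior (n := ⊤) (𝓡 n)
      (isClosed_tsupport (c i)) ((hc i).trans (hs i).interior_eq.symm.subset)
    refine ⟨θ, θ.contMDiff, fun x hx => h1.filter_mono (nhds_le_nhdsSet hx), fun x hx => ?_⟩
    by_contra h
    exact hx (h0 x h)
  choose θ hθs hθ1 hθμ using hθ
  exact ⟨fun i => c i, θ, fun i => (c i).contMDiff, hθs, μ.locallyFinite.subset hθμ,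
    fun i => (closure_mono (hθμ i)).trans (hμ i), hθ1, fun x => c.sum_eq_one (Set.mem_univ x)⟩

end Partition

/-! ### Extension by zero and locally finite sums of local forms -/

section Gluing

variable {n k s : ℕ} {M : Type*} [TopologicalSpace M] [ChartedSpace (Coord n) M]
  [IsManifold (𝓡 n) ∞ M]

theorem formInChart_eventuallyEq_of_eventuallyEq {α β : RawForm n M k} {x₀ x : M}
    (hx : x ∈ (extChartAt (𝓡 n) x₀).source) (h : ∀ᶠ z in 𝓝 x, α z = β z) :
    formInChart α x₀ =ᶠ[𝓝 (extChartAt (𝓡 n) x₀ x)] formInChart β x₀ := by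
  have hc := (continuousAt_extChartAt_symm'' (I := 𝓡 n) ((extChartAt (𝓡 n) x₀).map_source hx))
  rw [ContinuousAt, (extChartAt (𝓡 n) x₀).left_inv hx] at hc
  filter_upwards [hc.eventually h] with z hz
  rw [formInChart, formInChart, hz]

theorem extDerivAt_congr {α β : RawForm n M k} {x : M} (h : ∀ᶠ z in 𝓝 x, α z = β z) :
    extDerivAt α x = extDerivAt β x := by
  rw [extDerivAt, extDerivAt,
    (formInChart_eventuallyEq_of_eventuallyEq (mem_extChartAt_source x) h).extDeriv_eq]

theorem extDerivAt_zero (x : M) : extDerivAt (0 : RawForm n M k) x = 0 := by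
  have := extDerivAt_smul (0 : ℝ) (0 : RawForm n M k) x
  rwa [zero_smul, zero_smul] at this

theorem extDerivAt_sum {ι : Type*} (S : Finset ι) {α : ι → RawForm n M k}
    (h : ∀ i ∈ S, IsSmoothForm (α i)) (x : M) :
    extDerivAt (∑ i ∈ S, α i) x = ∑ i ∈ S, extDerivAt (α i) x := by
  classical
  induction S using Finset.induction_on with
  | empty => exact extDerivAt_zero x
  | insert i S hi ih =>
    have h' : ∀ j ∈ S, IsSmoothForm (α j) := fun j hj => h j (Finset.mem_insert_of_mem hj)
    have hS : IsSmoothForm (∑ j ∈ S, α j) := Submodule.sum_mem (SmoothForm n M k) h'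
    rw [Finset.sum_insert hi, Finset.sum_insert hi, extDerivAt_add
      (h i (Finset.mem_insert_self i S)).diffInChart hS.diffInChart, ih h']

variable {Fm : Type*} [NormedAddCommGroup Fm] [NormedSpace ℝ Fm]
  {F : M → Type*} [TopologicalSpace (TotalSpace Fm F)] [∀ x, TopologicalSpace (F x)]
  [FiberBundle Fm F] [∀ x, AddCommGroup (F x)] [∀ x, Module ℝ (F x)]
  [VectorBundle ℝ Fm F] [ContMDiffVectorBundle ∞ Fm F (𝓡 n)]

open Classical in
variable (Fm F) in
/-- The form on `M` with coordinate expression `θ β` in the adapted coordinates at `x₁`, extended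
by zero. -/
def extendForm (x₁ : M) (θ : M → ℝ) (β : Coord n → Coord n [⋀^Fin k]→L[ℝ] ℝ) : RawForm n M k :=
  fun x => if x ∈ adaptedSource n Fm F x₁ then
    (θ x • (β (extChartAt (𝓡 n) x₁ x)).compContinuousLinearMap (chartDeriv x₁ x) :
      Coord n [⋀^Fin k]→L[ℝ] ℝ) else 0

theorem extendForm_of_mem {x₁ x : M} (hx : x ∈ adaptedSource n Fm F x₁) (θ : M → ℝ)
    (β : Coord n → Coord n [⋀^Fin k]→L[ℝ] ℝ) : (extendForm Fm F x₁ θ β).at x =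
      θ x • (β (extChartAt (𝓡 n) x₁ x)).compContinuousLinearMap (chartDeriv x₁ x) :=
  if_pos hx

theorem extendForm_of_notMem {x₁ x : M} (hx : x ∉ adaptedSource n Fm F x₁) (θ : M → ℝ)
    (β : Coord n → Coord n [⋀^Fin k]→L[ℝ] ℝ) : (extendForm Fm F x₁ θ β).at x = 0 :=
  if_neg hx

theorem extendForm_eq_zero {x₁ x : M} {θ : M → ℝ} (hθ : θ x = 0)
    (β : Coord n → Coord n [⋀^Fin k]→L[ℝ] ℝ) : (extendForm Fm F x₁ θ β).at x = 0 := by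
  by_cases hx : x ∈ adaptedSource n Fm F x₁
  · rw [extendForm_of_mem hx, hθ, zero_smul]
  · exact extendForm_of_notMem hx _ _

theorem formInChart_extendForm {x₁ : M} {y : Coord n} (hy : y ∈ adaptedTarget n Fm F x₁)
    {θ : M → ℝ} (hθ : θ ((extChartAt (𝓡 n) x₁).symm y) = 1)
    (β : Coord n → Coord n [⋀^Fin k]→L[ℝ] ℝ) :
    formInChart (extendForm Fm F x₁ θ β) x₁ y = β y := by
  rw [formInChart_eq, extendForm_of_mem (symm_mem_adaptedSource hy), hθ, one_smul,
    (extChartAt (𝓡 n) x₁).right_inv hy.1]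
  ext v
  exact congrArg (β y) (funext fun i =>
    congrArg (fun L : Coord n →L[ℝ] Coord n => L (v i)) (chartDeriv_comp_symmDeriv_self hy.1))

/-- The extension by zero of an operator which is local in one chart is local in all charts. -/
theorem exists_formula_extendForm {x₁ : M} {θ : M → ℝ} (hθ : ContMDiff (𝓡 n) 𝓘(ℝ) ∞ θ)
    (hθs : tsupport θ ⊆ adaptedSource n Fm F x₁)
    {T : Sec n Fm F → Coord n → Coord n [⋀^Fin k]→L[ℝ] ℝ}
    (hT : JetLocal s (fun ψ : Sec n Fm F => secInChart ψ x₁) (adaptedTarget n Fm F x₁) T) (x₀ : M) :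
    ∃ f : Coord n × Jet n Fm s → Coord n [⋀^Fin k]→L[ℝ] ℝ,
      ContDiffOn ℝ ∞ f (adaptedTarget n Fm F x₀ ×ˢ Set.univ) ∧
      (∀ (ψ : Sec n Fm F), ∀ y ∈ adaptedTarget n Fm F x₀,
        formInChart (extendForm Fm F x₁ θ (T ψ)) x₀ y = f (y, jetCoord s ψ x₀ y)) ∧
      ∀ p : Coord n × Jet n Fm s, θ ((extChartAt (𝓡 n) x₀).symm p.1) = 0 → f p = 0 := by
  obtain ⟨p₁, hp₁, hT⟩ := hT
  obtain ⟨a, ha, hA⟩ := jetLocal_transition (n := n) (Fm := Fm) (F := F) x₀ x₁ s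
  have hO := isOpen_adaptedOverlap (n := n) (Fm := Fm) (F := F) x₀ x₁
  have hsub := adaptedOverlap_subset (n := n) (Fm := Fm) (F := F) x₀ x₁
  have hσ := (contDiffOn_transition (n := n) x₀ x₁).mono hsub
  let p : Coord n × Jet n Fm s → Coord n [⋀^Fin k]→L[ℝ] ℝ := fun q =>
    (p₁ (transition x₀ x₁ q.1, a q)).compContinuousLinearMap (fderiv ℝ (transition x₀ x₁) q.1)
  have hp : ContDiffOn ℝ ∞ p (adaptedOverlap n Fm F x₀ x₁ ×ˢ Set.univ) := by
    refine contDiffOn_compContinuousLinearMap ?_ ?_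
    · exact hp₁.comp ((hσ.comp contDiffOn_fst fun q hq => hq.1).prodMk ha)
        fun q hq => ⟨transition_mem_adaptedTarget hq.1, trivial⟩
    · exact (hσ.fderiv_of_isOpen hO (by simp)).comp contDiffOn_fst fun q hq => hq.1
  -- The formula `p` is smooth only over the overlap of the two coordinate domains. Over the closed
  -- support of `θ` the base point lies in that open overlap, and elsewhere the product vanishes
  -- near the point.
  refine ⟨fun q => θ ((extChartAt (𝓡 n) x₀).symm q.1) • p q, ?_, ?_, fun q hq => ?_⟩
  · intro q hq
    refine ContDiffAt.contDiffWithinAt ?_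
    have hy : q.1 ∈ (extChartAt (𝓡 n) x₀).target := hq.1.1
    by_cases hx : (extChartAt (𝓡 n) x₀).symm q.1 ∈ tsupport θ
    · have hq' : q.1 ∈ adaptedOverlap n Fm F x₀ x₁ := ⟨hq.1, hθs hx⟩
      have h1 : ContDiffAt ℝ ∞ (fun q : Coord n × Jet n Fm s =>
          θ ((extChartAt (𝓡 n) x₀).symm q.1)) q :=
        ((contDiffOn_comp_symm hθ x₀).contDiffAt
          ((isOpen_extChartAt_target x₀).mem_nhds hy)).comp q contDiffAt_fst
      exact h1.smul (hp.contDiffAt ((hO.prod isOpen_univ).mem_nhds ⟨hq', trivial⟩))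
    · have h0 : ∀ᶠ z in 𝓝 ((extChartAt (𝓡 n) x₀).symm q.1), θ z = 0 :=
        notMem_tsupport_iff_eventuallyEq.1 hx
      have hc := (continuousAt_extChartAt_symm'' (I := 𝓡 n) hy).comp
        (continuousAt_fst (p := q))
      refine contDiffAt_const (c := 0) |>.congr_of_eventuallyEq ?_
      filter_upwards [hc.eventually h0] with z hz
      have hz' : θ ((extChartAt (𝓡 n) x₀).symm z.1) = 0 := hz
      rw [hz', zero_smul]
  · intro ψ y hy
    by_cases hx : (extChartAt (𝓡 n) x₀).symm y ∈ adaptedSource n Fm F x₁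
    · have hyO : y ∈ adaptedOverlap n Fm F x₀ x₁ := ⟨hy, hx⟩
      have hA' : jet s (secInChart ψ x₁) (transition x₀ x₁ y) =
        a (y, jetCoord s ψ x₀ y) := hA ψ y hyO
      rw [formInChart_eq, extendForm_of_mem hx]
      change _ = θ _ • (p₁ (transition x₀ x₁ y, a (y, jetCoord s ψ x₀ y))).compContinuousLinearMap _
      rw [← hA', ← hT ψ _ (transition_mem_adaptedTarget hyO),
        ← chartDeriv_comp_symmDeriv (hsub hyO)]
      rfl
    · have h0 : θ ((extChartAt (𝓡 n) x₀).symm y) = 0 := by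
        by_contra h
        exact hx (hθs (subset_tsupport θ h))
      rw [formInChart_eq, extendForm_of_notMem hx]
      beta_reduce
      rw [h0, zero_smul]
      rfl
  · beta_reduce
    rw [hq, zero_smul]

theorem isSmoothForm_extendForm {x₁ : M} {θ : M → ℝ} (hθ : ContMDiff (𝓡 n) 𝓘(ℝ) ∞ θ)
    (hθs : tsupport θ ⊆ adaptedSource n Fm F x₁)
    {T : Sec n Fm F → Coord n → Coord n [⋀^Fin k]→L[ℝ] ℝ}
    (hT : JetLocal s (fun ψ : Sec n Fm F => secInChart ψ x₁) (adaptedTarget n Fm F x₁) T)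
    (ψ : Sec n Fm F) : IsSmoothForm (extendForm Fm F x₁ θ (T ψ)) := by
  obtain ⟨j, hj, e⟩ := exists_localForm (fun ψ => extendForm Fm F x₁ θ (T ψ)) fun x₀ => by
    obtain ⟨f, hf, h, -⟩ := exists_formula_extendForm hθ hθs hT x₀
    exact ⟨f, hf, h⟩
  rw [← e ψ]
  exact IsLocalForm.isSmoothForm hj ψ

/-- A locally finite sum of extensions by zero is a local form. -/
theorem exists_localForm_finsum {θ : M → M → ℝ} (hθ : ∀ i, ContMDiff (𝓡 n) 𝓘(ℝ) ∞ (θ i))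
    (hlf : LocallyFinite fun i => Function.support (θ i))
    (hθs : ∀ i, tsupport (θ i) ⊆ adaptedSource n Fm F i)
    {T : M → Sec n Fm F → Coord n → Coord n [⋀^Fin k]→L[ℝ] ℝ}
    (hT : ∀ i, JetLocal s (fun ψ : Sec n Fm F => secInChart ψ i) (adaptedTarget n Fm F i) (T i)) :
    ∃ j ∈ LocalForm n Fm F k, ∀ ψ x, (j.along ψ).at x =
      ∑ᶠ i, (extendForm Fm F i (θ i) (T i ψ)).at x := by
  obtain ⟨j, hj, e⟩ := exists_localForm (n := n) (M := M) (k := k) (r := s)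
    (fun (ψ : Sec n Fm F) x => (∑ᶠ i, (extendForm Fm F i (θ i) (T i ψ)).at x :
      Coord n [⋀^Fin k]→L[ℝ] ℝ)) fun x₀ => by
    choose f hf hfT hf0 using fun i => exists_formula_extendForm (hθ i) (hθs i) (hT i) x₀
    refine ⟨fun p => ∑ᶠ i, f i p, ?_, fun ψ y hy => ?_⟩
    · intro q hq
      refine ContDiffAt.contDiffWithinAt ?_
      -- Local finiteness holds in the base variable, and `f i` vanishes wherever `θ i` does,
      -- whatever the jet; so near `q` the sum is finite uniformly in the jet coordinates.
      obtain ⟨N, hN, hfin⟩ := hlf ((extChartAt (𝓡 n) x₀).symm q.1)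
      have hc := (continuousAt_extChartAt_symm'' (I := 𝓡 n) hq.1.1).comp
        (continuousAt_fst (p := q))
      have h1 : ContDiffAt ℝ ∞ (fun p => ∑ i ∈ hfin.toFinset, f i p) q :=
        ContDiffAt.sum fun i _ => (hf i).contDiffAt
          (((isOpen_adaptedTarget x₀).prod isOpen_univ).mem_nhds hq)
      refine h1.congr_of_eventuallyEq ?_
      filter_upwards [hc.preimage_mem_nhds hN] with z hz
      refine finsum_eq_sum_of_support_subset _ fun i hi => ?_
      rw [Set.Finite.coe_toFinset]
      refine ⟨_, ?_, hz⟩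
      by_contra h
      exact hi (hf0 i z (by simpa using h))
    · let L : (Coord n [⋀^Fin k]→L[ℝ] ℝ) →L[ℝ] (Coord n [⋀^Fin k]→L[ℝ] ℝ) :=
        ContinuousAlternatingMap.compContinuousLinearMapCLM (symmDeriv x₀ y)
      have hfin : (Function.support fun i => (extendForm Fm F i (θ i) (T i ψ)).at
          ((extChartAt (𝓡 n) x₀).symm y)).Finite := by
        refine (hlf.point_finite ((extChartAt (𝓡 n) x₀).symm y)).subset fun i hi => ?_
        by_contra h
        exact hi (extendForm_eq_zero (by simpa using h) _)
      refine (AddMonoidHom.map_finsum L.toLinearMap.toAddMonoidHom hfin).trans ?_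
      exact finsum_congr fun i => hfT i ψ y hy
  exact ⟨j, hj, fun ψ x => congrFun (e ψ) x⟩

end Gluing

end

end VarBicomplex

namespace VarBicomplex
set_option linter.unusedSectionVars false
noncomputable section

/-! ## Exactness of the horizontal complex in positive degree in the fields -/

section Exactness

variable {n k : ℕ} {M : Type*} [TopologicalSpace M] [ChartedSpace (Coord n) M]
  [IsManifold (𝓡 n) ∞ M] [T2Space M]
  {Fm : Type*} [NormedAddCommGroup Fm] [NormedSpace ℝ Fm]
  {F : M → Type*} [TopologicalSpace (TotalSpace Fm F)] [∀ x, TopologicalSpace (F x)]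
  [FiberBundle Fm F] [∀ x, AddCommGroup (F x)] [∀ x, Module ℝ (F x)]
  [VectorBundle ℝ Fm F] [ContMDiffVectorBundle ∞ Fm F (𝓡 n)]

theorem eventually_symm_of_eventually {x₀ x : M} (hx : x ∈ (extChartAt (𝓡 n) x₀).source)
    {p : M → Prop} (h : ∀ᶠ z in 𝓝 x, p z) :
    ∀ᶠ w in 𝓝 (extChartAt (𝓡 n) x₀ x), p ((extChartAt (𝓡 n) x₀).symm w) := by
  have hc := continuousAt_extChartAt_symm'' (I := 𝓡 n) ((extChartAt (𝓡 n) x₀).map_source hx)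
  rw [ContinuousAt, (extChartAt (𝓡 n) x₀).left_inv hx] at hc
  exact hc.eventually h

/-- A closed local function with vanishing Euler-Lagrange derivative and vanishing along the zero
section is zero. -/
theorem eq_zero_of_isHorizontalDiff_zero {ρ : RawLocalForm n Fm F 0} (hρ : IsLocalForm ρ)
    (hc : IsHorizontalDiff ρ (0 : RawLocalForm n Fm F 1))
    (hEL : 0 = n → EulerLagrangeVanishes ρ) (h0 : ρ.along 0 = 0) : ρ = 0 := by
  refine RawLocalForm.ext_along fun ψ => funext fun x => ?_
  obtain ⟨r, hr⟩ := hρ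
  obtain ⟨f, hf⟩ : ∃ f : Coord n × Jet n Fm r → _, IsFormula ρ x f := hr x
  have hU := isOpen_adaptedTarget (n := n) (Fm := Fm) (F := F) x
  have hl := isLocOp_linOp hU hf.1
  have hP := isLinOp_linOp (r := r) hU f
  -- The linearization vanishes at every field, so the form is constant along the ray from the zero
  -- section.
  have hz := eq_zero_of_isClosedOp hU hl hP (hl.hasOrderLT hU hP) (hf.isClosedOp hc)
    fun hn => hf.integralVanishes (hEL hn)
  have hx := mem_adaptedSource (n := n) (Fm := Fm) (F := F) x
  have h1 := hf.integral_varAt ψ hx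
  have h2 : ∀ t : ℝ, varAt ρ (t • ψ) ψ x = 0 := fun t => by
    rw [hf.varAt_eq _ _ hx, hz _ _ _ (extChartAt_mem_adaptedTarget hx)]
    rfl
  simp only [h2, intervalIntegral.integral_zero, h0] at h1
  have h3 : (0 : RawForm n M 0).at x = 0 := rfl
  rw [h3, sub_zero] at h1
  exact h1.symm

variable {ρ : RawLocalForm n Fm F (k + 1)} {s r : ℕ}

/-- The differential of the contribution of one chart to the primitive. -/
theorem extDerivAt_extendForm_rayIntegral {x₁ : M} {c θ : M → ℝ}
    (hc : ContMDiff (𝓡 n) 𝓘(ℝ) ∞ c)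
    (hθs : tsupport θ ⊆ adaptedSource n Fm F x₁)
    (hcθ : ∀ x ∈ tsupport c, ∀ᶠ z in 𝓝 x, θ z = 1)
    (hf : ∀ x₀, ∃ f : Coord n × Jet n Fm r → Coord n [⋀^Fin (k + 1)]→L[ℝ] ℝ, IsFormula ρ x₀ f)
    {f : Coord n × Jet n Fm r → Coord n [⋀^Fin (k + 1)]→L[ℝ] ℝ} (hf₁ : IsFormula ρ x₁ f)
    {Q : Fld (adaptedTarget n Fm F x₁) Fm → Fld (adaptedTarget n Fm F x₁) Fm → Coord n →
      Coord n [⋀^Fin k]→L[ℝ] ℝ} (hQ : IsLocOp s Q)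
    (hQ0 : ∀ φ, ∀ y ∈ adaptedTarget n Fm F x₁, Q φ 0 y = 0)
    (hQd : ∀ φ η, ∀ y ∈ adaptedTarget n Fm F x₁, extDeriv (Q φ η) y = linOp f φ η y)
    (hg : ContDiffOn ℝ ∞ (fun y => c ((extChartAt (𝓡 n) x₁).symm y)) (adaptedTarget n Fm F x₁))
    (ψ : Sec n Fm F) (x : M) :
    extDerivAt (extendForm Fm F x₁ θ (rayIntegral Q _ hg (secFld ψ x₁))) x =
      ∫ t in (0 : ℝ)..1, varAt ρ (t • ψ) (smulSec c hc ψ) x := by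
  have hU := isOpen_adaptedTarget (n := n) (Fm := Fm) (F := F) x₁
  -- Over the support of `c` the cutoff is one near `x`, and the differential passes under the
  -- integral. Off it `c` vanishes near `x`, and both sides are zero: the left by the normalization
  -- of `Q`, the right by linearity in the direction.
  by_cases hx : x ∈ tsupport c
  · have hxs : x ∈ adaptedSource n Fm F x₁ := by
      refine hθs (subset_tsupport θ ?_)
      rw [Function.mem_support, (hcθ x hx).self_of_nhds]
      exact one_ne_zero
    have hy := extChartAt_mem_adaptedTarget hxs
    have e : formInChart (extendForm Fm F x₁ θ (rayIntegral Q _ hg (secFld ψ x₁))) x₁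
        =ᶠ[𝓝 (extChartAt (𝓡 n) x₁ x)] rayIntegral Q _ hg (secFld ψ x₁) := by
      filter_upwards [eventually_symm_of_eventually hxs.1 (hcθ x hx), hU.mem_nhds hy] with z hz hzU
      exact formInChart_extendForm hzU hz _
    have hd : ContDiffAt ℝ ∞ (rayIntegral Q _ hg (secFld ψ x₁)) (extChartAt (𝓡 n) x₁ x) :=
      ContDiffOn.contDiffAt (JetLocal.contDiffOn hU (fun φ => φ.2) (hQ.jetLocal_rayIntegral hU)
        (secFld ψ x₁)) (hU.mem_nhds hy)
    rw [extDerivAt_eq _ hxs.1 ((hd.congr_of_eventuallyEq e).differentiableAt (by simp)),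
      e.extDeriv_eq, hQ.extDeriv_rayIntegral hU _ hy]
    let L : (Coord n [⋀^Fin (k + 1)]→L[ℝ] ℝ) →L[ℝ] (Coord n [⋀^Fin (k + 1)]→L[ℝ] ℝ) :=
      ContinuousAlternatingMap.compContinuousLinearMapCLM (chartDeriv x₁ x)
    have h1 : ∀ t : ℝ, extDeriv (Q (t • secFld ψ x₁) (Fld.mul _ hg (secFld ψ x₁)))
        (extChartAt (𝓡 n) x₁ x) = linOp f (t • secFld ψ x₁) (Fld.mul _ hg (secFld ψ x₁))
        (extChartAt (𝓡 n) x₁ x) := fun t => hQd _ _ _ hy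
    have h2 : ∀ t : ℝ, varAt ρ (t • ψ) (smulSec c hc ψ) x =
        L (linOp f (t • secFld ψ x₁) (Fld.mul _ hg (secFld ψ x₁)) (extChartAt (𝓡 n) x₁ x)) := by
      intro t
      rw [hf₁.varAt_smul_eq _ _ _ hxs]
      refine congrArg L ((isLocOp_linOp hU hf₁.1).congr_germ hy Filter.EventuallyEq.rfl ?_)
      filter_upwards [hU.mem_nhds hy] with z hz using secInChart_smulSec c hc ψ hz
    simp only [h1, h2]
    exact (L.intervalIntegral_comp_comm ((continuous_linOp_smul hU hf₁.1 _ _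
      hy).intervalIntegrable _ _)).symm
  · have h0 : ∀ᶠ z in 𝓝 x, c z = 0 := notMem_tsupport_iff_eventuallyEq.1 hx
    have h1 : ∀ᶠ z in 𝓝 x, extendForm Fm F x₁ θ (rayIntegral Q _ hg (secFld ψ x₁)) z =
        (0 : RawForm n M k) z := by
      filter_upwards [eventually_eventually_nhds.2 h0] with z hz
      by_cases hzs : z ∈ adaptedSource n Fm F x₁
      · refine (extendForm_of_mem hzs _ _).trans ?_
        rw [rayIntegral_eq_zero hQ hQ0 _ (extChartAt_mem_adaptedTarget hzs)
          (eventually_symm_of_eventually hzs.1 hz)]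
        exact smul_zero _
      · exact extendForm_of_notMem hzs _ _
    rw [extDerivAt_congr h1, extDerivAt_zero]
    obtain ⟨f', hf'⟩ := hf x
    have hxs := mem_adaptedSource (n := n) (Fm := Fm) (F := F) x
    have h2 : ∀ t : ℝ, varAt ρ (t • ψ) (smulSec c hc ψ) x = 0 := fun t => by
      refine hf'.varAt_eq_zero _ _ hxs ?_
      filter_upwards [eventually_symm_of_eventually hxs.1 h0,
        (isOpen_adaptedTarget x).mem_nhds (extChartAt_mem_adaptedTarget hxs)] with z hz hzU
      rw [secInChart_smulSec c hc ψ hzU, hz, zero_smul]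
    simp only [h2, intervalIntegral.integral_zero]
    rfl

/-- Closed local forms which vanish along the zero section, with vanishing Euler-Lagrange derivative
in the top degree, are horizontally exact. -/
theorem exists_isHorizontalDiff [SecondCountableTopology M] (hk : k + 1 ≤ n) (hρ : IsLocalForm ρ)
    (hcl : IsHorizontalDiff ρ (0 : RawLocalForm n Fm F (k + 1 + 1)))
    (hEL : k + 1 = n → EulerLagrangeVanishes ρ) (h0 : ρ.along 0 = 0) :
    ∃ j ∈ LocalForm n Fm F k, IsHorizontalDiff j ρ := by
  obtain ⟨r, hr⟩ := hρ
  have hf : ∀ x₀, ∃ f : Coord n × Jet n Fm r → Coord n [⋀^Fin (k + 1)]→L[ℝ] ℝ, IsFormula ρ x₀ f := hr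
  choose f hff using hf
  have hU : ∀ x₀, IsOpen (adaptedTarget n Fm F x₀) := fun x₀ => isOpen_adaptedTarget x₀
  choose Q hQ hQ0 hQd using fun x₀ => exists_normalized_primitive_op (hU x₀) hk
    (isLocOp_linOp (hU x₀) (hff x₀).1) (isLinOp_linOp (r := r) (hU x₀) (f x₀))
    ((hff x₀).isClosedOp hcl) fun hn => (hff x₀).integralVanishes (hEL hn)
  obtain ⟨c, θ, hc, hθ, hlf, hθs, hcθ, hsum⟩ := exists_partition_cutoff (n := n)
    (adaptedSource n Fm F) isOpen_adaptedSource mem_adaptedSource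
  have hg : ∀ i, ContDiffOn ℝ ∞ (fun y => c i ((extChartAt (𝓡 n) i).symm y))
      (adaptedTarget n Fm F i) := fun i =>
    (contDiffOn_comp_symm (hc i) i).mono Set.inter_subset_left
  -- The contribution of chart `i` integrates `Q_i (t ψ) (c_i ψ)`; the cutoff `θ i` serves only to
  -- extend it by zero.
  let T : M → Sec n Fm F → Coord n → Coord n [⋀^Fin k]→L[ℝ] ℝ := fun i ψ =>
    rayIntegral (Q i) _ (hg i) (secFld ψ i)
  have hT : ∀ i, JetLocal (r + (r + 1)) (fun ψ : Sec n Fm F => secInChart ψ i)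
      (adaptedTarget n Fm F i) (T i) := by
    intro i
    obtain ⟨p, hp, h⟩ := (hQ i).jetLocal_rayIntegral (hU i) (hg := hg i)
    exact ⟨p, hp, fun ψ y hy => h (secFld ψ i) y hy⟩
  obtain ⟨j, hj, hjT⟩ := exists_localForm_finsum hθ hlf hθs hT
  refine ⟨j, hj, fun ψ => isExtDeriv_iff.2 fun x => ?_⟩
  obtain ⟨N, hN, hfin⟩ := hlf x
  have hS : ∀ z ∈ N, ∀ i ∉ hfin.toFinset, θ i z = 0 := by
    intro z hz i hi
    by_contra h
    exact hi (hfin.mem_toFinset.2 ⟨z, h, hz⟩)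
  have h1 : ∀ᶠ z in 𝓝 x, j.along ψ z =
      (∑ i ∈ hfin.toFinset, extendForm Fm F i (θ i) (T i ψ)) z := by
    filter_upwards [hN] with z hz
    refine (hjT ψ z).trans ((finsum_eq_sum_of_support_subset _ fun i hi => ?_).trans
      (Finset.sum_apply z _ _).symm)
    by_contra h
    exact hi (extendForm_eq_zero (hS z hz i h) _)
  rw [extDerivAt_congr h1, extDerivAt_sum _ fun i _ =>
    isSmoothForm_extendForm (hθ i) (hθs i) (hT i) ψ]
  have h2 : ∀ i, extDerivAt (extendForm Fm F i (θ i) (T i ψ)) x =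
      ∫ t in (0 : ℝ)..1, varAt ρ (t • ψ) (smulSec (c i) (hc i) ψ) x := fun i =>
    extDerivAt_extendForm_rayIntegral (hc i) (hθs i) (hcθ i) hr (hff i) (hQ i) (hQ0 i)
      (hQd i) (hg i) ψ x
  have hxs := mem_adaptedSource (n := n) (Fm := Fm) (F := F) x
  -- Indices with `c i ≠ 0` at a point also have `θ i = 1` there, so the finite set chosen for `θ`
  -- near `x` carries the whole partition of unity.
  have h3 : ∀ᶠ z in 𝓝 (extChartAt (𝓡 n) x x),
      ∑ i ∈ hfin.toFinset, secInChart (smulSec (c i) (hc i) ψ) x z = secInChart ψ x z := by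
    filter_upwards [eventually_symm_of_eventually hxs.1 hN,
      (hU x).mem_nhds (extChartAt_mem_adaptedTarget hxs)] with z hz hzU
    have h4 : ∑ i ∈ hfin.toFinset, c i ((extChartAt (𝓡 n) x).symm z) = 1 := by
      rw [← hsum ((extChartAt (𝓡 n) x).symm z)]
      refine (finsum_eq_sum_of_support_subset _ fun i hi => ?_).symm
      by_contra h
      have h5 := (hcθ i _ (subset_tsupport _ hi)).self_of_nhds
      rw [hS _ hz i h] at h5
      exact zero_ne_one h5
    simp only [secInChart_smulSec _ _ ψ hzU]
    rw [← Finset.sum_smul, h4, one_smul]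
  have h6 : ∫ t in (0 : ℝ)..1, varAt ρ (t • ψ) ψ x = (ρ.along ψ).at x - (ρ.along 0).at x :=
    (hff x).integral_varAt ψ hxs
  have h7 : (ρ.along 0).at x = 0 := congrFun h0 x
  rw [h7, sub_zero] at h6
  refine h6.symm.trans ?_
  have h8 : ∀ t : ℝ, varAt ρ (t • ψ) ψ x =
      ∑ i ∈ hfin.toFinset, varAt ρ (t • ψ) (smulSec (c i) (hc i) ψ) x := fun t =>
    ((hff x).varAt_sum _ ψ hxs _ _ h3).symm
  simp only [h8]
  rw [intervalIntegral.integral_finsetSum fun i _ =>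
    ((hff x).continuous_varAt ψ _ hxs).intervalIntegrable _ _]
  exact Finset.sum_congr rfl fun i _ => (h2 i).symm

end Exactness

end

end VarBicomplex

namespace VarBicomplex
set_option linter.unusedSectionVars false
noncomputable section

/-! ## Null sources, null cohomology and characteristic cohomology -/

section Cohomology

variable {n : ℕ} {M : Type*} [TopologicalSpace M] [ChartedSpace (Coord n) M]
  [IsManifold (𝓡 n) ∞ M]
  {Fm : Type*} [NormedAddCommGroup Fm] [NormedSpace ℝ Fm]
  {F : M → Type*} [TopologicalSpace (TotalSpace Fm F)] [∀ x, TopologicalSpace (F x)]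
  [FiberBundle Fm F] [∀ x, AddCommGroup (F x)] [∀ x, Module ℝ (F x)]
  [VectorBundle ℝ Fm F] [ContMDiffVectorBundle ∞ Fm F (𝓡 n)]
  {Gm : Type*} [NormedAddCommGroup Gm] [NormedSpace ℝ Gm]
  {G : M → Type*} [TopologicalSpace (TotalSpace Gm G)] [∀ x, TopologicalSpace (G x)]
  [FiberBundle Gm G] [∀ x, AddCommGroup (G x)] [∀ x, Module ℝ (G x)]
  [VectorBundle ℝ Gm G] [ContMDiffVectorBundle ∞ Gm G (𝓡 n)]
  {k : ℕ}

theorem IsHorizontalDiff.degree_eq {l : ℕ} {j : RawLocalForm n Fm F k} {ρ : RawLocalForm n Fm F l}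
    (h : IsHorizontalDiff j ρ) : l = k + 1 :=
  (h 0).1

/-- Every point of `J^∞F` is by definition the jet of a section, so a form on it is determined by
its values along sections. -/
theorem IsHorizontalDiff.unique {j : RawLocalForm n Fm F k} {ρ ρ' : RawLocalForm n Fm F (k + 1)}
    (h : IsHorizontalDiff j ρ) (h' : IsHorizontalDiff j ρ') : ρ = ρ' :=
  RawLocalForm.ext_along fun ψ => funext fun x =>
    (isExtDeriv_iff.1 (h ψ) x).trans (isExtDeriv_iff.1 (h' ψ) x).symm

theorem IsHorizontalDiff.isHorizontalDiff_zero {l : ℕ} {j : RawLocalForm n Fm F k}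
    {ρ : RawLocalForm n Fm F l} (hj : IsLocalForm j) (h : IsHorizontalDiff j ρ) :
    IsHorizontalDiff ρ (0 : RawLocalForm n Fm F (l + 1)) := by
  obtain rfl := h.degree_eq
  exact fun ψ => (h ψ).isExtDeriv_zero (hj.isSmoothForm ψ)

theorem isHorizontalDiff_zero_of_mem {S : (m : ℕ) → Submodule ℝ (RawLocalForm n Fm F m)}
    {ρ : RawLocalForm n Fm F k} (h : ρ ∈ horizontalImage S k) :
    IsHorizontalDiff ρ (0 : RawLocalForm n Fm F (k + 1)) := by
  rcases h with rfl | ⟨m, j, hj, h⟩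
  · exact IsHorizontalDiff.zero k
  · exact h.isHorizontalDiff_zero hj.1

/-- In positive degree the alternative `ρ = 0` is covered by `j = 0`, and the degree of a primitive
is forced. -/
theorem mem_horizontalImage_succ {S : (m : ℕ) → Submodule ℝ (RawLocalForm n Fm F m)}
    {ρ : RawLocalForm n Fm F (k + 1)} : ρ ∈ horizontalImage S (k + 1) ↔
      ∃ j ∈ LocalForm n Fm F k ⊓ S k, IsHorizontalDiff j ρ := by
  constructor
  · rintro (rfl | ⟨m, j, hj, h⟩)
    · exact ⟨0, zero_mem _, IsHorizontalDiff.zero k⟩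
    · obtain rfl : k = m := by
        have := h.degree_eq
        omega
      exact ⟨j, hj, h⟩
  · rintro ⟨j, hj, h⟩
    exact Or.inr ⟨k, j, hj, h⟩

/-- Horizontally closed local forms of degree less than `n` are sums of closed forms on `M` and of
horizontally exact forms. -/
theorem exists_closedForm_sub_mem [T2Space M] [SecondCountableTopology M] (hk : k < n)
    {δ : RawLocalForm n Fm F k} (hδ : IsLocalForm δ)
    (h : IsHorizontalDiff δ (0 : RawLocalForm n Fm F (k + 1))) :
    ∃ α ∈ closedForms n M k,
      δ - fieldIndependent k α ∈ LocalForm n Fm F k ⊓ horizontalImage (LocalForm n Fm F) k := by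
  -- The closed form on `M` is the value of `δ` along the zero section; after its removal the
  -- exactness theorem applies, and `k < n` makes the Euler-Lagrange condition void.
  have hα : δ.along 0 ∈ closedForms n M k := ⟨hδ.isSmoothForm 0, h 0⟩
  have hfi : IsHorizontalDiff (fieldIndependent k (δ.along 0) : RawLocalForm n Fm F k)
      (0 : RawLocalForm n Fm F (k + 1)) := fun _ => hα.2
  refine ⟨δ.along 0, hα, ?_⟩
  have h1 : δ - fieldIndependent k (δ.along 0) ∈ LocalForm n Fm F k :=
    sub_mem hδ (fieldIndependent_mem hα.1)
  refine ⟨h1, ?_⟩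
  have h2 : IsHorizontalDiff (δ - fieldIndependent k (δ.along 0))
      (0 : RawLocalForm n Fm F (k + 1)) := by
    have := h.add hδ (Submodule.smul_mem _ (-1 : ℝ) (fieldIndependent_mem hα.1)) (hfi.smul (-1))
    rwa [smul_zero, add_zero, neg_one_smul, ← sub_eq_add_neg] at this
  have h3 : (δ - fieldIndependent k (δ.along 0)).along 0 = 0 := sub_self (δ.along 0)
  cases k with
  | zero => exact Or.inl (eq_zero_of_isHorizontalDiff_zero h1 h2 (fun hn => absurd hn hk.ne) h3)
  | succ k =>
    obtain ⟨j, hj, hd⟩ := exists_isHorizontalDiff hk.le h1 h2 (fun hn => absurd hn hk.ne) h3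
    exact Or.inr ⟨k, j, ⟨hj, hj⟩, hd⟩

variable (e : Sec n Fm F →ₗ[ℝ] Sec n Gm G)

/-- Linearity of the system enters through this fact: `e 0 = 0`, so the zero section is a global
solution. -/
theorem prolong_zero_mem_pde (x : M) : prolong 0 x ∈ pde e :=
  ⟨0, rfl, by rw [map_zero]⟩

theorem along_zero_of_mem_nullForms {ρ : RawLocalForm n Fm F k} (hρ : ρ ∈ nullForms e k) :
    ρ.along 0 = 0 :=
  funext fun x => hρ.2 _ (prolong_zero_mem_pde e x)

/-- Null `k`-forms which are horizontal differentials of local forms. -/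
def exactNullForms (k : ℕ) : Submodule ℝ (RawLocalForm n Fm F k) :=
  nullForms e k ⊓ horizontalImage (LocalForm n Fm F) k

/-- Closedness is `d² = 0`; in degree `n` the Euler-Lagrange derivative of a differential vanishes
by Stokes. -/
theorem exactNullForms_le : exactNullForms e k ≤ nullCocycles e k := by
  rintro ρ ⟨hρ, h⟩
  refine ⟨hρ, isHorizontalDiff_zero_of_mem h, fun hk => ?_⟩
  rcases h with rfl | ⟨m, j, hj, h⟩
  · exact (zero_mem (nullCocycles e k)).2.2 hk
  · obtain rfl := h.degree_eq
    exact eulerLagrangeVanishes_of_isHorizontalDiff hj.1 h hk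

theorem exactNullForms_degree_zero {ρ : RawLocalForm n Fm F k} (hk : k = 0)
    (h : ρ ∈ exactNullForms e k) : ρ = 0 := by
  rcases h.2 with h | ⟨m, j, -, h⟩
  · exact h
  · have := h.degree_eq
    omega

/-- The converse inclusion and the core of the comparison: null forms vanish along the zero section,
so null cocycles have local primitives, although these need not be null. -/
theorem nullCocycles_le [T2Space M] [SecondCountableTopology M] (hk : k + 1 ≤ n) :
    nullCocycles e (k + 1) ≤ exactNullForms e (k + 1) := by
  rintro ρ ⟨hρ, h, hEL⟩
  obtain ⟨j, hj, hd⟩ := exists_isHorizontalDiff hk hρ.1 h hEL (along_zero_of_mem_nullForms e hρ)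
  exact ⟨hρ, Or.inr ⟨k, j, ⟨hj, hj⟩, hd⟩⟩

theorem nullCocycles_degree_zero [T2Space M] {ρ : RawLocalForm n Fm F 0}
    (h : ρ ∈ nullCocycles e 0) : ρ = 0 :=
  eq_zero_of_isHorizontalDiff_zero h.1.1 h.2.1 h.2.2 (along_zero_of_mem_nullForms e h.1)

/-- Evaluation along the zero section undoes the pullback of forms from `M`. If the pullback of `α`
agrees on shell with `d_h i'`, then `α` is the differential of `i'[0]`. -/
theorem injective_deRhamToChar (k : ℕ) : Function.Injective (deRhamToChar e k) := by
  rw [injective_iff_map_eq_zero]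
  intro a ha
  obtain ⟨⟨α, hα⟩, rfl⟩ := Submodule.Quotient.mk_surjective _ a
  rw [deRhamToChar, Submodule.mapQ_apply, Submodule.Quotient.mk_eq_zero] at ha
  obtain ⟨i, ⟨hi, hi'⟩, hr⟩ := ha
  have h1 : i.along 0 = α := funext fun x =>
    congrFun hr (⟨prolong 0 x, prolong_zero_mem_pde e x⟩ : pde e)
  rw [Submodule.Quotient.mk_eq_zero]
  refine ⟨hα.1, ?_⟩
  rcases hi' with rfl | ⟨m, i', hi', h⟩
  · exact Or.inl h1.symm
  · exact Or.inr ⟨m, i'.along 0, IsLocalForm.isSmoothForm hi'.1 0, h1 ▸ h 0⟩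

/-- The map from the cohomology of sources to the null cohomology, `[ρ] ↦ [ρ]`. -/
def exactNullMap (k : ℕ) :
    (exactNullForms e k ⧸ (nullCoboundaries e k).submoduleOf (exactNullForms e k)) →ₗ[ℝ]
      HNull e k :=
  Submodule.mapQ ((nullCoboundaries e k).submoduleOf (exactNullForms e k))
    ((nullCoboundaries e k).submoduleOf (nullCocycles e k))
    (Submodule.inclusion (exactNullForms_le e)) fun _ h => h

/-- Source and target are quotients by the same coboundaries, so injectivity is formal. -/
theorem exactNullMap_injective (k : ℕ) : Function.Injective (exactNullMap e k) := by
  rw [injective_iff_map_eq_zero]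
  intro a ha
  obtain ⟨ρ, rfl⟩ := Submodule.Quotient.mk_surjective _ a
  have h : (Submodule.inclusion (exactNullForms_le e) ρ : nullCocycles e k) ∈
      (nullCoboundaries e k).submoduleOf (nullCocycles e k) :=
    (Submodule.Quotient.mk_eq_zero _).1 ha
  exact (Submodule.Quotient.mk_eq_zero _).2 h

theorem exactNullMap_surjective [T2Space M] [SecondCountableTopology M] {l : ℕ} (hl : l = k + 1)
    (hln : l ≤ n) : Function.Surjective (exactNullMap e l) := by
  intro b
  obtain ⟨ρ, rfl⟩ := Submodule.Quotient.mk_surjective _ b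
  subst hl
  exact ⟨Submodule.Quotient.mk ⟨ρ, nullCocycles_le e hln ρ.2⟩, rfl⟩

/-- The horizontal differential of a conserved form. -/
def conservedDiff (k : ℕ) : conservedForms e k →ₗ[ℝ] exactNullForms e (k + 1) where
  toFun j := ⟨j.2.2.choose, j.2.2.choose_spec.1,
    Or.inr ⟨k, j, ⟨j.2.1, j.2.1⟩, j.2.2.choose_spec.2⟩⟩
  map_add' j j' := Subtype.ext (IsHorizontalDiff.unique (j + j').2.2.choose_spec.2
    (j.2.2.choose_spec.2.add j.2.1 j'.2.1 j'.2.2.choose_spec.2))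
  map_smul' c j := Subtype.ext (IsHorizontalDiff.unique (c • j).2.2.choose_spec.2
    (j.2.2.choose_spec.2.smul c))

theorem isHorizontalDiff_conservedDiff (j : conservedForms e k) :
    IsHorizontalDiff (j : RawLocalForm n Fm F k)
      (conservedDiff e k j : RawLocalForm n Fm F (k + 1)) :=
  j.2.2.choose_spec.2

theorem conservedDiff_surjective : Function.Surjective (conservedDiff e k) := by
  rintro ⟨ρ, hρ, h⟩
  obtain ⟨j, hj, h⟩ := mem_horizontalImage_succ.1 h
  refine ⟨⟨j, hj.1, ρ, hρ, h⟩, Subtype.ext ?_⟩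
  exact (isHorizontalDiff_conservedDiff e _).unique h

/-- The on-shell class of a conserved form. -/
def conservedToOnShell (k : ℕ) : conservedForms e k →ₗ[ℝ] onShellClosed e k :=
  ((restrict e k).comp (conservedForms e k).subtype).codRestrict _ fun j =>
    Submodule.mem_map_of_mem j.2

/-- `j ↦ [j]` modulo de Rham cohomology. -/
def currentClass (k : ℕ) :
    conservedForms e k →ₗ[ℝ] (HChar e k ⧸ LinearMap.range (deRhamToChar e k)) :=
  (Submodule.mkQ _).comp ((Submodule.mkQ _).comp (conservedToOnShell e k))

theorem currentClass_surjective : Function.Surjective (currentClass e k) := by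
  refine (Submodule.mkQ_surjective _).comp ((Submodule.mkQ_surjective _).comp ?_)
  rintro ⟨_, j, hj, rfl⟩
  exact ⟨⟨j, hj⟩, rfl⟩

/-- `j ↦ [d_h j]`. -/
def sourceClass (k : ℕ) : conservedForms e k →ₗ[ℝ] (exactNullForms e (k + 1) ⧸
    (nullCoboundaries e (k + 1)).submoduleOf (exactNullForms e (k + 1))) :=
  (Submodule.mkQ _).comp (conservedDiff e k)

theorem sourceClass_surjective : Function.Surjective (sourceClass e k) :=
  (Submodule.mkQ_surjective _).comp (conservedDiff_surjective e)

/-- The null primitive `j'` may differ from `j` itself; only the equality of their differentials is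
asserted. -/
theorem sourceClass_eq_zero_iff (j : conservedForms e k) : sourceClass e k j = 0 ↔
    ∃ j' ∈ nullForms e k, IsHorizontalDiff j' (conservedDiff e k j : RawLocalForm n Fm F (k + 1)) := by
  change Submodule.Quotient.mk _ = _ ↔ _
  rw [Submodule.Quotient.mk_eq_zero]
  change _ ∈ nullCoboundaries e (k + 1) ↔ _
  rw [nullCoboundaries, Submodule.mem_inf, mem_horizontalImage_succ]
  exact ⟨fun ⟨_, j', hj', h⟩ => ⟨j', hj'.2, h⟩,
    fun ⟨j', hj', h⟩ => ⟨(conservedDiff e k j).2.1, j', ⟨hj'.1, hj'⟩, h⟩⟩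

theorem currentClass_eq_zero_iff (j : conservedForms e k) : currentClass e k j = 0 ↔
    ∃ α ∈ closedForms n M k, ∃ i ∈ LocalForm n Fm F k ⊓ horizontalImage (LocalForm n Fm F) k,
      (j : RawLocalForm n Fm F k) - fieldIndependent k α - i ∈ nullForms e k := by
  have h1 : currentClass e k j = 0 ↔ ∃ α : closedForms n M k,
      conservedToOnShell e k j - closedToOnShell e k α ∈
        (onShellExact e k).submoduleOf (onShellClosed e k) := by
    change Submodule.Quotient.mk _ = _ ↔ _
    rw [Submodule.Quotient.mk_eq_zero]
    constructor
    · rintro ⟨a, ha⟩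
      obtain ⟨α, rfl⟩ := Submodule.Quotient.mk_surjective _ a
      refine ⟨α, (Submodule.Quotient.eq _).1 ?_⟩
      exact ha.symm
    · rintro ⟨α, h⟩
      exact ⟨Submodule.Quotient.mk α, ((Submodule.Quotient.eq _).2 h).symm⟩
  rw [h1]
  constructor
  · rintro ⟨α, i, hi, h⟩
    refine ⟨α, α.2, i, hi, sub_mem (sub_mem j.2.1 (fieldIndependent_mem α.2.1)) hi.1,
      fun θ hθ => ?_⟩
    have h2 : i θ = (j : RawLocalForm n Fm F k) θ - fieldIndependent k (α : RawForm n M k) θ :=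
      congrFun h (⟨θ, hθ⟩ : pde e)
    change (j : RawLocalForm n Fm F k) θ - fieldIndependent k (α : RawForm n M k) θ - i θ = 0
    rw [h2, sub_self]
  · rintro ⟨α, hα, i, hi, h⟩
    refine ⟨⟨α, hα⟩, i, hi, funext fun θ => ?_⟩
    exact (sub_eq_zero.1 (h.2 θ.1 θ.2)).symm

/-- If `j` is a closed form on `M` plus an exact form plus a null form, then the null part has the
same differential as `j`. Conversely, if a null `j'` has the same differential as `j`, then `j - j'`
is closed of degree below `n`, hence a closed form on `M` plus an exact form. -/
theorem ker_currentClass [T2Space M] [SecondCountableTopology M] (hk : k < n) :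
    LinearMap.ker (currentClass e k) = LinearMap.ker (sourceClass e k) := by
  ext j
  rw [LinearMap.mem_ker, LinearMap.mem_ker, currentClass_eq_zero_iff, sourceClass_eq_zero_iff]
  have hd := isHorizontalDiff_conservedDiff e j
  constructor
  · rintro ⟨α, hα, i, hi, h⟩
    refine ⟨_, h, ?_⟩
    have h1 : IsHorizontalDiff (fieldIndependent k α : RawLocalForm n Fm F k)
      (0 : RawLocalForm n Fm F (k + 1)) := fun _ => hα.2
    have h2 := (hd.add j.2.1 (Submodule.smul_mem _ (-1 : ℝ) (fieldIndependent_mem hα.1))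
      (h1.smul (-1))).add (add_mem j.2.1 (Submodule.smul_mem _ (-1 : ℝ)
      (fieldIndependent_mem hα.1))) (Submodule.smul_mem _ (-1 : ℝ) hi.1)
      ((isHorizontalDiff_zero_of_mem hi.2).smul (-1))
    rwa [smul_zero, add_zero, add_zero, neg_one_smul, neg_one_smul, ← sub_eq_add_neg,
      ← sub_eq_add_neg] at h2
  · rintro ⟨j', hj', h⟩
    have h1 := hd.add j.2.1 (Submodule.smul_mem _ (-1 : ℝ) hj'.1) (h.smul (-1))
    rw [neg_one_smul, neg_one_smul, add_neg_cancel, ← sub_eq_add_neg] at h1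
    obtain ⟨α, hα, hi⟩ := exists_closedForm_sub_mem hk (sub_mem j.2.1 hj'.1) h1
    refine ⟨α, hα, _, hi, ?_⟩
    convert hj' using 1
    abel

/-- The isomorphism between conserved currents and sources. -/
def currentEquiv [T2Space M] [SecondCountableTopology M] (hk : k < n) :
    (HChar e k ⧸ LinearMap.range (deRhamToChar e k)) ≃ₗ[ℝ] (exactNullForms e (k + 1) ⧸
      (nullCoboundaries e (k + 1)).submoduleOf (exactNullForms e (k + 1))) :=
  ((currentClass e k).quotKerEquivOfSurjective (currentClass_surjective e)).symm ≪≫ₗ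
    Submodule.quotEquivOfEq _ _ (ker_currentClass e hk) ≪≫ₗ
    (sourceClass e k).quotKerEquivOfSurjective (sourceClass_surjective e)

theorem currentEquiv_apply [T2Space M] [SecondCountableTopology M] (hk : k < n)
    (j : conservedForms e k) : currentEquiv e hk (currentClass e k j) = sourceClass e k j := by
  have h : ((currentClass e k).quotKerEquivOfSurjective (currentClass_surjective e)).symm
      (currentClass e k j) = Submodule.Quotient.mk j := by
    rw [LinearEquiv.symm_apply_eq]
    rfl
  rw [currentEquiv, LinearEquiv.trans_apply, LinearEquiv.trans_apply, h]
  rfl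

/-- The free index `l` allows the degree `n - p`, which is only propositionally equal to `n - p - 1
+ 1`. -/
theorem exists_currentEquiv [T2Space M] [SecondCountableTopology M] {l : ℕ} (hl : l = k + 1)
    (hk : k < n) :
    ∃ Φ : (HChar e k ⧸ LinearMap.range (deRhamToChar e k)) ≃ₗ[ℝ]
        (exactNullForms e l ⧸ (nullCoboundaries e l).submoduleOf (exactNullForms e l)),
      ∀ j (hj : j ∈ conservedForms e k), ∃ ρ : exactNullForms e l,
        IsHorizontalDiff j (ρ : RawLocalForm n Fm F l) ∧
          Φ (Submodule.Quotient.mk (Submodule.Quotient.mk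
            ⟨restrict e k j, Submodule.mem_map_of_mem hj⟩)) = Submodule.Quotient.mk ρ := by
  subst hl
  exact ⟨currentEquiv e hk, fun j hj => ⟨conservedDiff e k ⟨j, hj⟩,
    isHorizontalDiff_conservedDiff e ⟨j, hj⟩, currentEquiv_apply e hk ⟨j, hj⟩⟩⟩

end Cohomology

end

end VarBicomplex

/-! ### The main theorem -/

theorem mainTheorem3 (n : ℕ)
    {M : Type*} [TopologicalSpace M] [ChartedSpace (Coord n) M]
    [IsManifold (𝓡 n) ∞ M] [T2Space M] [SecondCountableTopology M] [ConnectedSpace M]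
    {Fm : Type*} [NormedAddCommGroup Fm] [NormedSpace ℝ Fm] [FiniteDimensional ℝ Fm]
    {F : M → Type*} [TopologicalSpace (TotalSpace Fm F)] [∀ x, TopologicalSpace (F x)]
    [FiberBundle Fm F] [∀ x, AddCommGroup (F x)] [∀ x, Module ℝ (F x)]
    [VectorBundle ℝ Fm F] [ContMDiffVectorBundle ∞ Fm F (𝓡 n)]
    {Gm : Type*} [NormedAddCommGroup Gm] [NormedSpace ℝ Gm] [FiniteDimensional ℝ Gm]
    {G : M → Type*} [TopologicalSpace (TotalSpace Gm G)] [∀ x, TopologicalSpace (G x)]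
    [FiberBundle Gm G] [∀ x, AddCommGroup (G x)] [∀ x, Module ℝ (G x)]
    [VectorBundle ℝ Gm G] [ContMDiffVectorBundle ∞ Gm G (𝓡 n)]
    (e : Sec n Fm F →ₗ[ℝ] Sec n Gm G)
    (he : IsDifferentialOperator e) :
    Subsingleton (HSrc e n) ∧
    Subsingleton (HNull e 0) ∧
    ∀ p < n,
      Function.Injective (deRhamToChar e (n - p - 1)) ∧
      (∃ (hle : nullSources e p ≤ nullCocycles e (n - p))
          (Ψ : HSrc e p ≃ₗ[ℝ] HNull e (n - p)),
        ∀ ρ : nullSources e p,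
          Ψ (Submodule.Quotient.mk ρ) = Submodule.Quotient.mk ⟨ρ, hle ρ.2⟩) ∧
      (∃ Φ : (HChar e (n - p - 1) ⧸ LinearMap.range (deRhamToChar e (n - p - 1))) ≃ₗ[ℝ] HSrc e p,
        ∀ j (hj : j ∈ conservedForms e (n - p - 1)),
          ∃ ρ : nullSources e p, IsHorizontalDiff j (ρ : RawLocalForm n Fm F (n - p)) ∧
            Φ (Submodule.Quotient.mk (Submodule.Quotient.mk
              ⟨restrict e (n - p - 1) j, Submodule.mem_map_of_mem hj⟩)) =
                Submodule.Quotient.mk ρ) ∧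
      Nonempty (HSrc e p ≃ₗ[ℝ] HCur e (p + 1)) := by
  refine ⟨⟨fun a b => ?_⟩, ⟨fun a b => ?_⟩, fun p hp => ?_⟩
  · obtain ⟨ρ, rfl⟩ := Submodule.Quotient.mk_surjective _ a
    obtain ⟨ρ', rfl⟩ := Submodule.Quotient.mk_surjective _ b
    have h : ∀ ρ : nullSources e n, ρ = 0 := fun ρ =>
      Subtype.ext (exactNullForms_degree_zero e (Nat.sub_self n) ρ.2)
    rw [h ρ, h ρ']
  · obtain ⟨ρ, rfl⟩ := Submodule.Quotient.mk_surjective _ a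
    obtain ⟨ρ', rfl⟩ := Submodule.Quotient.mk_surjective _ b
    have h : ∀ ρ : nullCocycles e 0, ρ = 0 := fun ρ =>
      Subtype.ext (nullCocycles_degree_zero e ρ.2)
    rw [h ρ, h ρ']
  · have hl : n - p = n - p - 1 + 1 := by omega
    obtain ⟨Φ, hΦ⟩ := exists_currentEquiv e hl (by omega)
    -- Null `p`-sources unfold to exact null forms of degree `n - p`, and `n - (p + 1)` reduces to
    -- `n - p - 1`, so the inverse of the same isomorphism `Φ` also serves the last claim, about
    -- `HCur`.
    exact ⟨injective_deRhamToChar e _, ⟨exactNullForms_le e,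
      LinearEquiv.ofBijective (exactNullMap e (n - p))
        ⟨exactNullMap_injective e _, exactNullMap_surjective e hl (Nat.sub_le n p)⟩,
      fun _ => rfl⟩, ⟨Φ, hΦ⟩, ⟨Φ.symm⟩⟩
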